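/- Setting. Let $G$ be a group with a finite presentation $\mathcal A=\langle S\mid R\rangle$, $S\subset G$, and let $P_1,\dots,P_n$ be subgroups of $G$ such that $S\cap P_i$ generates $P_i$ for each $i$ (as is the case when $\mathcal A$ contains finite sub-presentations of the $P_i$). Let $X=X(G,\{P_i\},\mathcal A)$ be the cusped space of Groves and Manning: the Cayley 2-complex of $\mathcal A$ with, for each $i$ and each left coset $gP_i$, the combinatorial horoball (a 2-complex) based on the full subgraph $\Gamma(gP_i)$ of the Cayley graph glued along $\Gamma(gP_i)$. The base vertex $\ast$ is the identity of $G$, $d$ is the edge path metric on $X^{(1)}$, and $X^{(1)}$ is assumed to be $\delta$-hyperbolic in the sense that geodesic triangles are $\delta$-thin, with $\delta\ge 1$ an integer. $\partial X$ is the Gromov boundary, the set of classes $[r]$ of geodesic rays $r$ at $\ast$ (rays being equivalent if they stay at bounded distance), with its usual topology. For a vertex $v$, $St_m(v)$ is the full subcomplex of $X$ on the vertices at distance at most $m$ from $v$, and $B_m(v)$ is its 1-skeleton. A filter is a connected graph $F\subset[0,1]\times[0,\infty)$ with the following properties. Its vertices are points $(t,m)$ with $m\ge 0$ an integer, finitely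 many at each height $m$ and including $(0,m)$ and $(1,m)$. If $(t,m)$ is a vertex then so is $(t,m+1)$, and the two are joined by a vertical edge. The horizontal edges at height $m$ join the consecutive vertices of height $m$, forming an edge path from $(0,m)$ to $(1,m)$. All edges are of these two kinds. The components of $[0,1]\times[0,\infty)-F$ are open rectangles. Theorem. Let $K\ge\delta$ be an integer. There is an integer $A$ such that (0) for every vertex $v$ of $X$, every edge path loop through $v$ with image in $B_{2K+\delta+1}(v)$ is homotopically trivial in $St_A(v)$. Let $A=A(2K+\delta+1)$ be any integer with property (0). Let $s_1,s_2$ be geodesic edge path rays at $\ast$ in $X$ with $[s_1]\ne[s_2]$ in $\partial X$. For $i\in\{1,2\}$ let $s_i'$ be an edge path ray at $\ast$ with $d(s_i(k),s_i'(k))\le K$ for all integers $k\ge 0$. Let $\gamma$ be a path in $\partial X$ from $[s_1]$ to $[s_2]$. Then there are a filter $F$ and a proper homotopy $f:[0,1]\times[0,\infty)\to X$ of $s_1'$ to $s_2'$ rel $\{\ast\}$ (that is, $f$ is continuous, preimages of compact sets are compact, $f(0,t)=s_1'(t)$, $f(1,t)=s_2'(t)$ and $f(t,0)=\ast$) such that: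 (1) If $(t,m)$ is a vertex of $F$ with $t\notin\{0,1\}$, then $f$ restricted to $\{t\}\times[m,\infty)$ is the tail of a geodesic edge path ray at $\ast$ representing a point of $\gamma$: there is a geodesic edge path ray $r$ at $\ast$ with $[r]$ in the image of $\gamma$ and $f(t,u)=r(u)$ for all real $u\ge m$. (2) Each horizontal edge of $F$ is mapped (at constant speed) to an edge path of length at most $K+2\delta$. (3) If $R$ is a component of $[0,1]\times[0,\infty)-F$ and $v$ is the upper left vertex of $R$, then $f(v)$ is a vertex, $f(\partial R)\subset B_{2K+\delta+1}(f(v))$ and $f(R)\subset St_A(f(v))$. (4) If $(a,b)$ is a vertex of $F$ and $\tau$ is the vertical segment from $(a,0)$ to $(a,b)$, then $f(\tau)$ and any geodesic edge path $q$ from $\ast$ to the vertex $f(a,b)$ synchronously $(2\delta+A)$-track one another: if $l$ is the length of $q$, then $f(a,\min(u,b))\in St_{2\delta+A}\big(q(\min(\lceil u\rceil,l))\big)$ for all real $u\ge 0$. -/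

import Mathlib

open Set Topology unitInterval
open scoped NNReal

universe u

/-! ### Graphs and 2-complexes -/

/-- A graph (1-complex), loops and multiple edges allowed: `D` is the set of oriented edges, `inv`
reverses an oriented edge, and an edge is a pair `{d, inv d}`. -/
structure DartGraph where
  V : Type u
  D : Type u
  src : D → V
  inv : D → D
  inv_inv : ∀ d, inv (inv d) = d
  inv_ne : ∀ d, inv d ≠ d

namespace DartGraph

variable (Γ : DartGraph.{u})

/-- The end point of an oriented edge. -/
def tgt (d : Γ.D) : Γ.V := Γ.src (Γ.inv d)

/-- `p` is an edge path from `x` to `y`. -/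
def IsWalk : Γ.V → List Γ.D → Γ.V → Prop
  | x, [], y => x = y
  | x, d :: p, y => Γ.src d = x ∧ IsWalk (Γ.tgt d) p y

/-- The underlying simple graph, used for the edge path metric. -/
def toSimple : SimpleGraph Γ.V where
  Adj x y := x ≠ y ∧ ∃ d, Γ.src d = x ∧ Γ.tgt d = y
  symm := ⟨by
    rintro x y ⟨hne, d, hx, hy⟩
    exact ⟨hne.symm, Γ.inv d, hy, by rw [tgt, Γ.inv_inv]; exact hx⟩⟩
  loopless := ⟨fun x h => h.1 rfl⟩

/-- The edge path metric on vertices. -/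
noncomputable def dist (x y : Γ.V) : ℕ := Γ.toSimple.dist x y

/-- `q 0, …, q l` are the consecutive vertices of a geodesic edge path from `x` to `y`. -/
def IsGeodSeg (q : ℕ → Γ.V) (l : ℕ) (x y : Γ.V) : Prop :=
  q 0 = x ∧ q l = y ∧ ∀ i j, i ≤ j → j ≤ l → Γ.dist (q i) (q j) = j - i

/-- Geodesic triangles with vertices `x, y, z` are `δ`-thin: for two sides issuing from a corner
`x`, points at the same distance `k ≤ (d(x,y) + d(x,z) - d(y,z)) / 2` from `x` (these are the points
with the same image in the comparison tripod) are at distance at most `δ`.  The condition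
is asked for corners and points that are vertices of the graph. -/
def IsThin (δ : ℕ) : Prop :=
  ∀ (x y z : Γ.V) (q q' : ℕ → Γ.V) (l l' : ℕ), Γ.IsGeodSeg q l x y → Γ.IsGeodSeg q' l' x z →
    ∀ k : ℕ, 2 * k + Γ.dist y z ≤ Γ.dist x y + Γ.dist x z → Γ.dist (q k) (q' k) ≤ δ

/-- An edge path ray. -/
structure EdgeRay where
  dart : ℕ → Γ.D
  chain : ∀ n, Γ.src (dart (n + 1)) = Γ.tgt (dart n)

/-- The `n`-th vertex of an edge path ray. -/
def EdgeRay.vert {Γ : DartGraph.{u}} (r : Γ.EdgeRay) (n : ℕ) : Γ.V := Γ.src (r.dart n)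

/-- A geodesic edge path ray at the vertex `x`. -/
structure GeodRay (x : Γ.V) extends Γ.EdgeRay where
  start : toEdgeRay.vert 0 = x
  geod : ∀ i j, i ≤ j → Γ.dist (toEdgeRay.vert i) (toEdgeRay.vert j) = j - i

/-- Uniform convergence on compact sets, i.e. pointwise convergence of the sequence of edges. -/
instance (x : Γ.V) : TopologicalSpace (Γ.GeodRay x) :=
  TopologicalSpace.induced (fun r => r.dart) (@Pi.topologicalSpace ℕ (fun _ => Γ.D) (fun _ => ⊥))

/-- Two geodesic rays are equivalent when they stay at bounded distance from each other. -/
def geodRaySetoid (x : Γ.V) : Setoid (Γ.GeodRay x) where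
  r r s := ∃ C : ℕ, ∀ n, Γ.dist (r.vert n) (s.vert n) ≤ C
  iseqv :=
    { refl := fun r => ⟨0, fun n => by simp [DartGraph.dist]⟩
      symm := by
        rintro r s ⟨C, h⟩
        exact ⟨C, fun n => by
          rw [DartGraph.dist, SimpleGraph.dist_comm]; exact h n⟩
      trans := by
        rintro r s t ⟨C, h⟩ ⟨C', h'⟩
        have hreach : ∀ (r : Γ.GeodRay x) (n : ℕ), Γ.toSimple.Reachable x (r.vert n) := by
          intro r n
          induction n with
          | zero => rw [r.start]
          | succ n ih =>
            refine ih.trans (SimpleGraph.Adj.reachable ?_)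
            rw [← SimpleGraph.dist_eq_one_iff_adj]
            simpa [DartGraph.dist] using r.geod n (n + 1) (Nat.le_succ n)
        refine ⟨C + C', fun n => ?_⟩
        have hrs := (hreach r n).symm.trans (hreach s n)
        obtain ⟨p, hp⟩ := hrs.exists_walk_length_eq_dist
        have hst := (hreach s n).symm.trans (hreach t n)
        obtain ⟨p', hp'⟩ := hst.exists_walk_length_eq_dist
        have h1 := SimpleGraph.dist_le (p.append p')
        rw [SimpleGraph.Walk.length_append, hp, hp'] at h1
        exact h1.trans (add_le_add (h n) (h' n)) }

/-- The Gromov boundary: classes of geodesic rays at the base vertex `x`, with the quotient of the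
topology of uniform convergence on compact sets. -/
def Boundary (x : Γ.V) : Type u := Quotient (Γ.geodRaySetoid x)

instance (x : Γ.V) : TopologicalSpace (Γ.Boundary x) :=
  inferInstanceAs (TopologicalSpace (Quotient (Γ.geodRaySetoid x)))

variable {Γ} in
/-- The boundary point `[r]` to which a geodesic ray converges. -/
def GeodRay.toBoundary {x : Γ.V} (r : Γ.GeodRay x) : Γ.Boundary x :=
  Quotient.mk (Γ.geodRaySetoid x) r

/-- A circuit: a nontrivial closed edge path without repeated vertices. -/
def IsCircuit (p : List Γ.D) : Prop :=
  p ≠ [] ∧ (∃ x, Γ.IsWalk x p x) ∧ (p.map Γ.src).Nodup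

/-- The oriented edges lying on an edge path, with both orientations: this represents the set
of unoriented edges of the path. -/
def edgeSet (p : List Γ.D) : Set Γ.D := {d | d ∈ p ∨ Γ.inv d ∈ p}

/-- The reverse edge path. -/
def revPath (p : List Γ.D) : List Γ.D := (p.map Γ.inv).reverse

theorem revPath_revPath (p : List Γ.D) : Γ.revPath (Γ.revPath p) = p := by
  simp [revPath, List.map_reverse, Function.comp_def, Γ.inv_inv]

theorem revPath_isRotated {p q : List Γ.D} (h : p ~r q) : Γ.revPath p ~r Γ.revPath q :=
  (h.map Γ.inv).reverse

/-- Closed edge paths up to the choice of the starting point and of the direction. -/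
def cyclicSetoid (Q : List Γ.D → Prop) : Setoid {p : List Γ.D // Q p} where
  r p q := p.1 ~r q.1 ∨ p.1 ~r Γ.revPath q.1
  iseqv :=
    { refl := fun p => Or.inl (List.IsRotated.refl _)
      symm := by
        rintro p q (h | h)
        · exact Or.inl h.symm
        · right
          have := Γ.revPath_isRotated h
          rw [Γ.revPath_revPath] at this
          exact this.symm
      trans := by
        rintro p q r (h | h) (h' | h')
        · exact Or.inl (h.trans h')
        · exact Or.inr (h.trans h')
        · exact Or.inr (h.trans (Γ.revPath_isRotated h'))
        · have := Γ.revPath_isRotated h'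
          rw [Γ.revPath_revPath] at this
          exact Or.inl (h.trans this) }

end DartGraph

/-- A 2-complex: a graph together with 2-cells attached along closed edge paths. -/
structure TwoComplex extends DartGraph.{u} where
  C : Type u
  base : C → V
  bdry : C → List D
  closed : ∀ c, toDartGraph.IsWalk (base c) (bdry c) (base c)

namespace TwoComplex

variable (X : TwoComplex.{u})

/-- The closed unit disc. -/
abbrev Disc : Type := Metric.closedBall (0 : ℂ) 1

/-- The disjoint union of all vertices, (oriented) edges and closed 2-cells. -/
abbrev Pre : Type u := (Σ _ : X.V, PUnit.{1}) ⊕ (Σ _ : X.D, I) ⊕ (Σ _ : X.C, Disc)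

/-- The point `exp (2 π i θ)` of the boundary circle of the disc. -/
noncomputable def circlePt (θ : ℝ) : Disc :=
  ⟨Complex.exp (2 * Real.pi * θ * Complex.I), by
    have h := Complex.norm_exp_ofReal_mul_I (2 * Real.pi * θ)
    push_cast at h
    rw [mem_closedBall_zero_iff, h]⟩

/-- The gluing of edges and 2-cells.  The boundary circle of a 2-cell with boundary path of `n ≥ 1`
edges is divided in `n` arcs of equal length, mapped to the successive edges; the
boundary circle is mapped to the base vertex when `n = 0`. -/
inductive Glue : X.Pre → X.Pre → Prop
  | start (d : X.D) : Glue (.inr (.inl ⟨d, 0⟩)) (.inl ⟨X.src d, PUnit.unit⟩)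
  | flip (d : X.D) (t : I) : Glue (.inr (.inl ⟨d, t⟩)) (.inr (.inl ⟨X.inv d, σ t⟩))
  | attach (c : X.C) (j : Fin (X.bdry c).length) (t : I) :
      Glue (.inr (.inr ⟨c, circlePt (((j : ℕ) + (t : ℝ)) / (X.bdry c).length)⟩))
        (.inr (.inl ⟨(X.bdry c).get j, t⟩))
  | attachNil (c : X.C) (h : X.bdry c = []) (θ : ℝ) :
      Glue (.inr (.inr ⟨c, circlePt θ⟩)) (.inl ⟨X.base c, PUnit.unit⟩)

/-- The topological realization of a 2-complex. -/
def Space : Type u := Quot X.Glue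

instance : TopologicalSpace X.Space := inferInstanceAs (TopologicalSpace (Quot X.Glue))

/-- The point of the realization given by a vertex. -/
def vertexPt (x : X.V) : X.Space := Quot.mk _ (.inl ⟨x, PUnit.unit⟩)

/-- The point at time `t` on an oriented edge. -/
def edgePt (d : X.D) (t : I) : X.Space := Quot.mk _ (.inr (.inl ⟨d, t⟩))

/-- The image of a point of the closed disc in a closed 2-cell. -/
def cellPt (c : X.C) (z : Disc) : X.Space := Quot.mk _ (.inr (.inr ⟨c, z⟩))

/-- The map `ℝ → X` which runs through the edges of the edge path `p` starting at `x` at unit speed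
from time `0` to time `p.length`, and is constant before and after. -/
noncomputable def walkPt : X.V → List X.D → ℝ → X.Space
  | x, [], _ => X.vertexPt x
  | _, d :: p, t =>
    if t ≤ 1 then X.edgePt d (projIcc 0 1 zero_le_one t) else walkPt (X.tgt d) p (t - 1)

/-- The map `[0,∞) → X` given by an edge path ray, with unit speed. -/
noncomputable def rayPt (r : X.EdgeRay) (t : ℝ≥0) : X.Space :=
  X.edgePt (r.dart ⌊t⌋₊) (projIcc 0 1 zero_le_one ((t : ℝ) - (⌊t⌋₊ : ℕ)))

/-- `B_n(v)`: the full subgraph of the 1-skeleton on the vertices at distance at most `n` of `v`. -/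
def ball (n : ℕ) (v : X.V) : Set X.Space :=
  {y | (∃ x, X.dist v x ≤ n ∧ y = X.vertexPt x) ∨
    ∃ d t, X.dist v (X.src d) ≤ n ∧ X.dist v (X.tgt d) ≤ n ∧ y = X.edgePt d t}

/-- `St_n(v)`: the full subcomplex on the vertices at distance at most `n` of `v`.  Its
1-skeleton is `B_n(v)`. -/
def star (n : ℕ) (v : X.V) : Set X.Space :=
  X.ball n v ∪ {y | ∃ c z, X.dist v (X.base c) ≤ n ∧ (∀ d ∈ X.bdry c, X.dist v (X.src d) ≤ n) ∧
    y = X.cellPt c z}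

/-- Every edge path loop through a vertex `v` with image in `B_R(v)` is homotopically trivial in
`St_A(v)`. -/
def IsFillingRadius (R A : ℕ) : Prop :=
  ∀ (v : X.V) (p : List X.D), X.IsWalk v p v → (∀ d ∈ p, X.dist v (X.src d) ≤ R) →
    ∃ H : I × I → X.Space, Continuous H ∧ (∀ z, H z ∈ X.star A v) ∧
      (∀ t, H (0, t) = X.walkPt v p ((t : ℝ) * p.length)) ∧ (∀ t, H (1, t) = X.vertexPt v) ∧
      ∀ s, H (s, 0) = X.vertexPt v ∧ H (s, 1) = X.vertexPt v

end TwoComplex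

/-! ### Cusped spaces -/

/-- A finite presentation `⟨S | R⟩` of the group `G` (relators are words in the letters `S` and their
inverses) and a finite family of subgroups `P i`, such that `S` contains generators of each `P i`. -/
structure PeripheralPresentation (G : Type u) [Group G] (n : ℕ) where
  S : Set G
  S_finite : S.Finite
  S_gen : Subgroup.closure S = ⊤
  R : Set (List (S × Bool))
  R_finite : R.Finite
  R_pres : Subgroup.normalClosure (FreeGroup.mk '' R) =
    (FreeGroup.lift (Subtype.val : S → G)).ker
  P : Fin n → Subgroup G
  P_gen : ∀ i, Subgroup.closure (S ∩ P i) = P i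

namespace PeripheralPresentation

variable {G : Type u} [Group G] {n : ℕ} (𝒜 : PeripheralPresentation G n)

/-- `g` and `h` lie in the same left coset of `P i` and are at distance at most `m` in the full
subgraph of the Cayley graph on this coset, i.e. for the generating set `S ∩ P i`. -/
def Within (i : Fin n) (m : ℕ) (g h : G) : Prop :=
  ∃ l : List G, l.length ≤ m ∧ (∀ x ∈ l, x ∈ 𝒜.P i ∧ (x ∈ 𝒜.S ∨ x⁻¹ ∈ 𝒜.S)) ∧ g * l.prod = h

theorem Within.symm {i : Fin n} {m : ℕ} {g h : G} (H : 𝒜.Within i m g h) : 𝒜.Within i m h g := by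
  obtain ⟨l, hl, hS, rfl⟩ := H
  refine ⟨(l.map (·⁻¹)).reverse, by simpa using hl, ?_, ?_⟩
  · intro x hx
    simp only [List.mem_reverse, List.mem_map] at hx
    obtain ⟨y, hy, rfl⟩ := hx
    refine ⟨inv_mem (hS y hy).1, ?_⟩
    rw [inv_inv]
    exact (hS y hy).2.symm
  · rw [← List.prod_inv_reverse, mul_assoc, mul_inv_cancel, mul_one]

/-- Vertices of the cusped space: the elements of `G`, and for each `i` and each `g` the
vertices over `g`, of depth `k + 1`, of the horoball based on the coset `g (P i)`. -/
inductive Vertex (G : Type u) (n : ℕ) : Type u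
  | base (g : G)
  | horo (i : Fin n) (g : G) (k : ℕ)

/-- The vertex of depth `k` over `g` in the horoball based on `g (P i)`. -/
def Vertex.at (i : Fin n) (g : G) : ℕ → Vertex G n
  | 0 => .base g
  | k + 1 => .horo i g k

/-- Oriented edges of the cusped space: the edge of the Cayley graph from `g` to `g * s` and its
reverse; the horizontal edges of depth `k + 1`, joining points of a coset of `P i`
at distance between `1` and `2 ^ (k + 1)`; the vertical edges over `g` between the depths `k` and
`k + 1`. -/
inductive Dart : Type u
  | cayley (g : G) (s : 𝒜.S) (forward : Bool)
  | horiz (i : Fin n) (k : ℕ) (g h : G) (hne : g ≠ h) (hd : 𝒜.Within i (2 ^ (k + 1)) g h)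
  | vert (i : Fin n) (g : G) (k : ℕ) (up : Bool)

/-- The initial vertex of an oriented edge. -/
def Dart.src : 𝒜.Dart → Vertex G n
  | .cayley g _ true => .base g
  | .cayley g s false => .base (g * s)
  | .horiz i k g _ _ _ => .horo i g k
  | .vert i g k true => .at i g k
  | .vert i g k false => .at i g (k + 1)

/-- The reverse of an oriented edge. -/
def Dart.inv : 𝒜.Dart → 𝒜.Dart
  | .cayley g s b => .cayley g s (!b)
  | .horiz i k g h hne hd => .horiz i k h g hne.symm (Within.symm 𝒜 hd)
  | .vert i g k b => .vert i g k (!b)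

/-- The 1-skeleton of the cusped space. -/
abbrev graph : DartGraph.{u} where
  V := Vertex G n
  D := 𝒜.Dart
  src := Dart.src 𝒜
  inv := Dart.inv 𝒜
  inv_inv := by rintro (_ | _ | _) <;> simp [Dart.inv]
  inv_ne := by
    rintro (⟨g, s, b⟩ | ⟨i, k, g, h, hne, hd⟩ | ⟨i, g, k, b⟩)
    · simp [Dart.inv]
    · simp only [Dart.inv, ne_eq, Dart.horiz.injEq, true_and]
      exact fun h => hne h.2
    · simp [Dart.inv]

/-- The oriented edges in the horoballs based on the cosets of `P i`. -/
def Dart.InHoroball (i : Fin n) : 𝒜.Dart → Prop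
  | .cayley _ s _ => (s : G) ∈ 𝒜.P i
  | .horiz j _ _ _ _ _ => j = i
  | .vert j _ _ _ => j = i

/-- Vertical edges; the others are the horizontal edges. -/
def Dart.isVert : 𝒜.Dart → Bool
  | .vert _ _ _ _ => true
  | _ => false

/-- A circuit in a horoball over a coset of `P i`, with `h` horizontal and `v` vertical edges. -/
def IsHoroCircuit (i : Fin n) (h v : ℕ) (p : List 𝒜.Dart) : Prop :=
  𝒜.graph.IsCircuit p ∧ (∀ d ∈ p, Dart.InHoroball 𝒜 i d) ∧ p.length = h + v ∧
    p.countP (Dart.isVert 𝒜) = v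

/-- The circuits that bound a 2-cell of a combinatorial horoball: horizontal triangles, vertical
squares, and vertical pentagons unless they bound the union of a vertical square and
a horizontal triangle. -/
def BoundsHoroCell (i : Fin n) (p : List 𝒜.Dart) : Prop :=
  IsHoroCircuit 𝒜 i 3 0 p ∨ IsHoroCircuit 𝒜 i 2 2 p ∨
    (IsHoroCircuit 𝒜 i 3 2 p ∧ ¬ ∃ q t, IsHoroCircuit 𝒜 i 2 2 q ∧ IsHoroCircuit 𝒜 i 3 0 t ∧
      𝒜.graph.edgeSet p = symmDiff (𝒜.graph.edgeSet q) (𝒜.graph.edgeSet t))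

theorem BoundsHoroCell.isCircuit {i : Fin n} {p : List 𝒜.Dart} (h : BoundsHoroCell 𝒜 i p) :
    𝒜.graph.IsCircuit p := by
  rcases h with h | h | h
  exacts [h.1, h.1, h.1.1]

/-- The 2-cells of the horoballs over the cosets of `P i`: one for each circuit as above, regardless
of its starting point and direction. -/
def HoroCell (i : Fin n) : Type u := Quotient (𝒜.graph.cyclicSetoid (BoundsHoroCell 𝒜 i))

/-- A boundary path of a 2-cell of a horoball. -/
noncomputable def HoroCell.path {i : Fin n} (c : HoroCell 𝒜 i) : List 𝒜.Dart :=
  (Quotient.out c).1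

theorem HoroCell.isCircuit {i : Fin n} (c : HoroCell 𝒜 i) : 𝒜.graph.IsCircuit c.path :=
  BoundsHoroCell.isCircuit 𝒜 (Quotient.out c).2

/-- The edge path in the Cayley graph starting at `g` and reading the word `w`. -/
def wordPath : G → List (𝒜.S × Bool) → List 𝒜.Dart
  | _, [] => []
  | g, (s, true) :: w => .cayley g s true :: wordPath (g * s) w
  | g, (s, false) :: w => .cayley (g * (s : G)⁻¹) s false :: wordPath (g * (s : G)⁻¹) w

theorem isWalk_wordPath (w : List (𝒜.S × Bool)) (g : G) :
    𝒜.graph.IsWalk (.base g) (wordPath 𝒜 g w)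
      (.base (g * FreeGroup.lift (Subtype.val : 𝒜.S → G) (FreeGroup.mk w))) := by
  induction w generalizing g with
  | nil =>
    simp only [wordPath, DartGraph.IsWalk, ← FreeGroup.one_eq_mk, map_one, mul_one]
  | cons a w ih =>
    obtain ⟨s, b⟩ := a
    cases b
    · refine ⟨by simp [graph, Dart.src], ?_⟩
      have := ih (g * (s : G)⁻¹)
      simpa [DartGraph.tgt, graph, Dart.src, Dart.inv, mul_assoc] using this
    · refine ⟨by simp [graph, Dart.src], ?_⟩
      have := ih (g * (s : G))
      simpa [DartGraph.tgt, graph, Dart.src, Dart.inv, mul_assoc] using this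

/-- The cusped space: the Cayley 2-complex of the presentation, with a combinatorial horoball
attached along each left coset of each `P i`. -/
noncomputable def cuspedSpace : TwoComplex.{u} where
  toDartGraph := 𝒜.graph
  C := (G × 𝒜.R) ⊕ (Σ i, HoroCell 𝒜 i)
  base
    | .inl (g, _) => .base g
    | .inr ⟨_, c⟩ => Dart.src 𝒜 (c.path.head c.isCircuit.1)
  bdry
    | .inl (g, w) => wordPath 𝒜 g w.1
    | .inr ⟨_, c⟩ => c.path
  closed := by
    rintro (⟨g, w, hw⟩ | ⟨i, c⟩)
    · have h := isWalk_wordPath 𝒜 w g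
      have hk : FreeGroup.mk w ∈ (FreeGroup.lift (Subtype.val : 𝒜.S → G)).ker := by
        rw [← 𝒜.R_pres]
        exact Subgroup.subset_normalClosure ⟨w, hw, rfl⟩
      rw [MonoidHom.mem_ker] at hk
      rw [hk, mul_one] at h
      exact h
    · obtain ⟨hne, ⟨x, hx⟩, -⟩ := c.isCircuit
      have key : ∀ (p : List 𝒜.Dart) (hp : p ≠ []), 𝒜.graph.IsWalk x p x →
          Dart.src 𝒜 (p.head hp) = x := by
        rintro (_ | ⟨d, p⟩) hp h
        · exact absurd rfl hp
        · exact h.1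
      dsimp only
      rw [key _ hne hx]
      exact hx

/-- The base vertex `∗` of the cusped space, the identity element of `G`. -/
def basePt : 𝒜.cuspedSpace.V := Vertex.base (1 : G)

end PeripheralPresentation

/-! ### Filters -/

/-- A filter in `[0,1] × [0,∞)`.  The vertices are the points `(t, m)` with `m : ℕ` and `t ∈ level m`;
a vertical edge joins each vertex `(t, m)` to `(t, m + 1)`; the horizontal edges of height `m` join
the consecutive vertices of height `m`, and so form an edge path from `(0, m)` to `(1, m)`. -/
structure StripFilter where
  level : ℕ → Finset I
  zero_mem : ∀ m, 0 ∈ level m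
  one_mem : ∀ m, 1 ∈ level m
  mono : ∀ m, level m ⊆ level (m + 1)

namespace StripFilter

variable (F : StripFilter)

/-- `(t, m)` and `(s, m)` are the left and right vertices of a horizontal edge. -/
def IsHorizontalEdge (m : ℕ) (t s : I) : Prop :=
  t ∈ F.level m ∧ s ∈ F.level m ∧ t < s ∧ ∀ u ∈ F.level m, u ≤ t ∨ s ≤ u

/-- The realization: the union of all vertical and horizontal edges. -/
def carrier : Set (I × ℝ≥0) :=
  {z | ∃ (m : ℕ) (t : I), t ∈ F.level m ∧ z.1 = t ∧ (m : ℝ≥0) ≤ z.2 ∧ z.2 ≤ m + 1} ∪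
    {z | ∃ (m : ℕ) (t s : I), F.IsHorizontalEdge m t s ∧ z.2 = m ∧ t ≤ z.1 ∧ z.1 ≤ s}

/-- `R` is a component of `[0,1] × [0,∞) - F`. -/
def IsRectangle (R : Set (I × ℝ≥0)) : Prop :=
  ∃ z ∈ F.carrierᶜ, R = connectedComponentIn F.carrierᶜ z

/-- `(t, m)` is the upper left vertex of the rectangle `R`. -/
def IsUpperLeft (R : Set (I × ℝ≥0)) (t : I) (m : ℕ) : Prop :=
  t ∈ F.level m ∧ (t, (m : ℝ≥0)) ∈ closure R ∧ ∀ z ∈ closure R, t ≤ z.1 ∧ z.2 ≤ m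

end StripFilter

/-- `f` is a proper homotopy from the edge path ray `r` to the edge path ray `s` rel the
vertex `x`. -/
def TwoComplex.IsProperHomotopyRel (X : TwoComplex.{u}) (f : I × ℝ≥0 → X.Space) (x : X.V)
    (r s : X.EdgeRay) : Prop :=
  Continuous f ∧ (∀ C : Set X.Space, IsCompact C → IsCompact (f ⁻¹' C)) ∧
    (∀ t, f (0, t) = X.rayPt r t) ∧ (∀ t, f (1, t) = X.rayPt s t) ∧ ∀ a, f (a, 0) = X.vertexPt x

/-!
# Filters for paths in the boundary of a cusped space

*Filling radii.* A loop in a ball of radius `R` is a product of loops of length at most `2 R + 1`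
through the centre (`isFillingRadius_of_short_loops`), so it suffices to fill short loops uniformly
(`exists_homot_nil`). A short loop that meets the Cayley graph has bounded depth; its horizontal edges
of depth `k` are pushed down, one level at a time, by the squares, triangles and pentagons of the
horoballs (`exists_homot_wordPath`), until the loop lies in the Cayley graph. There the group acts
with finitely many orbits on the short loops, and each is null-homotopic because the relators
normally generate the kernel of the free group (`exists_forall_wordPath_homot`). A short loop that avoids
the Cayley graph stays in one horoball. Pushed up far enough, it runs through vertices that are
pairwise joined by horizontal edges, and collapses across horizontal triangles
(`homot_nil_of_horo`).

*Rays along the path.* The cusped space is locally finite (`locallyFinite`), hence the space of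
geodesic rays is compact. Two rays are equivalent if and only if they are `δ`-close at all times, a
closed relation, so the boundary points all of whose representatives are `δ`-close to a given ray at a
given time form an open set (`isOpen_nearAt`). By Lebesgue's number lemma, arbitrary representatives
of nearby points of `γ` are `δ`-close up to time `m + 1` as soon as their parameters are `ε m`-close
(`exists_forall_dist_le`). The path is reparametrized to be constant on `[0, 1/4]` and `[3/4, 1]`; the
vertices of the filter other than the ends lie over `[1/4, 3/4]` and have mesh less than `ε m` at
height `m` (`exists_rays`). So `s₁'` and `s₂'` only bound
columns that are never subdivided, and this keeps the boundary of each rectangle close to its upper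
left vertex: an upper edge either starts at that vertex and has length at most `K + δ`, or joins
geodesic rays that are `δ`-close to each other and to the left side.

*The homotopy.* Over the vertices of the filter the homotopy follows the chosen rays, and along the
horizontal edges geodesics. The boundary of a rectangle is a loop in a ball of radius
`2 K + δ + 1` about its upper left vertex, hence contracts in the star of radius `A`, and the
rectangle can be filled there (`exists_rectangle_fill`). The rectangles form a locally finite closed
cover, on which the maps are glued (`exists_strip_fill`). The homotopy is proper because it goes to
infinity, and compact sets are closed and bounded: the realization is Hausdorff, and the
distance from a vertex extends to a continuous function on it (`distFun`). The tracking property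
follows from thinness, and from `2 K + δ + 1 ≤ A` for the two sides of the strip
(`IsFillingRadius.le`).
-/

/-! ### Edge paths -/

namespace DartGraph

variable {Γ : DartGraph.{u}}

@[simp] theorem src_inv (d : Γ.D) : Γ.src (Γ.inv d) = Γ.tgt d := rfl

@[simp] theorem tgt_inv (d : Γ.D) : Γ.tgt (Γ.inv d) = Γ.src d := by rw [tgt, Γ.inv_inv]

theorem isWalk_append {x y z : Γ.V} {p q : List Γ.D} (hp : Γ.IsWalk x p y) (hq : Γ.IsWalk y q z) :
    Γ.IsWalk x (p ++ q) z := by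
  induction p generalizing x with
  | nil => cases hp; exact hq
  | cons d p ih => exact ⟨hp.1, ih hp.2⟩

theorem revPath_cons (d : Γ.D) (p : List Γ.D) :
    Γ.revPath (d :: p) = Γ.revPath p ++ [Γ.inv d] := by
  simp [revPath]

@[simp] theorem length_revPath (p : List Γ.D) : (Γ.revPath p).length = p.length := by
  simp [revPath]

theorem revPath_append (p q : List Γ.D) :
    Γ.revPath (p ++ q) = Γ.revPath q ++ Γ.revPath p := by
  simp [revPath]

/-- `p` is an edge path from `x` to `y` all of whose vertices belong to `U`. -/
def IsWalkIn (U : Set Γ.V) : Γ.V → List Γ.D → Γ.V → Prop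
  | x, [], y => x ∈ U ∧ x = y
  | x, d :: p, y => Γ.src d = x ∧ x ∈ U ∧ IsWalkIn U (Γ.tgt d) p y

namespace IsWalkIn

variable {U W : Set Γ.V} {x y z : Γ.V} {p q : List Γ.D}

theorem isWalk (h : Γ.IsWalkIn U x p y) : Γ.IsWalk x p y := by
  induction p generalizing x with
  | nil => exact h.2
  | cons d p ih => exact ⟨h.1, ih h.2.2⟩

theorem left_mem (h : Γ.IsWalkIn U x p y) : x ∈ U := by
  cases p with
  | nil => exact h.1
  | cons d p => exact h.2.1

theorem right_mem (h : Γ.IsWalkIn U x p y) : y ∈ U := by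
  induction p generalizing x with
  | nil => exact h.2 ▸ h.1
  | cons d p ih => exact ih h.2.2

theorem mono (hU : U ⊆ W) (h : Γ.IsWalkIn U x p y) : Γ.IsWalkIn W x p y := by
  induction p generalizing x with
  | nil => exact ⟨hU h.1, h.2⟩
  | cons d p ih => exact ⟨h.1, hU h.2.1, ih h.2.2⟩

theorem append (hp : Γ.IsWalkIn U x p y) (hq : Γ.IsWalkIn U y q z) :
    Γ.IsWalkIn U x (p ++ q) z := by
  induction p generalizing x with
  | nil => obtain ⟨-, rfl⟩ := hp; exact hq
  | cons d p ih => exact ⟨hp.1, hp.2.1, ih hp.2.2⟩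

theorem of_append (h : Γ.IsWalkIn U x (p ++ q) z) :
    ∃ y, Γ.IsWalkIn U x p y ∧ Γ.IsWalkIn U y q z := by
  induction p generalizing x with
  | nil => exact ⟨x, ⟨h.left_mem, rfl⟩, h⟩
  | cons d p ih =>
    obtain ⟨y, h1, h2⟩ := ih h.2.2
    exact ⟨y, ⟨h.1, h.2.1, h1⟩, h2⟩

theorem nil (hx : x ∈ U) : Γ.IsWalkIn U x [] x := ⟨hx, rfl⟩

theorem rev (h : Γ.IsWalkIn U x p y) : Γ.IsWalkIn U y (Γ.revPath p) x := by
  induction p generalizing x with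
  | nil => obtain ⟨hx, rfl⟩ := h; exact nil hx
  | cons d p ih =>
    rw [revPath_cons]
    obtain ⟨rfl, h2, h3⟩ := h
    refine (ih h3).append ⟨rfl, h3.left_mem, ?_, ?_⟩
    · rw [tgt_inv]; exact h2
    · rw [tgt_inv]

theorem src_mem (h : Γ.IsWalkIn U x p y) {d : Γ.D} (hd : d ∈ p) : Γ.src d ∈ U := by
  induction p generalizing x with
  | nil => simp at hd
  | cons e p ih =>
    rcases List.mem_cons.1 hd with rfl | hd
    · exact h.1 ▸ h.2.1
    · exact ih h.2.2 hd

theorem right_unique (h : Γ.IsWalkIn U x p y) (h' : Γ.IsWalkIn W x p z) : y = z := by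
  induction p generalizing x with
  | nil => exact h.2.symm.trans h'.2
  | cons d p ih => exact ih h.2.2 h'.2.2

theorem left_unique {x' y' : Γ.V} (hp : p ≠ []) (h : Γ.IsWalkIn U x p y)
    (h' : Γ.IsWalkIn W x' p y') : x = x' := by
  cases p with
  | nil => exact absurd rfl hp
  | cons d p => exact h.1.symm.trans h'.1

end IsWalkIn

theorem IsWalk.isWalkIn {U : Set Γ.V} {x y : Γ.V} {p : List Γ.D} (h : Γ.IsWalk x p y)
    (hy : y ∈ U) (hU : ∀ d ∈ p, Γ.src d ∈ U) : Γ.IsWalkIn U x p y := by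
  induction p generalizing x with
  | nil => cases h; exact ⟨hy, rfl⟩
  | cons d p ih =>
    exact ⟨h.1, h.1 ▸ hU d (by simp), ih h.2 fun e he => hU e (by simp [he])⟩

theorem isWalkIn_univ {x y : Γ.V} {p : List Γ.D} : Γ.IsWalkIn univ x p y ↔ Γ.IsWalk x p y :=
  ⟨IsWalkIn.isWalk, fun h => h.isWalkIn trivial fun _ _ => trivial⟩

end DartGraph

namespace TwoComplex

variable {X : TwoComplex.{u}}

/-! ### Points of the realization -/

theorem continuous_edgePt (d : X.D) : Continuous (X.edgePt d) := by
  have h : Continuous fun t : I => (⟨d, t⟩ : Σ _ : X.D, I) :=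
    @continuous_sigmaMk _ (fun _ : X.D => I) _ d
  exact continuous_quot_mk.comp (continuous_inr.comp (continuous_inl.comp h))

theorem continuous_cellPt (c : X.C) : Continuous (X.cellPt c) := by
  have h : Continuous fun z : Disc => (⟨c, z⟩ : Σ _ : X.C, Disc) :=
    @continuous_sigmaMk _ (fun _ : X.C => Disc) _ c
  exact continuous_quot_mk.comp (continuous_inr.comp (continuous_inr.comp h))

@[simp] theorem edgePt_zero (d : X.D) : X.edgePt d 0 = X.vertexPt (X.src d) :=
  Quot.sound (Glue.start d)

theorem edgePt_inv (d : X.D) (t : I) : X.edgePt (X.inv d) t = X.edgePt d (σ t) := by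
  have := Quot.sound (Glue.flip d (σ t))
  rw [unitInterval.symm_symm] at this
  exact this.symm

@[simp] theorem edgePt_one (d : X.D) : X.edgePt d 1 = X.vertexPt (X.tgt d) := by
  rw [show (1 : I) = σ 0 by simp, ← edgePt_inv, edgePt_zero]; rfl

theorem walkPt_cons (x : X.V) (d : X.D) (p : List X.D) (t : ℝ) :
    X.walkPt x (d :: p) t =
      if t ≤ 1 then X.edgePt d (projIcc 0 1 zero_le_one t) else X.walkPt (X.tgt d) p (t - 1) := rfl

theorem walkPt_of_nonpos {x y : X.V} {p : List X.D} (h : X.IsWalk x p y) {t : ℝ} (ht : t ≤ 0) :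
    X.walkPt x p t = X.vertexPt x := by
  cases p with
  | nil => rfl
  | cons d p =>
    rw [walkPt_cons, if_pos (ht.trans zero_le_one), projIcc_of_le_left _ ht]
    exact (edgePt_zero d).trans (by rw [h.1])

theorem walkPt_cons_of_ge {x y : X.V} {d : X.D} {p : List X.D} (h : X.IsWalk x (d :: p) y) {t : ℝ}
    (ht : 1 ≤ t) : X.walkPt x (d :: p) t = X.walkPt (X.tgt d) p (t - 1) := by
  rw [walkPt_cons]
  split_ifs with h1
  · rw [walkPt_of_nonpos h.2 (by linarith), projIcc_of_right_le _ ht]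
    exact edgePt_one d
  · rfl

theorem continuous_walkPt {x y : X.V} {p : List X.D} (h : X.IsWalk x p y) :
    Continuous (X.walkPt x p) := by
  induction p generalizing x with
  | nil => exact continuous_const
  | cons d p ih =>
    refine Continuous.if_le ((continuous_edgePt d).comp continuous_projIcc)
      ((ih h.2).comp (continuous_id.sub continuous_const)) continuous_id continuous_const ?_
    rintro t rfl
    have := walkPt_cons_of_ge h (le_refl (1 : ℝ))
    rw [walkPt_cons, if_pos le_rfl] at this
    exact this

theorem walkPt_append_of_le {x y z : X.V} {p q : List X.D} (hp : X.IsWalk x p y)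
    (hq : X.IsWalk y q z) {t : ℝ} (ht : t ≤ p.length) :
    X.walkPt x (p ++ q) t = X.walkPt x p t := by
  induction p generalizing x t with
  | nil =>
    cases hp
    exact walkPt_of_nonpos hq (by simpa using ht)
  | cons d p ih =>
    rw [List.cons_append, walkPt_cons, walkPt_cons, ih hp.2]
    push_cast [List.length_cons] at ht
    linarith

theorem walkPt_append_of_ge {x y z : X.V} {p q : List X.D} (hp : X.IsWalk x p y)
    (hq : X.IsWalk y q z) {t : ℝ} (ht : p.length ≤ t) :
    X.walkPt x (p ++ q) t = X.walkPt y q (t - p.length) := by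
  induction p generalizing x t with
  | nil => cases hp; simp
  | cons d p ih =>
    push_cast [List.length_cons] at ht
    have : (0 : ℝ) ≤ p.length := Nat.cast_nonneg _
    have h := DartGraph.isWalk_append hp hq
    rw [List.cons_append] at h ⊢
    rw [walkPt_cons_of_ge h (by linarith), ih hp.2 (by linarith)]
    congr 1
    push_cast [List.length_cons]
    ring

theorem walkPt_of_ge {x y : X.V} {p : List X.D} (h : X.IsWalk x p y) {t : ℝ}
    (ht : p.length ≤ t) : X.walkPt x p t = X.vertexPt y := by
  have := walkPt_append_of_ge h (q := []) rfl ht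
  rwa [List.append_nil] at this

theorem walkPt_revPath {x y : X.V} {p : List X.D} (h : X.IsWalk x p y) (t : ℝ) :
    X.walkPt y (X.revPath p) (p.length - t) = X.walkPt x p t := by
  induction p generalizing x t with
  | nil => cases h; rfl
  | cons d p ih =>
    have hr : X.IsWalk y (X.revPath p) (X.tgt d) :=
      (DartGraph.isWalkIn_univ.2 h.2).rev.isWalk
    have hd : X.IsWalk (X.tgt d) [X.inv d] (X.src d) := ⟨rfl, X.tgt_inv d⟩
    rw [DartGraph.revPath_cons]
    rcases le_total 1 t with h1 | h1
    · rw [walkPt_append_of_le hr hd (by simp; linarith), walkPt_cons_of_ge h h1, ← ih h.2]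
      congr 1
      push_cast [List.length_cons]
      ring
    · rw [walkPt_append_of_ge hr hd (by simp; linarith), walkPt_cons, walkPt_cons, if_pos h1]
      simp only [DartGraph.length_revPath, List.length_cons]
      push_cast
      have e : ((p.length : ℝ) + 1 - t - p.length) = 1 - t := by ring
      rw [e]
      split_ifs with h2
      · rw [edgePt_inv]
        congr 1
        ext
        simp only [coe_symm_eq, coe_projIcc]
        have : 0 ≤ t := by linarith
        rw [min_eq_right h2, min_eq_right h1, max_eq_right (by linarith), max_eq_right this]
        ring
      · rw [X.tgt_inv, projIcc_of_le_left _ (by linarith)]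
        exact (edgePt_zero d).symm

/-! ### Full subcomplexes -/

/-- The full subcomplex on a set `U` of vertices: all the cells whose vertices lie in `U`. -/
def sub (X : TwoComplex.{u}) (U : Set X.V) : Set X.Space :=
  {y | (∃ x ∈ U, y = X.vertexPt x) ∨ (∃ d t, X.src d ∈ U ∧ X.tgt d ∈ U ∧ y = X.edgePt d t) ∨
    ∃ c z, X.base c ∈ U ∧ (∀ d ∈ X.bdry c, X.src d ∈ U) ∧ y = X.cellPt c z}

variable {U W : Set X.V}

theorem vertexPt_mem_sub {x : X.V} (hx : x ∈ U) : X.vertexPt x ∈ X.sub U := Or.inl ⟨x, hx, rfl⟩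

theorem sub_mono (h : U ⊆ W) : X.sub U ⊆ X.sub W := by
  rintro y (⟨x, hx, rfl⟩ | ⟨d, t, h1, h2, rfl⟩ | ⟨c, z, h1, h2, rfl⟩)
  · exact Or.inl ⟨x, h hx, rfl⟩
  · exact Or.inr (Or.inl ⟨d, t, h h1, h h2, rfl⟩)
  · exact Or.inr (Or.inr ⟨c, z, h h1, fun d hd => h (h2 d hd), rfl⟩)

theorem star_eq_sub (n : ℕ) (v : X.V) : X.star n v = X.sub {x | X.dist v x ≤ n} := by
  ext y
  simp only [star, ball, sub, mem_union, mem_ofPred_eq, or_assoc]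

theorem walkPt_mem_sub {x y : X.V} {p : List X.D} (h : X.IsWalkIn U x p y) (t : ℝ) :
    X.walkPt x p t ∈ X.sub U := by
  induction p generalizing x t with
  | nil => exact vertexPt_mem_sub h.1
  | cons d p ih =>
    rw [walkPt_cons]
    split_ifs
    · exact Or.inr (Or.inl ⟨d, _, h.1 ▸ h.2.1, h.2.2.left_mem, rfl⟩)
    · exact ih h.2.2 _

/-- The path in the full subcomplex on `U` that runs through an edge path. -/
noncomputable def walkPath {x y : X.V} {p : List X.D} (h : X.IsWalkIn U x p y) :
    Path (⟨X.vertexPt x, vertexPt_mem_sub h.left_mem⟩ : X.sub U)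
      ⟨X.vertexPt y, vertexPt_mem_sub h.right_mem⟩ where
  toFun t := ⟨X.walkPt x p (t * p.length), walkPt_mem_sub h _⟩
  continuous_toFun := Continuous.subtype_mk
    ((continuous_walkPt h.isWalk).comp (by fun_prop)) _
  source' := Subtype.ext (walkPt_of_nonpos h.isWalk (by simp))
  target' := Subtype.ext (walkPt_of_ge h.isWalk (by simp))

theorem walkPath_apply {x y : X.V} {p : List X.D} (h : X.IsWalkIn U x p y) (t : I) :
    (walkPath h t : X.Space) = X.walkPt x p (t * p.length) := rfl

end TwoComplex

/-- A path is homotopic to the concatenation of its restrictions to `[0, t₁]` and `[t₁, 1]`, both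
reparametrized by `[0, 1]`. -/
theorem Path.homotopic_trans_of_eq {Y : Type*} [TopologicalSpace Y] {a b c : Y} (γ : Path a b)
    (α : Path a c) (β : Path c b) (t₁ : I)
    (hα : ∀ t s : I, (s : ℝ) = t * t₁ → α t = γ s)
    (hβ : ∀ t s : I, (s : ℝ) = t₁ + t * (1 - t₁) → β t = γ s) : γ.Homotopic (α.trans β) := by
  have hx0 : ∀ t : I, (t : ℝ) * t₁ ∈ I := fun t => unitInterval.mul_mem t.2 t₁.2
  have hx1 : ∀ t : I, (t₁ : ℝ) + t * (1 - t₁) ∈ I := fun t =>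
    ⟨add_nonneg t₁.2.1 (mul_nonneg t.2.1 (sub_nonneg.2 t₁.2.2)), by
      nlinarith [t.2.2, sub_nonneg.2 t₁.2.2]⟩
  let d₁ : Path (0 : I) t₁ :=
    { toFun := fun t => ⟨(t : ℝ) * t₁, hx0 t⟩
      continuous_toFun := by fun_prop
      source' := by ext; simp
      target' := by ext; simp }
  let d₂ : Path t₁ (1 : I) :=
    { toFun := fun t => ⟨(t₁ : ℝ) + t * (1 - t₁), hx1 t⟩
      continuous_toFun := by fun_prop
      source' := by ext; simp
      target' := by ext; simp }
  have key : α.trans β = γ.reparam (d₁.trans d₂) (d₁.trans d₂).continuous (by simp) (by simp) := by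
    ext t
    rw [Path.coe_reparam, Function.comp_apply, Path.trans_apply, Path.trans_apply]
    split_ifs with h
    · exact hα _ _ rfl
    · exact hβ _ _ rfl
  rw [key]
  exact ⟨Path.Homotopy.reparam γ _ _ _ _⟩

namespace TwoComplex

variable {X : TwoComplex.{u}} {U W : Set X.V} {x y z : X.V}

/-- `p` and `q` are edge paths from `x` to `y`, homotopic relative to their end points in the full
subcomplex on `U`. -/
def Homot (U : Set X.V) (x : X.V) (p q : List X.D) (y : X.V) : Prop :=
  ∃ (hp : X.IsWalkIn U x p y) (hq : X.IsWalkIn U x q y), (walkPath hp).Homotopic (walkPath hq)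

namespace Homot

variable {p q r p' q' : List X.D}

theorem left (h : Homot U x p q y) : X.IsWalkIn U x p y := h.1

theorem right (h : Homot U x p q y) : X.IsWalkIn U x q y := h.2.1

theorem refl (h : X.IsWalkIn U x p y) : Homot U x p p y := ⟨h, h, .refl _⟩

theorem symm (h : Homot U x p q y) : Homot U x q p y := by
  obtain ⟨h1, h2, h3⟩ := h
  exact ⟨h2, h1, h3.symm⟩

theorem trans (h : Homot U x p q y) (h' : Homot U x q r y) : Homot U x p r y := by
  obtain ⟨h1, h2, h3⟩ := h
  obtain ⟨h1', h2', h3'⟩ := h'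
  exact ⟨h1, h2', h3.trans h3'⟩

theorem mono (hU : U ⊆ W) (h : Homot U x p q y) : Homot W x p q y := by
  obtain ⟨h1, h2, h3⟩ := h
  exact ⟨h1.mono hU, h2.mono hU, h3.map ⟨inclusion (sub_mono hU), continuous_inclusion _⟩⟩

end Homot

theorem walkPath_append {p q : List X.D} (hp : X.IsWalkIn U x p y) (hq : X.IsWalkIn U y q z) :
    (walkPath (hp.append hq)).Homotopic ((walkPath hp).trans (walkPath hq)) := by
  have hmem : (p.length : ℝ) / (p ++ q).length ∈ I := by
    refine unitInterval.div_mem (Nat.cast_nonneg _) (Nat.cast_nonneg _) ?_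
    simp
  have hlen : (p.length : ℝ) / (p ++ q).length * (p ++ q).length = p.length := by
    rcases eq_or_ne ((p ++ q).length : ℝ) 0 with h | h
    · have h' : (p ++ q).length = 0 := by exact_mod_cast h
      have : p.length = 0 := by rw [List.length_append] at h'; omega
      simp [this]
    · exact div_mul_cancel₀ _ h
  have hpq : ((p ++ q).length : ℝ) = p.length + q.length := by simp
  refine Path.homotopic_trans_of_eq _ _ _ ⟨_, hmem⟩ ?_ ?_
  · intro t s hs
    refine Subtype.ext ?_
    rw [walkPath_apply, walkPath_apply, hs, mul_assoc]
    dsimp only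
    rw [hlen, walkPt_append_of_le hp.isWalk hq.isWalk]
    exact mul_le_of_le_one_left (Nat.cast_nonneg _) t.2.2
  · intro t s hs
    refine Subtype.ext ?_
    have e : (s : ℝ) * (p ++ q).length = p.length + t * q.length := by
      rw [hs, add_mul, mul_assoc, sub_mul]
      dsimp only
      rw [hlen, one_mul, hpq]
      ring
    rw [walkPath_apply, walkPath_apply, e, walkPt_append_of_ge hp.isWalk hq.isWalk]
    · congr 1; ring
    · have := mul_nonneg t.2.1 (Nat.cast_nonneg (α := ℝ) q.length)
      linarith

theorem walkPath_nil (hx : x ∈ U) :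
    walkPath (DartGraph.IsWalkIn.nil (Γ := X.toDartGraph) hx) = Path.refl _ := rfl

theorem walkPath_rev {p : List X.D} (hp : X.IsWalkIn U x p y) :
    walkPath hp.rev = (walkPath hp).symm := by
  ext t
  rw [Path.symm_apply, Function.comp_apply, walkPath_apply, walkPath_apply, ← walkPt_revPath hp.isWalk]
  congr 1
  rw [DartGraph.length_revPath, coe_symm_eq]
  ring

namespace Homot

variable {p q r p' q' : List X.D}

theorem append (h : Homot U x p q y) (h' : Homot U y p' q' z) :
    Homot U x (p ++ p') (q ++ q') z := by
  obtain ⟨h1, h2, h3⟩ := h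
  obtain ⟨h1', h2', h3'⟩ := h'
  exact ⟨h1.append h1', h2.append h2', (walkPath_append h1 h1').trans
    ((h3.hcomp h3').trans (walkPath_append h2 h2').symm)⟩

theorem append_left (hp : X.IsWalkIn U x p y) (h' : Homot U y p' q' z) :
    Homot U x (p ++ p') (p ++ q') z := (refl hp).append h'

theorem append_right (h : Homot U x p q y) (hp' : X.IsWalkIn U y p' z) :
    Homot U x (p ++ p') (q ++ p') z := h.append (refl hp')

theorem rev (h : Homot U x p q y) : Homot U y (X.revPath p) (X.revPath q) x := by
  obtain ⟨h1, h2, h3⟩ := h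
  refine ⟨h1.rev, h2.rev, ?_⟩
  rw [walkPath_rev h1, walkPath_rev h2]
  exact h3.symm₂

theorem append_rev (h : X.IsWalkIn U x p y) : Homot U x (p ++ X.revPath p) [] x := by
  refine ⟨h.append h.rev, .nil h.left_mem, (walkPath_append h h.rev).trans ?_⟩
  rw [walkPath_rev h, walkPath_nil h.left_mem]
  exact ⟨(Path.Homotopy.reflTransSymm _).symm⟩

theorem rev_append (h : X.IsWalkIn U x p y) : Homot U y (X.revPath p ++ p) [] y := by
  have := append_rev h.rev
  rwa [X.revPath_revPath] at this

/-- A loop `p q⁻¹` is null-homotopic if and only if `p` and `q` are homotopic. -/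
theorem of_loop (h : Homot U x (p ++ X.revPath q) [] x) (hq : X.IsWalkIn U x q y) :
    Homot U x p q y := by
  obtain ⟨y', hp, hq'⟩ := h.left.of_append
  have hy : y' = y := by
    have := hq'.rev
    rw [X.revPath_revPath] at this
    exact this.right_unique hq
  subst hy
  have h1 := append_left hp (rev_append hq)
  have h2 := append_right h hq
  rw [List.append_nil] at h1
  rw [List.append_assoc] at h2
  exact h1.symm.trans h2

/-- If `a e₁ c⁻¹` is homotopic to `w₁` and `c e₂ b⁻¹` to `w₂`, then `a e₁ e₂ b⁻¹` is homotopic to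
`w₁ w₂`. -/
theorem conj_append {a b c e₁ e₂ w₁ w₂ : List X.D}
    (h₁ : Homot U x (a ++ (e₁ ++ X.revPath c)) w₁ y)
    (h₂ : Homot U y (c ++ (e₂ ++ X.revPath b)) w₂ z) :
    Homot U x (a ++ ((e₁ ++ e₂) ++ X.revPath b)) (w₁ ++ w₂) z := by
  obtain ⟨u, ha, h⟩ := h₁.left.of_append
  obtain ⟨v, he₁, hc⟩ := h.of_append
  obtain ⟨v', hc', h⟩ := h₂.left.of_append
  have hv : v = v' := by
    have := hc.rev
    rw [X.revPath_revPath] at this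
    exact this.right_unique hc'
  subst hv
  have h3 := append_left (ha.append he₁) (append_right (rev_append hc') h)
  have h4 := h₁.append h₂
  simp only [List.append_assoc, List.nil_append] at h3 h4 ⊢
  exact h3.symm.trans h4

theorem conj_symm {a b e f : List X.D} {x' y' : X.V} (ha : X.IsWalkIn U x a x')
    (hb : X.IsWalkIn U y b y') (h : Homot U x (a ++ (e ++ X.revPath b)) f y) :
    Homot U x' (X.revPath a ++ (f ++ b)) e y' := by
  obtain ⟨u, ha', h'⟩ := h.left.of_append
  obtain rfl := ha'.right_unique ha
  obtain ⟨v, he, hb'⟩ := h'.of_append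
  have hv : v = y' := by
    have := hb'.rev
    rw [X.revPath_revPath] at this
    exact this.right_unique hb
  subst hv
  have h1 := append_left ha.rev (append_right h hb)
  have h2 := append_right (rev_append ha) (he.append (hb.rev.append hb))
  have h3 := append_left he (rev_append hb)
  simp only [List.append_assoc, List.nil_append, List.append_nil] at h1 h2 h3
  exact h1.symm.trans (h2.trans h3)

theorem of_append_nil (h : Homot U x (p ++ []) q y) : Homot U x p q y := by
  rwa [List.append_nil] at h

/-- A null-homotopic loop stays so when its starting point is moved along it. -/
theorem loop_left (h : Homot U y (q ++ p) [] y) (hp : X.IsWalkIn U x p y) :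
    Homot U x (p ++ q) [] x := by
  rw [← X.revPath_revPath p] at h
  exact (append_left hp (of_loop h hp.rev)).trans (append_rev hp)

end Homot

theorem walkPt_getElem {p : List X.D} (h : X.IsWalk x p y) {j : ℕ} (hj : j < p.length) (t : I) :
    X.walkPt x p (j + t) = X.edgePt p[j] t := by
  induction p generalizing x j with
  | nil => simp at hj
  | cons d p ih =>
    cases j with
    | zero =>
      rw [walkPt_cons, if_pos (by simpa using t.2.2)]
      simp
    | succ j =>
      have := t.2.1
      have hj0 : (0 : ℝ) ≤ j := Nat.cast_nonneg j
      rw [walkPt_cons_of_ge h (by push_cast; linarith)]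
      simp only [List.getElem_cons_succ]
      rw [← ih h.2 (by simpa using hj)]
      congr 1
      push_cast
      ring

/-- The boundary path of a 2-cell, as a path in the cell. -/
theorem walkPt_bdry (c : X.C) (t : I) :
    X.walkPt (X.base c) (X.bdry c) (t * (X.bdry c).length) = X.cellPt c (circlePt t) := by
  rcases eq_or_ne (X.bdry c) [] with h | h
  · rw [show X.cellPt c (circlePt t) = X.vertexPt (X.base c) from
      Quot.sound (Glue.attachNil c h t), h]
    rfl
  · have hn : 0 < (X.bdry c).length := List.length_pos_of_ne_nil h
    have hn' : (0 : ℝ) < (X.bdry c).length := by exact_mod_cast hn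
    have key : ∃ (j : Fin (X.bdry c).length) (s : I),
        (t : ℝ) * (X.bdry c).length = (j : ℕ) + (s : ℝ) := by
      rcases t.2.2.lt_or_eq with h1 | h1
      · have h0 : 0 ≤ (t : ℝ) * (X.bdry c).length := mul_nonneg t.2.1 hn'.le
        refine ⟨⟨⌊(t : ℝ) * (X.bdry c).length⌋₊, ?_⟩, ⟨_ - ⌊(t : ℝ) * (X.bdry c).length⌋₊,
          sub_nonneg.2 (Nat.floor_le h0), ?_⟩, ?_⟩
        · rw [Nat.floor_lt h0]
          exact mul_lt_of_lt_one_left hn' h1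
        · linarith [Nat.lt_floor_add_one ((t : ℝ) * (X.bdry c).length)]
        · simp
      · refine ⟨⟨(X.bdry c).length - 1, by omega⟩, 1, ?_⟩
        rw [h1, Nat.cast_sub hn]
        simp
    obtain ⟨j, s, hjs⟩ := key
    have hg : X.cellPt c (circlePt (((j : ℕ) + (s : ℝ)) / (X.bdry c).length)) =
        X.edgePt ((X.bdry c).get j) s := Quot.sound (Glue.attach c j s)
    rw [hjs, walkPt_getElem (X.closed c) j.2, show (X.bdry c)[(j : ℕ)] = (X.bdry c).get j from rfl, ← hg,
      ← hjs, mul_div_assoc, div_self hn'.ne', mul_one]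

theorem continuous_circlePt : Continuous circlePt := by
  unfold circlePt
  fun_prop

instance : ContractibleSpace Disc :=
  (convex_closedBall (0 : ℂ) 1).contractibleSpace ⟨0, by simp⟩

theorem circlePt_one : circlePt 1 = circlePt 0 := by
  ext
  simp [circlePt]

/-- The boundary of a 2-cell is null-homotopic, as the disc is contractible. -/
theorem Homot.cell (c : X.C) (h : X.IsWalkIn U (X.base c) (X.bdry c) (X.base c)) :
    Homot U (X.base c) (X.bdry c) [] (X.base c) := by
  refine ⟨h, .nil h.left_mem, ?_⟩
  have hφ : ∀ z, X.cellPt c z ∈ X.sub U := fun z =>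
    Or.inr (Or.inr ⟨c, z, h.left_mem, fun d hd => h.src_mem hd, rfl⟩)
  let φ : C(Disc, X.sub U) := ⟨fun z => ⟨X.cellPt c z, hφ z⟩, (continuous_cellPt c).subtype_mk _⟩
  let ℓ : Path (circlePt 0) (circlePt 0) :=
    { toFun := fun t => circlePt t
      continuous_toFun := continuous_circlePt.comp continuous_subtype_val
      source' := by simp
      target' := by simp [circlePt_one] }
  have h0 : (⟨X.vertexPt (X.base c), vertexPt_mem_sub h.left_mem⟩ : X.sub U) = φ (circlePt 0) := by
    refine Subtype.ext ?_
    have := walkPt_bdry c 0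
    rw [Icc.coe_zero, zero_mul, walkPt_of_nonpos (X.closed c) le_rfl] at this
    exact this
  have H := ((SimplyConnectedSpace.paths_homotopic ℓ (Path.refl _)).map φ).pathCast h0 h0
  have e1 : walkPath h = (ℓ.map φ.continuous).cast h0 h0 := by
    ext t
    exact walkPt_bdry c t
  have e2 : walkPath (DartGraph.IsWalkIn.nil (Γ := X.toDartGraph) h.left_mem) =
      ((Path.refl (circlePt 0)).map φ.continuous).cast h0 h0 := by
    ext t
    exact congrArg Subtype.val h0
  rw [e1, e2]
  exact H

end TwoComplex

/-! ### The edge path metric -/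

namespace DartGraph

variable {Γ : DartGraph.{u}} {x y z : Γ.V}

theorem dist_self (x : Γ.V) : Γ.dist x x = 0 := SimpleGraph.dist_self

theorem dist_comm (x y : Γ.V) : Γ.dist x y = Γ.dist y x := SimpleGraph.dist_comm

theorem dist_triangle (hc : Γ.toSimple.Connected) (x y z : Γ.V) :
    Γ.dist x z ≤ Γ.dist x y + Γ.dist y z := hc.dist_triangle

theorem IsWalk.exists_walk {p : List Γ.D} (h : Γ.IsWalk x p y) :
    ∃ w : Γ.toSimple.Walk x y, w.length ≤ p.length := by
  induction p generalizing x with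
  | nil => cases h; exact ⟨.nil, le_rfl⟩
  | cons d p ih =>
    obtain ⟨w, hw⟩ := ih h.2
    obtain ⟨rfl, -⟩ := h
    by_cases hd : Γ.src d = Γ.tgt d
    · exact ⟨w.copy hd.symm rfl, by simpa using hw.trans (Nat.le_succ _)⟩
    · exact ⟨.cons ⟨hd, d, rfl, rfl⟩ w, Nat.succ_le_succ hw⟩

theorem IsWalk.dist_le {p : List Γ.D} (h : Γ.IsWalk x p y) : Γ.dist x y ≤ p.length := by
  obtain ⟨w, hw⟩ := h.exists_walk
  exact (SimpleGraph.dist_le w).trans hw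

theorem IsWalk.reachable {p : List Γ.D} (h : Γ.IsWalk x p y) : Γ.toSimple.Reachable x y := by
  obtain ⟨w, -⟩ := h.exists_walk
  exact ⟨w⟩

theorem dist_src_tgt (d : Γ.D) : Γ.dist (Γ.src d) (Γ.tgt d) ≤ 1 :=
  IsWalk.dist_le (p := [d]) ⟨rfl, rfl⟩

theorem exists_geodesic (hc : Γ.toSimple.Connected) (x y : Γ.V) :
    ∃ p, Γ.IsWalk x p y ∧ p.length = Γ.dist x y := by
  obtain ⟨w, hw⟩ := hc.exists_walk_length_eq_dist x y
  suffices ∀ {x y : Γ.V} (w : Γ.toSimple.Walk x y), ∃ p, Γ.IsWalk x p y ∧ p.length = w.length by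
    obtain ⟨p, h1, h2⟩ := this w
    exact ⟨p, h1, h2.trans hw⟩
  intro x y w
  induction w with
  | nil => exact ⟨[], rfl, rfl⟩
  | cons h w ih =>
    obtain ⟨p, h1, h2⟩ := ih
    obtain ⟨-, d, rfl, rfl⟩ := h
    exact ⟨d :: p, ⟨rfl, h1⟩, congrArg Nat.succ h2⟩

/-- The closed ball of radius `n` about `v` in the edge path metric. -/
def cball (Γ : DartGraph.{u}) (n : ℕ) (v : Γ.V) : Set Γ.V := {x | Γ.dist v x ≤ n}

theorem mem_cball {n : ℕ} {v : Γ.V} : x ∈ Γ.cball n v ↔ Γ.dist v x ≤ n := Iff.rfl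

theorem cball_mono {m n : ℕ} (h : m ≤ n) (v : Γ.V) : Γ.cball m v ⊆ Γ.cball n v :=
  fun _ hx => le_trans hx h

theorem cball_subset (hc : Γ.toSimple.Connected) {m n k : ℕ} {v w : Γ.V} (h : Γ.dist v w ≤ k)
    (hk : k + m ≤ n) : Γ.cball m w ⊆ Γ.cball n v := fun x hx =>
  (dist_triangle hc v w x).trans ((add_le_add h hx).trans hk)

theorem IsWalk.isWalkIn_cball (hc : Γ.toSimple.Connected) {p : List Γ.D} (h : Γ.IsWalk x p y)
    {v : Γ.V} {k n : ℕ} (hk : Γ.dist v x ≤ k) (hn : k + p.length ≤ n) :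
    Γ.IsWalkIn (Γ.cball n v) x p y := by
  induction p generalizing x k with
  | nil => exact ⟨by rw [mem_cball]; simp at hn; omega, h⟩
  | cons d p ih =>
    obtain ⟨rfl, h⟩ := h
    rw [List.length_cons] at hn
    refine ⟨rfl, by rw [mem_cball]; omega, ih h (k := k + 1) ?_ (by omega)⟩
    have h1 := dist_triangle hc v (Γ.src d) (Γ.tgt d)
    have h2 := dist_src_tgt d
    omega

end DartGraph

namespace TwoComplex

variable {X : TwoComplex.{u}} {x y v : X.V}

/-- If short loops can be filled uniformly, then so can all the loops in a ball: such a loop is a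
product of loops that run along a geodesic from the centre, an edge, and a geodesic back. -/
theorem isFillingRadius_of_short_loops (hc : X.toSimple.Connected) {R A : ℕ}
    (h : ∀ (v : X.V) (p : List X.D), X.IsWalk v p v → p.length ≤ 2 * R + 1 →
      Homot (X.cball A v) v p [] v) : X.IsFillingRadius R A := by
  intro v p hp hR
  choose c hc1 hc2 using fun x => DartGraph.exists_geodesic hc v x
  have hlen : ∀ {x}, X.dist v x ≤ R → (c x).length ≤ R := fun hx => (hc2 _).trans_le hx
  have key : ∀ {x}, X.IsWalkIn (X.cball R v) x p v →
      Homot (X.cball A v) v (c x ++ p) (c v) v := by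
    clear hp hR
    intro x hx
    induction p generalizing x with
    | nil =>
      obtain ⟨-, rfl⟩ := hx
      rw [List.append_nil]
      refine Homot.refl (h x (c x) (hc1 x) ?_).left
      have := hlen ((DartGraph.dist_self x).trans_le (Nat.zero_le R))
      omega
    | cons d p ih =>
      obtain ⟨rfl, h1, h2⟩ := hx
      have ih := ih h2
      obtain ⟨y, hy1, hy2⟩ := ih.left.of_append
      obtain rfl := (DartGraph.isWalkIn_univ.2 (hc1 (X.tgt d))).right_unique hy1
      have h1' := hlen h1
      have h2' := hlen h2.left_mem
      have hloop : Homot (X.cball A v) v ((c (X.src d) ++ [d]) ++ X.revPath (c (X.tgt d))) [] v := by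
        refine h _ _ ?_ ?_
        · exact DartGraph.isWalk_append (DartGraph.isWalk_append (hc1 _) ⟨rfl, rfl⟩)
            (DartGraph.isWalkIn_univ.2 (hc1 _)).rev.isWalk
        · simp
          omega
      have h3 := (hloop.of_loop hy1).append_right hy2
      rw [List.append_assoc, List.singleton_append] at h3
      exact h3.trans ih
  have hv : X.dist v v ≤ R := (DartGraph.dist_self v).trans_le (Nat.zero_le R)
  have hcv : Homot (X.cball A v) v (c v) [] v := h v _ (hc1 v) (by have := hlen hv; omega)
  have h1 := key (hp.isWalkIn hv hR)
  obtain ⟨y, hy1, hy2⟩ := h1.left.of_append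
  obtain rfl := hcv.left.right_unique hy1
  obtain ⟨h2, h3, ⟨F⟩⟩ := (hcv.append_right hy2).symm.trans (h1.trans hcv)
  refine ⟨fun z => F z, continuous_subtype_val.comp F.continuous, fun z => ?_, fun t => ?_,
    fun t => ?_, fun s => ⟨?_, ?_⟩⟩
  · rw [star_eq_sub]
    exact (F z).2
  · exact congrArg Subtype.val (F.apply_zero t)
  · exact congrArg Subtype.val (F.apply_one t)
  · exact congrArg Subtype.val (F.source s)
  · exact congrArg Subtype.val (F.target s)

end TwoComplex

namespace PeripheralPresentation

open TwoComplex

variable {G : Type u} {n : ℕ}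

/-! ### The graph of the cusped space -/

/-- The depth of a vertex. -/
def Vertex.depth : Vertex G n → ℕ
  | .base _ => 0
  | .horo _ _ k => k + 1

/-- The group element over which a vertex lies. -/
def Vertex.foot : Vertex G n → G
  | .base g => g
  | .horo _ g _ => g

@[simp] theorem Vertex.depth_at (i : Fin n) (g : G) (k : ℕ) : (Vertex.at i g k).depth = k := by
  cases k <;> rfl

@[simp] theorem Vertex.foot_at (i : Fin n) (g : G) (k : ℕ) : (Vertex.at i g k).foot = g := by
  cases k <;> rfl

@[simp] theorem Vertex.at_inj {i : Fin n} {g h : G} {k l : ℕ} :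
    Vertex.at i g k = Vertex.at i h l ↔ g = h ∧ k = l := by
  refine ⟨fun H => ⟨?_, ?_⟩, by rintro ⟨rfl, rfl⟩; rfl⟩
  · simpa using congrArg Vertex.foot H
  · simpa using congrArg Vertex.depth H

variable [Group G] {𝒜 : PeripheralPresentation G n}

theorem Within.refl (i : Fin n) (m : ℕ) (g : G) : 𝒜.Within i m g g :=
  ⟨[], by simp, by simp, by simp⟩

theorem Within.mono {i : Fin n} {m m' : ℕ} (hm : m ≤ m') {g h : G} (H : 𝒜.Within i m g h) :
    𝒜.Within i m' g h := by
  obtain ⟨l, h1, h2⟩ := H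
  exact ⟨l, h1.trans hm, h2⟩

theorem Within.trans {i : Fin n} {m m' : ℕ} {g h k : G} (H : 𝒜.Within i m g h)
    (H' : 𝒜.Within i m' h k) : 𝒜.Within i (m + m') g k := by
  obtain ⟨l, h1, h2, rfl⟩ := H
  obtain ⟨l', h1', h2', rfl⟩ := H'
  refine ⟨l ++ l', by simp; omega, ?_, by simp [mul_assoc]⟩
  intro x hx
  rcases List.mem_append.1 hx with hx | hx
  exacts [h2 x hx, h2' x hx]

theorem Within.split {i : Fin n} {m m' : ℕ} {g h : G} (H : 𝒜.Within i (m + m') g h) :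
    ∃ k, 𝒜.Within i m g k ∧ 𝒜.Within i m' k h := by
  obtain ⟨l, h1, h2, rfl⟩ := H
  refine ⟨g * (l.take m).prod, ⟨l.take m, by simp, fun x hx => h2 x (List.mem_of_mem_take hx), rfl⟩,
    ⟨l.drop m, by simp; omega, fun x hx => h2 x (List.mem_of_mem_drop hx), ?_⟩⟩
  rw [mul_assoc, List.prod_take_mul_prod_drop]

variable (𝒜) in
/-- `e` is a horizontal edge of depth `k` from `g` to `h` in the horoball based on `g (P i)`. -/
def IsHoriz (i : Fin n) (k : ℕ) (g h : G) (e : 𝒜.Dart) : Prop :=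
  Dart.src 𝒜 e = .at i g k ∧ Dart.src 𝒜 (Dart.inv 𝒜 e) = .at i h k ∧ Dart.InHoroball 𝒜 i e ∧
    Dart.isVert 𝒜 e = false

theorem IsHoriz.inv {i : Fin n} {k : ℕ} {g h : G} {e : 𝒜.Dart} (H : IsHoriz 𝒜 i k g h e) :
    IsHoriz 𝒜 i k h g (Dart.inv 𝒜 e) := by
  obtain ⟨h1, h2, h3, h4⟩ := H
  refine ⟨h2, ?_, ?_, ?_⟩
  · rw [show Dart.inv 𝒜 (Dart.inv 𝒜 e) = e from 𝒜.graph.inv_inv e, h1]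
  · cases e <;> exact h3
  · cases e <;> simp_all [Dart.inv, Dart.isVert]

theorem isHoriz_horiz {i : Fin n} {k : ℕ} {g h : G} (hne : g ≠ h)
    (hd : 𝒜.Within i (2 ^ (k + 1)) g h) : IsHoriz 𝒜 i (k + 1) g h (.horiz i k g h hne hd) :=
  ⟨rfl, rfl, rfl, rfl⟩

theorem exists_isHoriz {i : Fin n} {k : ℕ} {g h : G} (hne : g ≠ h)
    (hd : 𝒜.Within i (2 ^ k) g h) : ∃ e, IsHoriz 𝒜 i k g h e := by
  cases k with
  | succ k => exact ⟨_, isHoriz_horiz hne hd⟩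
  | zero =>
    obtain ⟨l, h1, h2, rfl⟩ := hd
    match l, h1, h2, hne with
    | [], _, _, hne => simp at hne
    | [x], _, h2, _ =>
      obtain ⟨hP, hS | hS⟩ := h2 x (by simp)
      · exact ⟨.cayley g ⟨x, hS⟩ true, rfl, by simp [Dart.inv, Dart.src, Vertex.at], hP, rfl⟩
      · refine ⟨.cayley (g * x) ⟨x⁻¹, hS⟩ false, ?_, ?_, inv_mem hP, rfl⟩
        · simp [Dart.src, Vertex.at]
        · simp [Dart.inv, Dart.src, Vertex.at]
    | _ :: _ :: _, h1, _, _ => simp at h1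

theorem reachable_base (g h : G) :
    𝒜.graph.toSimple.Reachable (Vertex.base g) (Vertex.base (g * h)) := by
  have hh : h ∈ Subgroup.closure 𝒜.S := by rw [𝒜.S_gen]; trivial
  have key : ∀ (g : G) (s : 𝒜.S),
      𝒜.graph.toSimple.Reachable (Vertex.base g) (Vertex.base (g * s)) := fun g s =>
    DartGraph.IsWalk.reachable (p := [.cayley g s true]) ⟨rfl, rfl⟩
  induction hh using Subgroup.closure_induction_right generalizing g with
  | one => rw [mul_one]
  | mul_right x hx y hy ih =>
    rw [← mul_assoc]
    exact (ih g).trans (key (g * x) ⟨y, hy⟩)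
  | mul_inv_cancel x hx y hy ih =>
    rw [← mul_assoc]
    have := key (g * x * y⁻¹) ⟨y, hy⟩
    rw [inv_mul_cancel_right] at this
    exact (ih g).trans this.symm

theorem reachable_at (i : Fin n) (g : G) (k : ℕ) :
    𝒜.graph.toSimple.Reachable (Vertex.base g) (Vertex.at i g k) := by
  induction k with
  | zero => exact .refl _
  | succ k ih =>
    exact ih.trans (DartGraph.IsWalk.reachable (p := [.vert i g k true]) ⟨rfl, rfl⟩)

variable (𝒜) in
theorem connected : 𝒜.cuspedSpace.toSimple.Connected := by
  change 𝒜.graph.toSimple.Connected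
  have key : ∀ x : Vertex G n, 𝒜.graph.toSimple.Reachable (Vertex.base 1) x := by
    rintro (g | ⟨i, g, k⟩)
    · have := reachable_base (𝒜 := 𝒜) 1 g
      rwa [one_mul] at this
    · have := reachable_base (𝒜 := 𝒜) 1 g
      rw [one_mul] at this
      exact this.trans (reachable_at i g (k + 1))
  exact { preconnected := fun x y => (key x).symm.trans (key y), nonempty := ⟨Vertex.base 1⟩ }

/-! ### Filling the circuits of a horoball -/

variable {U : Set 𝒜.cuspedSpace.V}

/-- A circuit that bounds a 2-cell is null-homotopic, from any of its vertices and in both directions: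
the attaching path chosen for the 2-cell agrees with the circuit up to rotation and reversal. -/
theorem homot_of_boundsHoroCell {i : Fin n} {p : List 𝒜.Dart} (hb : BoundsHoroCell 𝒜 i p)
    {x : Vertex G n} (hp : 𝒜.cuspedSpace.IsWalkIn U x p x) :
    Homot (X := 𝒜.cuspedSpace) U x p [] x := by
  let c : HoroCell 𝒜 i := Quotient.mk _ ⟨p, hb⟩
  have hc : c.path ~r p ∨ c.path ~r 𝒜.graph.revPath p :=
    Quotient.mk_out (s := 𝒜.graph.cyclicSetoid (BoundsHoroCell 𝒜 i)) ⟨p, hb⟩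
  have hbd : 𝒜.cuspedSpace.bdry (.inr ⟨i, c⟩) = c.path := rfl
  have hmem : ∀ d ∈ c.path, 𝒜.cuspedSpace.src d ∈ U := by
    intro d hd
    rcases hc with hc | hc
    · exact hp.src_mem (hc.mem_iff.1 hd)
    · exact hp.rev.src_mem (hc.mem_iff.1 hd)
  have hbase : 𝒜.cuspedSpace.base (.inr ⟨i, c⟩) ∈ U := hmem _ (List.head_mem _)
  have hcell := Homot.cell (X := 𝒜.cuspedSpace) (U := U) (.inr ⟨i, c⟩)
    ((𝒜.cuspedSpace.closed _).isWalkIn hbase hmem)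
  rw [hbd] at hcell
  have rot : ∀ {b x : Vertex G n} {p : List 𝒜.Dart}, p ≠ [] →
      Homot (X := 𝒜.cuspedSpace) U b c.path [] b → c.path ~r p → 𝒜.cuspedSpace.IsWalkIn U x p x →
      Homot (X := 𝒜.cuspedSpace) U x p [] x := by
    rintro b x p hp0 hcell ⟨m, hm⟩ hp
    rw [← List.rotate_mod] at hm
    rcases Nat.eq_zero_or_pos c.path.length with h0 | h0
    · rw [List.length_eq_zero_iff] at h0
      rw [h0, List.rotate_nil] at hm
      exact absurd hm.symm hp0
    · rw [List.rotate_eq_drop_append_take (Nat.mod_lt _ h0).le] at hm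
      rw [← List.take_append_drop (m % c.path.length) c.path] at hcell
      rw [← hm] at hp ⊢
      obtain ⟨y, h1, h2⟩ := hp.of_append
      obtain ⟨z, h3, h4⟩ := hcell.left.of_append
      have hdrop : c.path.drop (m % c.path.length) ≠ [] := by
        rw [Ne, List.drop_eq_nil_iff, not_le]
        exact Nat.mod_lt _ h0
      obtain rfl := h1.left_unique hdrop h4
      exact hcell.loop_left h4
  have hp0 : p ≠ [] := (BoundsHoroCell.isCircuit 𝒜 hb).1
  rcases hc with hc | hc
  · exact rot hp0 hcell hc hp
  · have hr : 𝒜.graph.revPath p ≠ [] := by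
      intro h
      have := congrArg List.length h
      rw [DartGraph.length_revPath] at this
      exact hp0 (List.length_eq_zero_iff.1 this)
    have := (rot hr hcell hc hp.rev).rev
    change Homot (X := 𝒜.cuspedSpace) U x (𝒜.graph.revPath (𝒜.graph.revPath p)) [] x at this
    rwa [𝒜.graph.revPath_revPath] at this

theorem isWalkIn_cons {d : 𝒜.Dart} {p : List 𝒜.Dart} {x y z : Vertex G n}
    (h1 : Dart.src 𝒜 d = x) (hx : x ∈ U) (h2 : Dart.src 𝒜 (Dart.inv 𝒜 d) = y)
    (h : 𝒜.cuspedSpace.IsWalkIn U y p z) : 𝒜.cuspedSpace.IsWalkIn U x (d :: p) z := by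
  subst h2
  exact ⟨h1, hx, h⟩

theorem IsHoriz.isWalkIn {i : Fin n} {k : ℕ} {g h : G} {e : 𝒜.Dart} (H : IsHoriz 𝒜 i k g h e)
    (h1 : Vertex.at i g k ∈ U) (h2 : Vertex.at i h k ∈ U) :
    𝒜.cuspedSpace.IsWalkIn U (Vertex.at i g k) [e] (Vertex.at i h k) :=
  isWalkIn_cons H.1 h1 H.2.1 ⟨h2, rfl⟩

theorem homot_of_boundsHoroCell_append {i : Fin n} {p q : List 𝒜.Dart} {x y : Vertex G n}
    (hb : BoundsHoroCell 𝒜 i (p ++ 𝒜.graph.revPath q))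
    (hp : 𝒜.cuspedSpace.IsWalkIn U x p y) (hq : 𝒜.cuspedSpace.IsWalkIn U x q y) :
    Homot (X := 𝒜.cuspedSpace) U x p q y :=
  Homot.of_loop (homot_of_boundsHoroCell hb (hp.append hq.rev)) hq

theorem isVert_vert {i : Fin n} {k : ℕ} {g : G} {b : Bool} :
    Dart.isVert 𝒜 (.vert i g k b) = true := rfl

theorem boundsHoroCell_square {i : Fin n} {k : ℕ} {g h : G} (hne : g ≠ h) {e e' : 𝒜.Dart}
    (he : IsHoriz 𝒜 i k g h e) (he' : IsHoriz 𝒜 i (k + 1) g h e') :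
    BoundsHoroCell 𝒜 i [.vert i g k true, e', .vert i h k false, Dart.inv 𝒜 e] := by
  refine Or.inr (Or.inl ⟨⟨by simp, ⟨Vertex.at i g k, rfl, he'.1, he'.2.1.symm, he.2.1, he.inv.2.1⟩,
    ?_⟩, ?_, rfl, ?_⟩)
  · change (List.map (Dart.src 𝒜) _).Nodup
    simp only [List.map_cons, List.map_nil]
    rw [he'.1, he.inv.1]
    simp [Dart.src, hne]
  · simp only [List.forall_mem_cons]
    exact ⟨rfl, he'.2.2.1, rfl, he.inv.2.2.1, by simp⟩
  · simp [List.countP_cons, isVert_vert, he'.2.2.2, he.inv.2.2.2]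

theorem boundsHoroCell_triangle {i : Fin n} {k : ℕ} {g h l : G} (hgh : g ≠ h) (hhl : h ≠ l)
    (hgl : g ≠ l) {e₁ e₂ e₃ : 𝒜.Dart} (he₁ : IsHoriz 𝒜 i k g h e₁) (he₂ : IsHoriz 𝒜 i k h l e₂)
    (he₃ : IsHoriz 𝒜 i k g l e₃) : BoundsHoroCell 𝒜 i [e₁, e₂, Dart.inv 𝒜 e₃] := by
  refine Or.inl ⟨⟨by simp, ⟨Vertex.at i g k, he₁.1, he₂.1.trans he₁.2.1.symm,
    he₃.2.1.trans he₂.2.1.symm, he₃.inv.2.1⟩, ?_⟩, ?_, rfl, ?_⟩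
  · change ([Dart.src 𝒜 _, Dart.src 𝒜 _, Dart.src 𝒜 _] : List _).Nodup
    rw [he₁.1, he₂.1, he₃.inv.1]
    simp [hgh, hhl, hgl]
  · simp only [List.forall_mem_cons]
    exact ⟨he₁.2.2.1, he₂.2.2.1, he₃.inv.2.2.1, by simp⟩
  · simp [he₁.2.2.2, he₂.2.2.2, he₃.inv.2.2.2]

/-- The path up over `g`, along a horizontal edge, and down over `h` is homotopic to a horizontal
edge one level below. -/
theorem homot_square {i : Fin n} {k : ℕ} {g h : G} (hne : g ≠ h) {e e' : 𝒜.Dart}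
    (he : IsHoriz 𝒜 i k g h e) (he' : IsHoriz 𝒜 i (k + 1) g h e')
    (h1 : Vertex.at i g k ∈ U) (h2 : Vertex.at i g (k + 1) ∈ U)
    (h3 : Vertex.at i h (k + 1) ∈ U) (h4 : Vertex.at i h k ∈ U) :
    Homot (X := 𝒜.cuspedSpace) U (Vertex.at i g k)
      [.vert i g k true, e', .vert i h k false] [e] (Vertex.at i h k) :=
  homot_of_boundsHoroCell_append (boundsHoroCell_square hne he he')
    (isWalkIn_cons rfl h1 rfl (isWalkIn_cons he'.1 h2 he'.2.1 (isWalkIn_cons rfl h3 rfl ⟨h4, rfl⟩)))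
    (he.isWalkIn h1 h4)

theorem homot_triangle {i : Fin n} {k : ℕ} {g h l : G} (hgh : g ≠ h) (hhl : h ≠ l) (hgl : g ≠ l)
    {e₁ e₂ e₃ : 𝒜.Dart} (he₁ : IsHoriz 𝒜 i k g h e₁) (he₂ : IsHoriz 𝒜 i k h l e₂)
    (he₃ : IsHoriz 𝒜 i k g l e₃) (h1 : Vertex.at i g k ∈ U) (h2 : Vertex.at i h k ∈ U)
    (h3 : Vertex.at i l k ∈ U) :
    Homot (X := 𝒜.cuspedSpace) U (Vertex.at i g k) [e₁, e₂] [e₃] (Vertex.at i l k) :=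
  homot_of_boundsHoroCell_append (boundsHoroCell_triangle hgh hhl hgl he₁ he₂ he₃)
    ((he₁.isWalkIn h1 h2).append (he₂.isWalkIn h2 h3)) (he₃.isWalkIn h1 h3)

/-- Horizontal edges do not change the depth. -/
theorem exists_at_of_not_isVert {i : Fin n} {k : ℕ} {g : G} {e : 𝒜.Dart}
    (h1 : Dart.src 𝒜 e = .at i g k) (h2 : Dart.InHoroball 𝒜 i e) (h3 : Dart.isVert 𝒜 e = false) :
    ∃ h, Dart.src 𝒜 (Dart.inv 𝒜 e) = .at i h k := by
  obtain ⟨g', s, b⟩ | ⟨j, k', g', h', hne, hd⟩ | ⟨j, g', k', b⟩ := e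
  · have hk : k = 0 := by
      have := congrArg Vertex.depth h1
      rw [Vertex.depth_at] at this
      cases b <;> exact this.symm
    subst hk
    cases b
    · exact ⟨g', rfl⟩
    · exact ⟨g' * s, rfl⟩
  · obtain rfl : j = i := h2
    have hk := congrArg Vertex.depth h1
    rw [Vertex.depth_at] at hk
    obtain rfl : k' + 1 = k := hk
    exact ⟨h', rfl⟩
  · simp [Dart.isVert] at h3

theorem dart_vert_src_eq {i : Fin n} {k : ℕ} {g : G} {b : Bool} :
    Dart.src 𝒜 (.vert i g k b) = .at i g (if b then k else k + 1) := by
  cases b <;> rfl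

theorem dart_vert_tgt_eq {i : Fin n} {k : ℕ} {g : G} {b : Bool} :
    Dart.src 𝒜 (Dart.inv 𝒜 (.vert i g k b)) = .at i g (if b then k + 1 else k) := by
  cases b <;> rfl

/-- In a circuit with four edges, of which the first and the third are vertical, one of the two
others is a horizontal edge at the lower level. -/
theorem exists_isHoriz_of_opposite {i : Fin n} {k : ℕ} {g₁ g₂ : G} {b₁ b₂ : Bool} {y w : 𝒜.Dart}
    (hc : 𝒜.graph.IsCircuit [.vert i g₁ k b₁, y, .vert i g₂ k b₂, w])
    (hy : Dart.InHoroball 𝒜 i y ∧ Dart.isVert 𝒜 y = false)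
    (hw : Dart.InHoroball 𝒜 i w ∧ Dart.isVert 𝒜 w = false) :
    g₁ ≠ g₂ ∧ ∃ e, IsHoriz 𝒜 i k g₁ g₂ e := by
  obtain ⟨-, ⟨x, e1, e2, e3, e4, e5⟩, hnd⟩ := hc
  replace e2 : Dart.src 𝒜 y = _ := e2.trans dart_vert_tgt_eq
  replace e3 : _ = Dart.src 𝒜 (Dart.inv 𝒜 y) := dart_vert_src_eq.symm.trans e3
  replace e4 : Dart.src 𝒜 w = _ := e4.trans dart_vert_tgt_eq
  replace e5 : Dart.src 𝒜 (Dart.inv 𝒜 w) = _ := e5.trans (e1.symm.trans dart_vert_src_eq)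
  obtain ⟨h, hh⟩ := exists_at_of_not_isVert e2 hy.1 hy.2
  rw [hh, Vertex.at_inj] at e3
  obtain ⟨rfl, hk⟩ := e3
  simp only [List.map_cons, List.map_nil] at hnd
  change ([Dart.src 𝒜 _, Dart.src 𝒜 _, Dart.src 𝒜 _, Dart.src 𝒜 _] : List _).Nodup at hnd
  rw [e2, e4, dart_vert_src_eq, dart_vert_src_eq] at hnd
  cases b₁ <;> cases b₂ <;> simp at hk hnd ⊢ <;>
    simp only [reduceIte, Bool.false_eq_true] at e2 hh e4 e5
  · exact ⟨hnd, y, e2, hh, hy.1, hy.2⟩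
  · exact ⟨hnd, _, e5, by rw [show Dart.inv 𝒜 (Dart.inv 𝒜 w) = w from 𝒜.graph.inv_inv w, e4],
      (IsHoriz.inv ⟨e4, e5, hw.1, hw.2⟩).2.2⟩

/-- Two consecutive edges of a circuit with four edges are not both vertical, if they connect the
same two levels. -/
theorem not_vert_vert {i : Fin n} {k : ℕ} {g₁ g₂ : G} {b₁ b₂ : Bool} {z w : 𝒜.Dart}
    (hc : 𝒜.graph.IsCircuit [.vert i g₁ k b₁, .vert i g₂ k b₂, z, w]) : False := by
  obtain ⟨-, ⟨x, e1, e2, e3, e4, e5⟩, hnd⟩ := hc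
  replace e2 := dart_vert_src_eq.symm.trans (e2.trans dart_vert_tgt_eq)
  replace e3 : Dart.src 𝒜 z = _ := e3.trans dart_vert_tgt_eq
  change ([Dart.src 𝒜 _, Dart.src 𝒜 _, Dart.src 𝒜 _, Dart.src 𝒜 _] : List _).Nodup at hnd
  rw [e3, dart_vert_src_eq, dart_vert_src_eq] at hnd
  rw [Vertex.at_inj] at e2
  obtain ⟨rfl, hk⟩ := e2
  cases b₁ <;> cases b₂ <;> simp at hk hnd

/-- If a pentagon is the union of a square and a triangle, then the end points of its two lower
horizontal edges are joined by a horizontal edge. -/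
theorem exists_isHoriz_of_symmDiff {i : Fin n} {k : ℕ} {g h l : G} {e e₁ e₂ : 𝒜.Dart}
    (he : IsHoriz 𝒜 i (k + 1) g l e) (he₁ : IsHoriz 𝒜 i k g h e₁) (he₂ : IsHoriz 𝒜 i k h l e₂)
    {q t : List 𝒜.Dart} (hq : IsHoroCircuit 𝒜 i 2 2 q) (ht : IsHoroCircuit 𝒜 i 3 0 t)
    (hs : 𝒜.graph.edgeSet [.vert i g k true, e, .vert i l k false, Dart.inv 𝒜 e₂, Dart.inv 𝒜 e₁] =
      symmDiff (𝒜.graph.edgeSet q) (𝒜.graph.edgeSet t)) : ∃ e', IsHoriz 𝒜 i k g l e' := by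
  obtain ⟨hqc, hqi, hql, hqv⟩ := hq
  have htv : ∀ d ∈ t, Dart.isVert 𝒜 d = false := by
    have := ht.2.2.2
    rw [List.countP_eq_zero] at this
    exact fun d hd => by simpa using this d hd
  have hinv : ∀ d, Dart.isVert 𝒜 (Dart.inv 𝒜 d) = Dart.isVert 𝒜 d := by
    rintro (_ | _ | _) <;> rfl
  have hvert : ∀ d ∈ q, Dart.isVert 𝒜 d = true →
      ∃ g' b, (g' = g ∨ g' = l) ∧ d = .vert i g' k b := by
    intro d hd hv
    have hmem : d ∈ 𝒜.graph.edgeSet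
        [.vert i g k true, e, .vert i l k false, Dart.inv 𝒜 e₂, Dart.inv 𝒜 e₁] := by
      rw [hs]
      refine Or.inl ⟨Or.inl hd, ?_⟩
      rintro (h' | h')
      · rw [htv _ h'] at hv; simp at hv
      · have := htv _ h'
        rw [show 𝒜.graph.inv d = Dart.inv 𝒜 d from rfl, hinv, hv] at this
        simp at this
    have n1 := he.2.2.2
    have n2 := he₂.inv.2.2.2
    have n3 := he₁.inv.2.2.2
    have main : ∀ d', Dart.isVert 𝒜 d' = true → d' ∈
        [.vert i g k true, e, .vert i l k false, Dart.inv 𝒜 e₂, Dart.inv 𝒜 e₁] →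
        ∃ g' b, (g' = g ∨ g' = l) ∧ d' = .vert i g' k b := by
      intro d' hv' hd'
      simp only [List.mem_cons, List.not_mem_nil, or_false] at hd'
      rcases hd' with rfl | rfl | rfl | rfl | rfl
      · exact ⟨g, true, Or.inl rfl, rfl⟩
      · rw [n1] at hv'; simp at hv'
      · exact ⟨l, false, Or.inr rfl, rfl⟩
      · rw [n2] at hv'; simp at hv'
      · rw [n3] at hv'; simp at hv'
    rcases hmem with hm | hm
    · exact main d hv hm
    · obtain ⟨g', b, h1, h2⟩ := main (Dart.inv 𝒜 d) (by rw [hinv, hv]) hm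
      refine ⟨g', !b, h1, ?_⟩
      rw [← show Dart.inv 𝒜 (Dart.inv 𝒜 d) = d from 𝒜.graph.inv_inv d, h2]
      rfl
  have conc : ∀ {g₁ g₂ : G}, (g₁ = g ∨ g₁ = l) → (g₂ = g ∨ g₂ = l) →
      (g₁ ≠ g₂ ∧ ∃ e, IsHoriz 𝒜 i k g₁ g₂ e) → ∃ e', IsHoriz 𝒜 i k g l e' := by
    rintro g₁ g₂ (rfl | rfl) (rfl | rfl) ⟨hne, e', he'⟩
    · exact absurd rfl hne
    · exact ⟨e', he'⟩
    · exact ⟨_, he'.inv⟩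
    · exact absurd rfl hne
  have rot : ∀ {a b c d : 𝒜.Dart}, 𝒜.graph.IsCircuit [a, b, c, d] →
      𝒜.graph.IsCircuit [b, c, d, a] := by
    rintro a b c d ⟨-, ⟨x, e1, e2, e3, e4, e5⟩, hnd⟩
    refine ⟨by simp, ⟨_, e2, e3, e4, e1.trans e5.symm, rfl⟩, ?_⟩
    exact (List.nodup_rotate (n := 1)).2 hnd
  match q, hql with
  | [a, b, c, d], _ =>
    have hva := hvert a (by simp)
    have hvb := hvert b (by simp)
    have hvc := hvert c (by simp)
    have hvd := hvert d (by simp)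
    have hia := hqi a (by simp)
    have hib := hqi b (by simp)
    have hic := hqi c (by simp)
    have hid := hqi d (by simp)
    cases ha : Dart.isVert 𝒜 a <;> cases hb : Dart.isVert 𝒜 b <;>
      cases hc : Dart.isVert 𝒜 c <;> cases hd : Dart.isVert 𝒜 d <;>
      simp [ha, hb, hc, hd] at hqv
    · obtain ⟨g₁, b₁, h₁, rfl⟩ := hvc hc
      obtain ⟨g₂, b₂, h₂, rfl⟩ := hvd hd
      exact (not_vert_vert (rot (rot hqc))).elim
    · obtain ⟨g₁, b₁, h₁, rfl⟩ := hvb hb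
      obtain ⟨g₂, b₂, h₂, rfl⟩ := hvd hd
      exact conc h₁ h₂ (exists_isHoriz_of_opposite (rot hqc) ⟨hic, hc⟩ ⟨hia, ha⟩)
    · obtain ⟨g₁, b₁, h₁, rfl⟩ := hvb hb
      obtain ⟨g₂, b₂, h₂, rfl⟩ := hvc hc
      exact (not_vert_vert (rot hqc)).elim
    · obtain ⟨g₁, b₁, h₁, rfl⟩ := hva ha
      obtain ⟨g₂, b₂, h₂, rfl⟩ := hvd hd
      exact (not_vert_vert (rot (rot (rot hqc)))).elim
    · obtain ⟨g₁, b₁, h₁, rfl⟩ := hva ha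
      obtain ⟨g₂, b₂, h₂, rfl⟩ := hvc hc
      exact conc h₁ h₂ (exists_isHoriz_of_opposite hqc ⟨hib, hb⟩ ⟨hid, hd⟩)
    · obtain ⟨g₁, b₁, h₁, rfl⟩ := hva ha
      obtain ⟨g₂, b₂, h₂, rfl⟩ := hvb hb
      exact (not_vert_vert hqc).elim

/-- The path up over `g`, along a horizontal edge, and down over `l` is homotopic to two
horizontal edges one level below: either the pentagon is a 2-cell, or it is the union of a square
and a triangle. -/
theorem homot_pentagon {i : Fin n} {k : ℕ} {g h l : G} (hgh : g ≠ h) (hhl : h ≠ l) (hgl : g ≠ l)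
    {e e₁ e₂ : 𝒜.Dart} (he : IsHoriz 𝒜 i (k + 1) g l e) (he₁ : IsHoriz 𝒜 i k g h e₁)
    (he₂ : IsHoriz 𝒜 i k h l e₂)
    (h1 : Vertex.at i g k ∈ U) (h2 : Vertex.at i g (k + 1) ∈ U)
    (h3 : Vertex.at i l (k + 1) ∈ U) (h4 : Vertex.at i l k ∈ U) (h5 : Vertex.at i h k ∈ U) :
    Homot (X := 𝒜.cuspedSpace) U (Vertex.at i g k)
      [.vert i g k true, e, .vert i l k false] [e₁, e₂] (Vertex.at i l k) := by
  by_cases hex : ∃ e', IsHoriz 𝒜 i k g l e'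
  · obtain ⟨e', he'⟩ := hex
    exact (homot_square hgl he' he h1 h2 h3 h4).trans
      (homot_triangle hgh hhl hgl he₁ he₂ he' h1 h5 h4).symm
  refine homot_of_boundsHoroCell_append (i := i) (q := [e₁, e₂]) ?_
    (isWalkIn_cons rfl h1 rfl (isWalkIn_cons he.1 h2 he.2.1 (isWalkIn_cons rfl h3 rfl ⟨h4, rfl⟩)))
    ((he₁.isWalkIn h1 h5).append (he₂.isWalkIn h5 h4))
  change BoundsHoroCell 𝒜 i
    [.vert i g k true, e, .vert i l k false, Dart.inv 𝒜 e₂, Dart.inv 𝒜 e₁]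
  refine Or.inr (Or.inr ⟨⟨⟨by simp, ⟨Vertex.at i g k, rfl, he.1, he.2.1.symm, he₂.2.1,
    he₁.2.1.trans he₂.inv.2.1.symm, he₁.inv.2.1⟩, ?_⟩, ?_, rfl, ?_⟩, ?_⟩)
  · change (List.map (Dart.src 𝒜) _).Nodup
    simp only [List.map_cons, List.map_nil]
    rw [he.1, he₁.inv.1, he₂.inv.1]
    simp [Dart.src, hgh, hgl, hhl.symm]
  · simp only [List.forall_mem_cons]
    exact ⟨rfl, he.2.2.1, rfl, he₂.inv.2.2.1, he₁.inv.2.2.1, by simp⟩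
  · simp [List.countP_cons, isVert_vert, he.2.2.2, he₁.inv.2.2.2, he₂.inv.2.2.2]
  · rintro ⟨q, t, hq, ht, hs⟩
    exact hex (exists_isHoriz_of_symmDiff he he₁ he₂ hq ht hs)

end PeripheralPresentation

namespace PeripheralPresentation

open TwoComplex

variable {G : Type u} {n : ℕ} [Group G] {𝒜 : PeripheralPresentation G n}

/-! ### Filling loops in the Cayley complex -/

theorem wordPath_append (g : G) (w w' : List (𝒜.S × Bool)) :
    wordPath 𝒜 g (w ++ w') = wordPath 𝒜 g w ++
      wordPath 𝒜 (g * FreeGroup.lift (Subtype.val : 𝒜.S → G) (FreeGroup.mk w)) w' := by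
  induction w generalizing g with
  | nil => simp [wordPath, ← FreeGroup.one_eq_mk]
  | cons a w ih =>
    obtain ⟨s, b⟩ := a
    cases b <;> simp [wordPath, ih, mul_assoc]

theorem length_wordPath (g : G) (w : List (𝒜.S × Bool)) : (wordPath 𝒜 g w).length = w.length := by
  induction w generalizing g with
  | nil => rfl
  | cons a w ih =>
    obtain ⟨s, b⟩ := a
    cases b <;> simp [wordPath, ih]

/-- The paths reading `w` and `w'` from any element of `G` are homotopic, within a ball whose
radius does not depend on that element. -/
def UnifHomot (w w' : List (𝒜.S × Bool)) : Prop :=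
  ∃ A, ∀ g, Homot (X := 𝒜.cuspedSpace) (𝒜.cuspedSpace.cball A (Vertex.base g)) (Vertex.base g)
    (wordPath 𝒜 g w) (wordPath 𝒜 g w')
    (Vertex.base (g * FreeGroup.lift (Subtype.val : 𝒜.S → G) (FreeGroup.mk w)))

namespace UnifHomot

variable {w w' v v' : List (𝒜.S × Bool)}

theorem isWalkIn_wordPath (g : G) (w : List (𝒜.S × Bool)) :
    𝒜.cuspedSpace.IsWalkIn (𝒜.cuspedSpace.cball w.length (Vertex.base g)) (Vertex.base g)
    (wordPath 𝒜 g w)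
    (Vertex.base (g * FreeGroup.lift (Subtype.val : 𝒜.S → G) (FreeGroup.mk w))) :=
  DartGraph.IsWalk.isWalkIn_cball (connected 𝒜) (isWalk_wordPath 𝒜 w g)
    (DartGraph.dist_self _).le (by rw [zero_add]; exact (length_wordPath g w).le)

theorem lift_eq (h : UnifHomot w w') : FreeGroup.lift (Subtype.val : 𝒜.S → G) (FreeGroup.mk w) =
    FreeGroup.lift (Subtype.val : 𝒜.S → G) (FreeGroup.mk w') := by
  obtain ⟨A, h⟩ := h
  have := (h 1).right.right_unique (isWalkIn_wordPath 1 w')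
  exact mul_left_cancel (Vertex.base.inj this)

theorem refl (w : List (𝒜.S × Bool)) : UnifHomot w w :=
  ⟨w.length, fun g => Homot.refl (isWalkIn_wordPath g w)⟩

theorem symm (h : UnifHomot w w') : UnifHomot w' w := by
  have he := h.lift_eq
  obtain ⟨A, h⟩ := h
  exact ⟨A, fun g => he ▸ (h g).symm⟩

theorem trans (h : UnifHomot w w') (h' : UnifHomot w' v) : UnifHomot w v := by
  have he := h.lift_eq
  obtain ⟨A, h⟩ := h
  obtain ⟨B, h'⟩ := h'
  exact ⟨max A B, fun g => ((h g).mono (DartGraph.cball_mono (le_max_left _ _) _)).trans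
    (he ▸ (h' g).mono (DartGraph.cball_mono (le_max_right _ _) _))⟩

theorem append (h : UnifHomot w w') (h' : UnifHomot v v') : UnifHomot (w ++ v) (w' ++ v') := by
  have he := h.lift_eq
  obtain ⟨A, h⟩ := h
  obtain ⟨B, h'⟩ := h'
  refine ⟨max A (w.length + B), fun g => ?_⟩
  rw [wordPath_append, wordPath_append, ← he, ← FreeGroup.mul_mk, map_mul, ← mul_assoc]
  refine ((h g).mono (DartGraph.cball_mono (le_max_left _ _) _)).append ((h' _).mono ?_)
  exact DartGraph.cball_subset (connected 𝒜) (isWalkIn_wordPath g w).right_mem (le_max_right _ _)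

theorem cancel (s : 𝒜.S) (b : Bool) : UnifHomot [(s, b), (s, !b)] [] := by
  refine ⟨1, fun g => ?_⟩
  have hlift : FreeGroup.lift (Subtype.val : 𝒜.S → G) (FreeGroup.mk [(s, b), (s, !b)]) = 1 := by
    cases b <;> simp
  have h := isWalkIn_wordPath g [(s, b)]
  have e : wordPath 𝒜 g [(s, b), (s, !b)] =
      wordPath 𝒜 g [(s, b)] ++ 𝒜.graph.revPath (wordPath 𝒜 g [(s, b)]) := by
    cases b <;> simp [wordPath, DartGraph.revPath, Dart.inv]
  rw [hlift, mul_one, e]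
  exact Homot.append_rev h

theorem of_mk_eq (h : FreeGroup.mk w = FreeGroup.mk w') : UnifHomot w w' := by
  have red : ∀ {w v : List (𝒜.S × Bool)}, FreeGroup.Red w v → UnifHomot w v := by
    intro w v h
    induction h with
    | refl => exact refl _
    | tail _ h ih =>
      refine ih.trans ?_
      cases h with
      | @not L₁ L₂ s b =>
        have := (refl L₁).append ((cancel s b).append (refl L₂))
        simpa using this
  obtain ⟨v, h1, h2⟩ := FreeGroup.Red.exact.1 h
  exact (red h1).trans (red h2).symm

theorem of_mem_R {r : List (𝒜.S × Bool)} (hr : r ∈ 𝒜.R) : UnifHomot r [] := by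
  refine ⟨r.length, fun g => ?_⟩
  have hw := isWalkIn_wordPath g r
  have e := hw.isWalk.isWalkIn (U := univ) trivial fun _ _ => trivial
  have e' := (𝒜.cuspedSpace.closed (.inl (g, ⟨r, hr⟩))).isWalkIn (U := univ) trivial
    fun _ _ => trivial
  have he := e.right_unique e'
  rw [he] at hw ⊢
  exact Homot.cell (X := 𝒜.cuspedSpace) (.inl (g, ⟨r, hr⟩)) hw

/-- The paths reading a word that represents `1` are uniformly null-homotopic, as such a word is a
product of conjugates of relators and their inverses. -/
theorem of_lift_eq_one (h : FreeGroup.lift (Subtype.val : 𝒜.S → G) (FreeGroup.mk w) = 1) :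
    UnifHomot w [] := by
  have hw : FreeGroup.mk w ∈ Subgroup.normalClosure (FreeGroup.mk '' 𝒜.R) := by
    rw [𝒜.R_pres]; exact h
  have key : ∀ x ∈ Subgroup.normalClosure (FreeGroup.mk '' 𝒜.R),
      ∀ w, FreeGroup.mk w = x → UnifHomot w [] := by
    intro x hx
    rw [Subgroup.normalClosure] at hx
    induction hx using Subgroup.closure_induction with
    | mem x hx =>
      intro w hw
      obtain ⟨a, ⟨r, hr, rfl⟩, hx⟩ := Group.mem_conjugatesOfSet_iff.1 hx
      obtain ⟨c, rfl⟩ := isConj_iff.1 hx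
      obtain ⟨v, rfl⟩ := Quot.exists_rep c
      change FreeGroup.mk w = FreeGroup.mk v * FreeGroup.mk r * (FreeGroup.mk v)⁻¹ at hw
      rw [FreeGroup.inv_mk, FreeGroup.mul_mk, FreeGroup.mul_mk] at hw
      refine (of_mk_eq hw).trans ((((refl v).append (of_mem_R hr)).append (refl _)).trans ?_)
      refine of_mk_eq ?_
      rw [List.append_nil, ← FreeGroup.mul_mk, ← FreeGroup.inv_mk, mul_inv_cancel]
      rfl
    | one => exact fun w hw => of_mk_eq hw
    | mul x y _ _ hx hy =>
      intro w hw
      obtain ⟨wx, rfl⟩ := Quot.exists_rep x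
      obtain ⟨wy, rfl⟩ := Quot.exists_rep y
      exact (of_mk_eq (w' := wx ++ wy) hw).trans ((hx wx rfl).append (hy wy rfl))
    | inv x _ hx =>
      intro w hw
      have h1 := hx (FreeGroup.invRev w) (by rw [← FreeGroup.inv_mk, hw, inv_inv])
      have h2 := (refl w).append h1
      rw [List.append_nil] at h2
      refine h2.symm.trans (of_mk_eq ?_)
      rw [← FreeGroup.mul_mk, ← FreeGroup.inv_mk, mul_inv_cancel]
      rfl
  exact key _ hw w rfl

end UnifHomot

variable (𝒜) in
/-- Short loops in the Cayley complex can be filled uniformly: up to translation there are only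
finitely many of them. -/
theorem exists_forall_wordPath_homot (L : ℕ) :
    ∃ A, ∀ (w : List (𝒜.S × Bool)), w.length ≤ L →
      FreeGroup.lift (Subtype.val : 𝒜.S → G) (FreeGroup.mk w) = 1 → ∀ g,
      Homot (X := 𝒜.cuspedSpace) (𝒜.cuspedSpace.cball A (Vertex.base g)) (Vertex.base g)
        (wordPath 𝒜 g w) [] (Vertex.base g) := by
  classical
  have : Finite 𝒜.S := 𝒜.S_finite
  have hfin := List.finite_length_le (𝒜.S × Bool) L
  have hex : ∀ w : List (𝒜.S × Bool), ∃ A,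
      FreeGroup.lift (Subtype.val : 𝒜.S → G) (FreeGroup.mk w) = 1 → ∀ g,
      Homot (X := 𝒜.cuspedSpace) (𝒜.cuspedSpace.cball A (Vertex.base g)) (Vertex.base g)
        (wordPath 𝒜 g w) [] (Vertex.base g) := by
    intro w
    by_cases hw : FreeGroup.lift (Subtype.val : 𝒜.S → G) (FreeGroup.mk w) = 1
    · obtain ⟨A, hA⟩ := UnifHomot.of_lift_eq_one hw
      rw [hw] at hA
      exact ⟨A, fun _ g => by have := hA g; rwa [mul_one] at this⟩
    · exact ⟨0, fun h => absurd h hw⟩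
  choose A hA using hex
  obtain ⟨B, hB⟩ := (hfin.image A).bddAbove
  exact ⟨B, fun w hw h1 g => (hA w h1 g).mono
    (DartGraph.cball_mono (hB ⟨w, hw, rfl⟩) _)⟩

end PeripheralPresentation

namespace PeripheralPresentation

open TwoComplex

variable {G : Type u} {n : ℕ} [Group G] {𝒜 : PeripheralPresentation G n}
  {U : Set 𝒜.cuspedSpace.V} {i : Fin n} {g h : G}

/-! ### Filling loops in the cusped space -/

variable (𝒜) in
/-- The vertical path with `m` edges over `g`, starting at depth `k`. -/
def rise (i : Fin n) (g : G) : ℕ → ℕ → List 𝒜.Dart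
  | _, 0 => []
  | k, m + 1 => .vert i g k true :: rise i g (k + 1) m

theorem rise_succ (k m : ℕ) :
    rise 𝒜 i g k (m + 1) = rise 𝒜 i g k m ++ [.vert i g (k + m) true] := by
  induction m generalizing k with
  | zero => rfl
  | succ m ih =>
    rw [rise, ih (k + 1), rise, List.cons_append, add_right_comm, add_assoc]

theorem length_rise (k m : ℕ) : (rise 𝒜 i g k m).length = m := by
  induction m generalizing k with
  | zero => rfl
  | succ m ih => rw [rise, List.length_cons, ih]

theorem isWalkIn_rise {k m : ℕ} (hU : ∀ t ≤ m, Vertex.at i g (k + t) ∈ U) :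
    𝒜.cuspedSpace.IsWalkIn U (Vertex.at i g k) (rise 𝒜 i g k m) (Vertex.at i g (k + m)) := by
  induction m generalizing k with
  | zero => exact ⟨hU 0 le_rfl, rfl⟩
  | succ m ih =>
    refine isWalkIn_cons rfl (hU 0 (Nat.zero_le _)) rfl ?_
    have := ih (k := k + 1) fun t ht => by
      have := hU (t + 1) (by omega)
      rwa [show k + (t + 1) = k + 1 + t by ring] at this
    rwa [show k + 1 + m = k + (m + 1) by ring] at this

theorem isWalk_rise (i : Fin n) (g : G) (k m : ℕ) :
    𝒜.cuspedSpace.IsWalk (Vertex.at i g k) (rise 𝒜 i g k m) (Vertex.at i g (k + m)) :=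
  (isWalkIn_rise (U := univ) fun _ _ => trivial).isWalk

theorem dist_at_at_le (i : Fin n) (g : G) (k m : ℕ) :
    𝒜.cuspedSpace.dist (Vertex.at i g k) (Vertex.at i g (k + m)) ≤ m :=
  (isWalk_rise i g k m).dist_le.trans (length_rise k m).le

theorem dist_base_at_le (i : Fin n) (g : G) (k : ℕ) :
    𝒜.cuspedSpace.dist (Vertex.base g) (Vertex.at i g k) ≤ k := by
  have := dist_at_at_le (𝒜 := 𝒜) i g 0 k
  rwa [zero_add] at this

/-- Every horizontal edge at the bottom of a horoball is an edge of the Cayley graph. -/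
theorem exists_wordPath_eq {e : 𝒜.Dart} (he : IsHoriz 𝒜 i 0 g h e) :
    ∃ w : List (𝒜.S × Bool), w.length = 1 ∧ wordPath 𝒜 g w = [e] := by
  obtain ⟨h1, h2, h3, h4⟩ := he
  obtain ⟨g', s, b⟩ | ⟨j, k', g', h', hne, hd⟩ | ⟨j, g', k', b⟩ := e
  · cases b
    · obtain rfl : g' * s = g := Vertex.base.inj h1
      exact ⟨[(s, false)], rfl, by simp [wordPath]⟩
    · obtain rfl : g' = g := Vertex.base.inj h1
      exact ⟨[(s, true)], rfl, by simp [wordPath]⟩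
  · cases h1
  · cases h4

theorem dist_of_isHoriz {k : ℕ} {e : 𝒜.Dart} (he : IsHoriz 𝒜 i k g h e) :
    𝒜.cuspedSpace.dist (Vertex.at i g k) (Vertex.at i h k) ≤ 1 := by
  have : 𝒜.cuspedSpace.IsWalk (Vertex.at i g k) [e] (Vertex.at i h k) := ⟨he.1, he.2.1⟩
  exact this.dist_le

theorem revPath_rise_succ (k m : ℕ) : 𝒜.graph.revPath (rise 𝒜 i g k (m + 1)) =
    .vert i g (k + m) false :: 𝒜.graph.revPath (rise 𝒜 i g k m) := by
  rw [rise_succ, DartGraph.revPath_append]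
  rfl

/-- If two vertices of the same depth in a horoball are joined by a horizontal edge, then the
vertical line over the second one is not far from the foot of the first. -/
theorem dist_at_le_of_isHoriz {k t : ℕ} {e : 𝒜.Dart} (he : IsHoriz 𝒜 i k g h e) (ht : t ≤ k) :
    𝒜.cuspedSpace.dist (Vertex.base g) (Vertex.at i h t) ≤ 2 * k + 1 := by
  obtain ⟨m, rfl⟩ := Nat.exists_eq_add_of_le ht
  have h1 := dist_base_at_le (𝒜 := 𝒜) i g (t + m)
  have h2 := dist_of_isHoriz he
  have h3 := (DartGraph.dist_comm _ _).trans_le (dist_at_at_le (𝒜 := 𝒜) i h t m)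
  have h4 := DartGraph.dist_triangle (connected 𝒜) (Vertex.base g) (Vertex.at i g (t + m))
    (Vertex.at i h (t + m))
  have h5 := DartGraph.dist_triangle (connected 𝒜) (Vertex.base g) (Vertex.at i h (t + m))
    (Vertex.at i h t)
  omega

variable (𝒜) in
/-- A horizontal edge of depth `k` can be pushed down to the Cayley graph. -/
theorem exists_homot_wordPath (k : ℕ) : ∃ B, ∀ (i : Fin n) (g h : G) (e : 𝒜.Dart),
    IsHoriz 𝒜 i k g h e → 𝒜.Within i (2 ^ k) g h → g ≠ h →
    ∃ w : List (𝒜.S × Bool), w.length ≤ 2 ^ k ∧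
      Homot (X := 𝒜.cuspedSpace) (𝒜.cuspedSpace.cball B (Vertex.base g)) (Vertex.base g)
        (rise 𝒜 i g 0 k ++ ([e] ++ 𝒜.graph.revPath (rise 𝒜 i h 0 k))) (wordPath 𝒜 g w)
        (Vertex.base h) := by
  induction k with
  | zero =>
    refine ⟨1, fun i g h e he _ _ => ?_⟩
    obtain ⟨w, hw, hwe⟩ := exists_wordPath_eq he
    refine ⟨w, hw.le, ?_⟩
    rw [hwe]
    refine Homot.refl ?_
    have : 𝒜.cuspedSpace.IsWalk (Vertex.base g) [e] (Vertex.base h) :=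
      ⟨he.1, he.2.1⟩
    exact this.isWalkIn_cball (connected 𝒜) (DartGraph.dist_self _).le le_rfl
  | succ k ih =>
    obtain ⟨B, hB⟩ := ih
    refine ⟨2 * k + 3 + B, fun i g h e he hd hgh => ?_⟩
    have hconn := connected 𝒜
    obtain ⟨l, hgl, hlh⟩ := Within.split (m := 2 ^ k) (m' := 2 ^ k)
      (by rwa [← two_mul, ← pow_succ'])
    have hgU : ∀ t ≤ k + 1, Vertex.at i g t ∈
        𝒜.cuspedSpace.cball (2 * k + 3 + B) (Vertex.base g) := fun t ht =>
      (dist_base_at_le i g t).trans (by omega)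
    have hhU : ∀ t ≤ k + 1, Vertex.at i h t ∈
        𝒜.cuspedSpace.cball (2 * k + 3 + B) (Vertex.base g) := fun t ht =>
      (dist_at_le_of_isHoriz he ht).trans (by omega)
    have hrg := isWalkIn_rise (𝒜 := 𝒜) (i := i) (g := g) (k := 0) (m := k)
      fun t ht => by rw [zero_add]; exact hgU t (by omega)
    have hrh := isWalkIn_rise (𝒜 := 𝒜) (i := i) (g := h) (k := 0) (m := k)
      fun t ht => by rw [zero_add]; exact hhU t (by omega)
    rw [zero_add] at hrg hrh
    have core : ∀ mid : List 𝒜.Dart,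
        Homot (X := 𝒜.cuspedSpace) (𝒜.cuspedSpace.cball (2 * k + 3 + B) (Vertex.base g))
          (Vertex.at i g k) [.vert i g k true, e, .vert i h k false] mid (Vertex.at i h k) →
        Homot (X := 𝒜.cuspedSpace) (𝒜.cuspedSpace.cball (2 * k + 3 + B) (Vertex.base g))
          (Vertex.base g)
          (rise 𝒜 i g 0 (k + 1) ++ ([e] ++ 𝒜.graph.revPath (rise 𝒜 i h 0 (k + 1))))
          (rise 𝒜 i g 0 k ++ (mid ++ 𝒜.graph.revPath (rise 𝒜 i h 0 k))) (Vertex.base h) := by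
      intro mid hm
      have := Homot.append_left hrg (hm.append_right hrh.rev)
      rw [rise_succ, revPath_rise_succ, zero_add, List.append_assoc]
      exact this
    by_cases hwd : 𝒜.Within i (2 ^ k) g h
    · obtain ⟨e₁, he₁⟩ := exists_isHoriz hgh hwd
      obtain ⟨w, hw, hw'⟩ := hB i g h e₁ he₁ hwd hgh
      refine ⟨w, hw.trans (Nat.pow_le_pow_right two_pos k.le_succ), (core [e₁] ?_).trans
        (hw'.mono (DartGraph.cball_mono (by omega) _))⟩
      exact homot_square hgh he₁ he (hgU _ (by omega)) (hgU _ le_rfl) (hhU _ le_rfl)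
        (hhU _ (by omega))
    · have hgl' : g ≠ l := by rintro rfl; exact hwd hlh
      have hlh' : l ≠ h := by rintro rfl; exact hwd hgl
      obtain ⟨e₁, he₁⟩ := exists_isHoriz hgl' hgl
      obtain ⟨e₂, he₂⟩ := exists_isHoriz hlh' hlh
      obtain ⟨w₁, hw₁, hw₁'⟩ := hB i g l e₁ he₁ hgl hgl'
      obtain ⟨w₂, hw₂, hw₂'⟩ := hB i l h e₂ he₂ hlh hlh'
      have hl : ∀ t ≤ k, 𝒜.cuspedSpace.dist (Vertex.base g) (Vertex.at i l t) ≤ 2 * k + 1 :=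
        fun t ht => dist_at_le_of_isHoriz he₁ ht
      have h1 := hw₁'.mono (DartGraph.cball_mono (n := 2 * k + 3 + B) (by omega) _)
      have h2 := hw₂'.mono (DartGraph.cball_subset (n := 2 * k + 3 + B) hconn (hl 0 (by omega))
        (by omega))
      have hword : wordPath 𝒜 g (w₁ ++ w₂) = wordPath 𝒜 g w₁ ++ wordPath 𝒜 l w₂ := by
        rw [wordPath_append]
        congr 2
        exact Vertex.base.inj ((UnifHomot.isWalkIn_wordPath g w₁).right_unique h1.right)
      refine ⟨w₁ ++ w₂, by rw [List.length_append, pow_succ]; omega, ?_⟩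
      rw [hword]
      refine (core ([e₁] ++ [e₂]) ?_).trans (Homot.conj_append h1 h2)
      exact homot_pentagon hgl' hlh' hgh he he₁ he₂ (hgU _ (by omega)) (hgU _ le_rfl)
        (hhU _ le_rfl) (hhU _ (by omega)) ((hl k le_rfl).trans (by omega))

variable (𝒜) in
/-- The vertical path from the Cayley graph to a vertex. -/
def stem : Vertex G n → List 𝒜.Dart
  | .base _ => []
  | .horo i g k => rise 𝒜 i g 0 (k + 1)

theorem stem_at (i : Fin n) (g : G) (k : ℕ) : stem 𝒜 (Vertex.at i g k) = rise 𝒜 i g 0 k := by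
  cases k <;> rfl

theorem isWalk_stem (x : Vertex G n) :
    𝒜.cuspedSpace.IsWalk (Vertex.base x.foot) (stem 𝒜 x) x := by
  cases x with
  | base g => rfl
  | horo i g k =>
    have := isWalk_rise (𝒜 := 𝒜) i g 0 (k + 1)
    rwa [zero_add] at this

theorem length_stem (x : Vertex G n) : (stem 𝒜 x).length = x.depth := by
  cases x with
  | base g => rfl
  | horo i g k => exact length_rise 0 (k + 1)

theorem dist_foot_le (x : Vertex G n) :
    𝒜.cuspedSpace.dist x (Vertex.base x.foot) ≤ x.depth :=
  (DartGraph.dist_comm _ _).trans_le ((isWalk_stem x).dist_le.trans (length_stem x).le)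

theorem depth_tgt_le (d : 𝒜.Dart) :
    (Dart.src 𝒜 (Dart.inv 𝒜 d)).depth ≤ (Dart.src 𝒜 d).depth + 1 := by
  obtain ⟨g, s, b⟩ | ⟨j, k, g, h, hne, hd⟩ | ⟨j, g, k, b⟩ := d
  · cases b <;> exact Nat.zero_le _
  · exact Nat.le_succ _
  · rw [dart_vert_src_eq, dart_vert_tgt_eq, Vertex.depth_at, Vertex.depth_at]
    cases b
    · exact Nat.le_succ_of_le (Nat.le_succ k)
    · exact le_rfl

variable (𝒜) in
/-- An edge of bounded depth, conjugated by the vertical paths to the Cayley graph, is homotopic to a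
short path in the Cayley graph, within a ball of uniform radius. -/
theorem exists_homot_wordPath_dart (L : ℕ) : ∃ B, ∀ (d : 𝒜.Dart), (Dart.src 𝒜 d).depth ≤ L →
    ∃ w : List (𝒜.S × Bool), w.length ≤ 2 ^ L ∧
      Homot (X := 𝒜.cuspedSpace)
        (𝒜.cuspedSpace.cball B (Vertex.base (Dart.src 𝒜 d).foot)) (Vertex.base (Dart.src 𝒜 d).foot)
        (stem 𝒜 (Dart.src 𝒜 d) ++ ([d] ++ 𝒜.graph.revPath (stem 𝒜 (Dart.src 𝒜 (Dart.inv 𝒜 d)))))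
        (wordPath 𝒜 (Dart.src 𝒜 d).foot w)
        (Vertex.base (Dart.src 𝒜 (Dart.inv 𝒜 d)).foot) := by
  -- `B k` is the radius needed at depth `k`.
  choose B hB using exists_homot_wordPath 𝒜
  refine ⟨(Finset.range (L + 1)).sup B + L + 1, fun d hd => ?_⟩
  have h2L : 1 ≤ 2 ^ L := Nat.one_le_two_pow
  have hconn := connected 𝒜
  obtain ⟨g, s, b⟩ | ⟨i, k, g, h, hne, hdd⟩ | ⟨i, g, k, b⟩ := d
  · cases b
    · refine ⟨[(s, false)], h2L, ?_⟩
      have e : wordPath 𝒜 (g * s) [(s, false)] = [.cayley g s false] := by simp [wordPath]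
      change Homot (X := 𝒜.cuspedSpace) _ (Vertex.base (g * s)) [.cayley g s false]
        (wordPath 𝒜 (g * s) [(s, false)]) (Vertex.base g)
      rw [e]
      have hw : 𝒜.cuspedSpace.IsWalk (Vertex.base (g * s)) [.cayley g s false] (Vertex.base g) :=
        ⟨rfl, rfl⟩
      exact Homot.refl (hw.isWalkIn_cball hconn (DartGraph.dist_self _).le (Nat.le_add_left _ _))
    · refine ⟨[(s, true)], h2L, ?_⟩
      have hw : 𝒜.cuspedSpace.IsWalk (Vertex.base g) [.cayley g s true] (Vertex.base (g * s)) :=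
        ⟨rfl, rfl⟩
      exact Homot.refl (hw.isWalkIn_cball hconn (DartGraph.dist_self _).le (Nat.le_add_left _ _))
  · obtain ⟨w, hw, hw'⟩ := hB (k + 1) i g h _ (isHoriz_horiz hne hdd) hdd hne
    refine ⟨w, hw.trans (Nat.pow_le_pow_right two_pos hd), hw'.mono (DartGraph.cball_mono ?_ _)⟩
    have : B (k + 1) ≤ (Finset.range (L + 1)).sup B :=
      Finset.le_sup (Finset.mem_range.2 (Nat.lt_succ_of_le hd))
    omega
  · refine ⟨[], by simp, ?_⟩
    rw [dart_vert_src_eq, Vertex.depth_at] at hd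
    rw [dart_vert_src_eq, dart_vert_tgt_eq, stem_at, stem_at, Vertex.foot_at, Vertex.foot_at]
    have key : ∀ m, m ≤ L + 1 → Homot (X := 𝒜.cuspedSpace)
        (𝒜.cuspedSpace.cball ((Finset.range (L + 1)).sup B + L + 1) (Vertex.base g))
        (Vertex.base g) (rise 𝒜 i g 0 m ++ 𝒜.graph.revPath (rise 𝒜 i g 0 m)) [] (Vertex.base g) := by
      intro m hm
      refine Homot.append_rev ((isWalk_rise i g 0 m).isWalkIn_cball hconn
        (DartGraph.dist_self _).le ?_)
      have := length_rise (𝒜 := 𝒜) (i := i) (g := g) 0 m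
      change 0 + (rise 𝒜 i g 0 m).length ≤ _
      omega
    cases b
    · have := key (k + 1) (by simp at hd; omega)
      rw [revPath_rise_succ, zero_add] at this
      exact this
    · have := key (k + 1) (by simp at hd; omega)
      nth_rw 1 [rise_succ] at this
      rw [zero_add, List.append_assoc] at this
      exact this

variable (𝒜) in
/-- Short loops that meet the Cayley graph can be filled uniformly. -/
theorem exists_homot_nil_of_base (L : ℕ) : ∃ A, ∀ (g : G) (p : List 𝒜.Dart),
    𝒜.cuspedSpace.IsWalk (Vertex.base g) p (Vertex.base g) → p.length ≤ L →
    Homot (X := 𝒜.cuspedSpace) (𝒜.cuspedSpace.cball A (Vertex.base g)) (Vertex.base g) p []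
      (Vertex.base g) := by
  obtain ⟨B, hB⟩ := exists_homot_wordPath_dart 𝒜 L
  obtain ⟨C, hC⟩ := exists_forall_wordPath_homot 𝒜 (L * 2 ^ L)
  have hconn := connected 𝒜
  refine ⟨3 * L + B + C, fun g₀ p hp hL => ?_⟩
  have key : ∀ (p : List 𝒜.Dart) (x y : Vertex G n) (s : ℕ), 𝒜.cuspedSpace.IsWalk x p y →
      s + p.length ≤ L → x.depth ≤ s → 𝒜.cuspedSpace.dist (Vertex.base g₀) x ≤ s →
      ∃ w : List (𝒜.S × Bool), w.length ≤ p.length * 2 ^ L ∧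
        Homot (X := 𝒜.cuspedSpace) (𝒜.cuspedSpace.cball (3 * L + B + C) (Vertex.base g₀))
          (Vertex.base x.foot) (stem 𝒜 x ++ (p ++ 𝒜.graph.revPath (stem 𝒜 y)))
          (wordPath 𝒜 x.foot w) (Vertex.base y.foot) := by
    intro p
    induction p with
    | nil =>
      intro x y s hp hL hx hd
      obtain rfl : x = y := hp
      simp only [List.length_nil] at hL
      refine ⟨[], by simp, Homot.append_rev ((isWalk_stem x).isWalkIn_cball hconn (k := 2 * L) ?_ ?_)⟩
      · have h1 := DartGraph.dist_triangle hconn (Vertex.base g₀) x (Vertex.base x.foot)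
        have h2 := dist_foot_le (𝒜 := 𝒜) x
        omega
      · have h3 := length_stem (𝒜 := 𝒜) x
        change 2 * L + (stem 𝒜 x).length ≤ _
        omega
    | cons d p ih =>
      intro x y s hp hL hx hd
      obtain ⟨rfl, hp⟩ := hp
      rw [List.length_cons] at hL
      obtain ⟨w₂, hw₂, hw₂'⟩ := ih _ y (s + 1) hp (by omega)
        ((depth_tgt_le d).trans (Nat.succ_le_succ hx))
        ((DartGraph.dist_triangle hconn _ _ _).trans
          (add_le_add hd (DartGraph.dist_src_tgt (Γ := 𝒜.graph) d)))
      obtain ⟨w₁, hw₁, hw₁'⟩ := hB d (hx.trans (by omega))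
      have hfoot : 𝒜.cuspedSpace.dist (Vertex.base g₀) (Vertex.base (Dart.src 𝒜 d).foot) ≤ 2 * L := by
        have h1 := DartGraph.dist_triangle hconn (Vertex.base g₀) (Dart.src 𝒜 d)
          (Vertex.base (Dart.src 𝒜 d).foot)
        have h2 := dist_foot_le (𝒜 := 𝒜) (Dart.src 𝒜 d)
        change 𝒜.cuspedSpace.dist (Vertex.base g₀) (Dart.src 𝒜 d) ≤ s at hd
        change (Dart.src 𝒜 d).depth ≤ s at hx
        omega
      have h1 := hw₁'.mono (DartGraph.cball_subset (n := 3 * L + B + C) hconn hfoot (by omega))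
      have hword : wordPath 𝒜 (Dart.src 𝒜 d).foot (w₁ ++ w₂) =
          wordPath 𝒜 (Dart.src 𝒜 d).foot w₁ ++
            wordPath 𝒜 (Dart.src 𝒜 (Dart.inv 𝒜 d)).foot w₂ := by
        rw [wordPath_append]
        congr 2
        exact Vertex.base.inj ((UnifHomot.isWalkIn_wordPath _ w₁).right_unique h1.right)
      refine ⟨w₁ ++ w₂, by rw [List.length_append, List.length_cons, add_mul]; omega, ?_⟩
      have := Homot.conj_append h1 hw₂'
      change Homot (X := 𝒜.cuspedSpace) _ _ _ (wordPath 𝒜 (Dart.src 𝒜 d).foot (w₁ ++ w₂)) _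
      rw [hword]
      exact this
  obtain ⟨w, hw, hw'⟩ := key p _ _ 0 hp (by omega) le_rfl (DartGraph.dist_self _).le
  change Homot (X := 𝒜.cuspedSpace) _ (Vertex.base g₀) (p ++ []) (wordPath 𝒜 g₀ w)
    (Vertex.base g₀) at hw'
  replace hw' := hw'.of_append_nil
  have hlift : FreeGroup.lift (Subtype.val : 𝒜.S → G) (FreeGroup.mk w) = 1 := by
    have := Vertex.base.inj ((UnifHomot.isWalkIn_wordPath g₀ w).right_unique hw'.right)
    exact mul_eq_left.1 this
  refine hw'.trans ((hC w (hw.trans (Nat.mul_le_mul_right _ hL)) hlift g₀).mono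
    (DartGraph.cball_mono (by omega) _))

end PeripheralPresentation

namespace PeripheralPresentation

open TwoComplex

variable {G : Type u} {n : ℕ} [Group G] {𝒜 : PeripheralPresentation G n}
  {U : Set 𝒜.cuspedSpace.V} {i : Fin n} {g h : G}

theorem IsHoriz.unique {k : ℕ} {e e' : 𝒜.Dart} (he : IsHoriz 𝒜 i (k + 1) g h e)
    (he' : IsHoriz 𝒜 i (k + 1) g h e') : e = e' := by
  have key : ∀ {e : 𝒜.Dart}, IsHoriz 𝒜 i (k + 1) g h e →
      ∃ hne hd, e = .horiz i k g h hne hd := by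
    rintro (⟨g', s, b⟩ | ⟨j, k', g', h', hne, hd⟩ | ⟨j, g', k', b⟩) ⟨h1, h2, h3, h4⟩
    · cases b <;> cases h1
    · cases h1
      cases h2
      exact ⟨_, _, rfl⟩
    · cases h4
  obtain ⟨_, _, rfl⟩ := key he
  obtain ⟨_, _, rfl⟩ := key he'
  rfl

/-- A horizontal edge is homotopic to the path that runs along the horizontal edge `m` levels
above it. -/
theorem homot_ladder {k m : ℕ} (hne : g ≠ h) (hd : 𝒜.Within i (2 ^ (k + 1)) g h) {e e' : 𝒜.Dart}
    (he : IsHoriz 𝒜 i (k + 1) g h e) (he' : IsHoriz 𝒜 i (k + 1 + m) g h e')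
    (hg : ∀ t ≤ m, Vertex.at i g (k + 1 + t) ∈ U) (hh : ∀ t ≤ m, Vertex.at i h (k + 1 + t) ∈ U) :
    Homot (X := 𝒜.cuspedSpace) U (Vertex.at i g (k + 1))
      (rise 𝒜 i g (k + 1) m ++ ([e'] ++ 𝒜.graph.revPath (rise 𝒜 i h (k + 1) m))) [e]
      (Vertex.at i h (k + 1)) := by
  induction m generalizing k e with
  | zero =>
    obtain rfl := he.unique he'
    exact Homot.refl (he.isWalkIn (hg 0 le_rfl) (hh 0 le_rfl))
  | succ m ih =>
    have hd' := hd.mono (Nat.pow_le_pow_right two_pos (Nat.le_succ (k + 1)))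
    obtain ⟨e₁, he₁⟩ := exists_isHoriz hne hd'
    have hadd : ∀ t, k + 1 + 1 + t = k + 1 + (t + 1) := fun t => by ring
    have h1 := ih (k := k + 1) hd' he₁ (by rwa [hadd])
      (fun t ht => by rw [hadd]; exact hg _ (by omega))
      (fun t ht => by rw [hadd]; exact hh _ (by omega))
    have hg0 := hg 0 (Nat.zero_le _)
    have hg1 := hg 1 (by omega)
    have hh0 := hh 0 (Nat.zero_le _)
    have hh1 := hh 1 (by omega)
    have hup : 𝒜.cuspedSpace.IsWalkIn U (Vertex.at i g (k + 1)) [.vert i g (k + 1) true]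
        (Vertex.at i g (k + 1 + 1)) := isWalkIn_cons rfl hg0 rfl ⟨hg1, rfl⟩
    have hdown : 𝒜.cuspedSpace.IsWalkIn U (Vertex.at i h (k + 1 + 1)) [.vert i h (k + 1) false]
        (Vertex.at i h (k + 1)) := isWalkIn_cons rfl hh1 rfl ⟨hh0, rfl⟩
    have h2 := (Homot.append_left hup (h1.append_right hdown)).trans
      (homot_square hne he he₁ hg0 hg1 hh1 hh0)
    have e1 : 𝒜.graph.revPath (rise 𝒜 i h (k + 1) (m + 1)) =
        𝒜.graph.revPath (rise 𝒜 i h (k + 1 + 1) m) ++ [.vert i h (k + 1) false] :=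
      DartGraph.revPath_cons _ _
    rw [e1]
    have e2 : rise 𝒜 i g (k + 1) (m + 1) ++ ([e'] ++
        (𝒜.graph.revPath (rise 𝒜 i h (k + 1 + 1) m) ++ [.vert i h (k + 1) false])) =
        [.vert i g (k + 1) true] ++ ((rise 𝒜 i g (k + 1 + 1) m ++ ([e'] ++
        𝒜.graph.revPath (rise 𝒜 i h (k + 1 + 1) m))) ++ [.vert i h (k + 1) false]) := by
      simp [rise]
    rw [e2]
    exact h2

variable (𝒜) in
/-- `q` is the empty path if `g = h`, and otherwise a horizontal edge of depth `T` from `g`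
to `h`. -/
def IsShortcut (i : Fin n) (T : ℕ) (g h : G) (q : List 𝒜.Dart) : Prop :=
  (g = h ∧ q = []) ∨ (g ≠ h ∧ ∃ e, IsHoriz 𝒜 i T g h e ∧ q = [e])

theorem IsShortcut.isWalkIn {T : ℕ} {q : List 𝒜.Dart} (hq : IsShortcut 𝒜 i T g h q)
    (hg : Vertex.at i g T ∈ U) (hh : Vertex.at i h T ∈ U) :
    𝒜.cuspedSpace.IsWalkIn U (Vertex.at i g T) q (Vertex.at i h T) := by
  rcases hq with ⟨rfl, rfl⟩ | ⟨-, e, he, rfl⟩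
  · exact ⟨hg, rfl⟩
  · exact he.isWalkIn hg hh

/-- Two shortcuts between vertices that are pairwise within reach at their depth can be replaced by
one, across a horizontal triangle. -/
theorem IsShortcut.append {T : ℕ} {l : G} {q q' : List 𝒜.Dart}
    (hq : IsShortcut 𝒜 i (T + 1) g h q) (hq' : IsShortcut 𝒜 i (T + 1) h l q')
    (hd : 𝒜.Within i (2 ^ (T + 1)) g l)
    (hg : Vertex.at i g (T + 1) ∈ U) (hh : Vertex.at i h (T + 1) ∈ U)
    (hl : Vertex.at i l (T + 1) ∈ U) :
    ∃ q'', IsShortcut 𝒜 i (T + 1) g l q'' ∧ Homot (X := 𝒜.cuspedSpace) U (Vertex.at i g (T + 1))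
      (q ++ q') q'' (Vertex.at i l (T + 1)) := by
  have hw := hq.isWalkIn hg hh
  have hw' := hq'.isWalkIn hh hl
  rcases hq with ⟨rfl, rfl⟩ | ⟨hgh, e₁, he₁, rfl⟩
  · exact ⟨q', hq', Homot.refl hw'⟩
  rcases hq' with ⟨rfl, rfl⟩ | ⟨hhl, e₂, he₂, rfl⟩
  · exact ⟨[e₁], Or.inr ⟨hgh, e₁, he₁, rfl⟩, Homot.refl hw⟩
  by_cases hgl : g = l
  · subst hgl
    obtain rfl := he₂.unique he₁.inv
    exact ⟨[], Or.inl ⟨rfl, rfl⟩, Homot.append_rev hw⟩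
  · obtain ⟨e₃, he₃⟩ := exists_isHoriz hgl hd
    exact ⟨[e₃], Or.inr ⟨hgl, e₃, he₃, rfl⟩, homot_triangle hgh hhl hgl he₁ he₂ he₃ hg hh hl⟩

theorem exists_of_src_eq_at_succ {k : ℕ} {d : 𝒜.Dart} (hd : Dart.src 𝒜 d = Vertex.at i g (k + 1)) :
    (∃ h hne hdd, d = .horiz i k g h hne hdd) ∨ d = .vert i g (k + 1) true ∨
      d = .vert i g k false := by
  obtain ⟨g', s, b⟩ | ⟨j, k', g', h', hne, hdd⟩ | ⟨j, g', k', b⟩ := d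
  · cases b <;> cases hd
  · cases hd
    exact Or.inl ⟨_, _, _, rfl⟩
  · cases b
    · cases hd
      exact Or.inr (Or.inr rfl)
    · cases k' with
      | zero => cases hd
      | succ k' =>
        cases hd
        exact Or.inr (Or.inl rfl)

variable (𝒜) in
/-- The part of a horoball that lies within height `m` above the ball of radius `L` about `v`. -/
def tower (v : Vertex G n) (i : Fin n) (L m : ℕ) : Set 𝒜.cuspedSpace.V :=
  {x | ∃ g k t, x = Vertex.at i g (k + t) ∧ t ≤ m ∧ 𝒜.cuspedSpace.dist v (Vertex.at i g k) ≤ L}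

theorem tower_subset (v : Vertex G n) (i : Fin n) (L m : ℕ) :
    tower 𝒜 v i L m ⊆ 𝒜.cuspedSpace.cball (L + m) v := by
  rintro x ⟨g, k, t, rfl, ht, hd⟩
  exact (DartGraph.dist_triangle (connected 𝒜) v (Vertex.at i g k) (Vertex.at i g (k + t))).trans
    (add_le_add hd ((dist_at_at_le i g k t).trans ht))

/-- An edge of a horoball, conjugated by the vertical paths to the level `T` far above, is
homotopic to an edge path with at most one edge. -/
theorem exists_shortcut_dart {k T : ℕ} {d : 𝒜.Dart} (hd : Dart.src 𝒜 d = Vertex.at i g (k + 1))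
    (hbase : ∀ g', Dart.src 𝒜 (Dart.inv 𝒜 d) ≠ Vertex.base g') (hkT : k + 2 ≤ T)
    (hU : ∀ h l, Dart.src 𝒜 (Dart.inv 𝒜 d) = Vertex.at i h l →
      ∀ t ≤ T - l, Vertex.at i h (l + t) ∈ U)
    (hU' : ∀ t ≤ T - (k + 1), Vertex.at i g (k + 1 + t) ∈ U) :
    ∃ h l q, Dart.src 𝒜 (Dart.inv 𝒜 d) = Vertex.at i h (l + 1) ∧ l ≤ k + 1 ∧ k ≤ l + 1 ∧
      𝒜.Within i (2 ^ (k + 1)) g h ∧ IsShortcut 𝒜 i T g h q ∧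
      Homot (X := 𝒜.cuspedSpace) U (Vertex.at i g T)
        (𝒜.graph.revPath (rise 𝒜 i g (k + 1) (T - (k + 1))) ++
          ([d] ++ 𝒜.graph.revPath (𝒜.graph.revPath (rise 𝒜 i h (l + 1) (T - (l + 1)))))) q
        (Vertex.at i h T) := by
  have hrise : ∀ {h : G} {l : ℕ}, l ≤ T → (∀ t ≤ T - l, Vertex.at i h (l + t) ∈ U) →
      𝒜.cuspedSpace.IsWalkIn U (Vertex.at i h l) (rise 𝒜 i h l (T - l)) (Vertex.at i h T) := by
    intro h l hl hU
    have := isWalkIn_rise hU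
    rwa [Nat.add_sub_cancel' hl] at this
  rcases exists_of_src_eq_at_succ hd with ⟨h, hne, hdd, rfl⟩ | rfl | rfl
  · have hTd := hdd.mono (Nat.pow_le_pow_right two_pos (show k + 1 ≤ T by omega))
    obtain ⟨e', he'⟩ := exists_isHoriz hne hTd
    refine ⟨h, k, [e'], rfl, by omega, by omega, hdd, Or.inr ⟨hne, e', he', rfl⟩, ?_⟩
    have h1 := hU h (k + 1) rfl
    have h2 := homot_ladder (m := T - (k + 1)) hne hdd (isHoriz_horiz hne hdd)
      (by rwa [Nat.add_sub_cancel' (by omega)]) hU' h1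
    have h3 := Homot.conj_symm (hrise (by omega) hU') (hrise (by omega) h1) h2
    rw [𝒜.graph.revPath_revPath]
    exact h3
  · refine ⟨g, k + 1, [], rfl, by omega, by omega, Within.refl _ _ _, Or.inl ⟨rfl, rfl⟩, ?_⟩
    have h1 := Homot.rev_append (hrise (h := g) (l := k + 1) (by omega) hU')
    rw [𝒜.graph.revPath_revPath]
    have e : rise 𝒜 i g (k + 1) (T - (k + 1)) =
        [.vert i g (k + 1) true] ++ rise 𝒜 i g (k + 1 + 1) (T - (k + 1 + 1)) := by
      rw [show T - (k + 1) = T - (k + 1 + 1) + 1 by omega]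
      rfl
    rw [← e]
    exact h1
  · obtain ⟨k, rfl⟩ : ∃ k', k = k' + 1 := by
      cases k with
      | zero => exact absurd rfl (hbase g)
      | succ k => exact ⟨k, rfl⟩
    refine ⟨g, k, [], rfl, by omega, by omega, Within.refl _ _ _, Or.inl ⟨rfl, rfl⟩, ?_⟩
    have h1 := Homot.rev_append (hrise (h := g) (l := k + 1) (by omega) (hU g (k + 1) rfl))
    rw [𝒜.graph.revPath_revPath]
    have e : 𝒜.graph.revPath (rise 𝒜 i g (k + 1 + 1) (T - (k + 1 + 1))) ++
        [.vert i g (k + 1) false] = 𝒜.graph.revPath (rise 𝒜 i g (k + 1) (T - (k + 1))) := by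
      rw [show T - (k + 1) = T - (k + 1 + 1) + 1 by omega, rise, DartGraph.revPath_cons]
      rfl
    rw [← List.append_assoc, e]
    exact h1

variable (𝒜) in
/-- Short loops in a horoball can be filled uniformly: pushed up far enough, such a loop runs
through vertices that are pairwise joined by horizontal edges. -/
theorem homot_nil_of_horo {L : ℕ} {k₀ : ℕ} {p : List 𝒜.Dart}
    (hp : 𝒜.cuspedSpace.IsWalk (Vertex.at i g (k₀ + 1)) p (Vertex.at i g (k₀ + 1)))
    (hL : p.length ≤ L) (hbase : ∀ d ∈ p, ∀ g', Dart.src 𝒜 (Dart.inv 𝒜 d) ≠ Vertex.base g') :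
    Homot (X := 𝒜.cuspedSpace) (𝒜.cuspedSpace.cball (4 * L) (Vertex.at i g (k₀ + 1)))
      (Vertex.at i g (k₀ + 1)) p [] (Vertex.at i g (k₀ + 1)) := by
  have hconn := connected 𝒜
  set v : Vertex G n := Vertex.at i g (k₀ + 1) with hv
  set T := k₀ + 2 * L with hT
  have hpow : L * 2 ^ (k₀ + 1 + L) ≤ 2 ^ (T + 1) := by
    calc L * 2 ^ (k₀ + 1 + L) ≤ 2 ^ L * 2 ^ (k₀ + 1 + L) :=
          Nat.mul_le_mul_right _ Nat.lt_two_pow_self.le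
      _ = 2 ^ (T + 1) := by rw [← pow_add]; congr 1; omega
  -- vertices at distance at most `s` from `v` are `3 * L` levels below the level `T + 1` at most
  have hmem : ∀ {h : G} {k s : ℕ}, 𝒜.cuspedSpace.dist v (Vertex.at i h k) ≤ s → s ≤ L →
      k₀ + 1 ≤ k + s → ∀ t ≤ T + 1 - k, Vertex.at i h (k + t) ∈ tower 𝒜 v i L (3 * L) :=
    fun {h k s} h1 h2 h3 t ht => ⟨h, k, t, rfl, by omega, h1.trans h2⟩
  have hrise : ∀ {h : G} {k s : ℕ}, 𝒜.cuspedSpace.dist v (Vertex.at i h k) ≤ s → s ≤ L →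
      k₀ + 1 ≤ k + s → k ≤ T + 1 → 𝒜.cuspedSpace.IsWalkIn (tower 𝒜 v i L (3 * L))
        (Vertex.at i h k) (rise 𝒜 i h k (T + 1 - k)) (Vertex.at i h (T + 1)) := by
    intro h k s h1 h2 h3 h4
    have := isWalkIn_rise (hmem h1 h2 h3)
    rwa [Nat.add_sub_cancel' h4] at this
  have key : ∀ (p : List 𝒜.Dart) (g : G) (k s : ℕ) (y : Vertex G n),
      𝒜.cuspedSpace.IsWalk (Vertex.at i g (k + 1)) p y → s + p.length ≤ L →
      𝒜.cuspedSpace.dist v (Vertex.at i g (k + 1)) ≤ s → k₀ ≤ k + s → k ≤ k₀ + s →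
      (∀ d ∈ p, ∀ g', Dart.src 𝒜 (Dart.inv 𝒜 d) ≠ Vertex.base g') →
      ∃ h l q, y = Vertex.at i h (l + 1) ∧ 𝒜.Within i (p.length * 2 ^ (k₀ + 1 + L)) g h ∧
        IsShortcut 𝒜 i (T + 1) g h q ∧
        Homot (X := 𝒜.cuspedSpace) (tower 𝒜 v i L (3 * L)) (Vertex.at i g (T + 1))
          (𝒜.graph.revPath (rise 𝒜 i g (k + 1) (T + 1 - (k + 1))) ++
            (p ++ 𝒜.graph.revPath (𝒜.graph.revPath (rise 𝒜 i h (l + 1) (T + 1 - (l + 1)))))) q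
          (Vertex.at i h (T + 1)) := by
    intro p
    induction p with
    | nil =>
      intro g k s y hp hL hs h1 h2 _
      obtain rfl := hp
      simp only [List.length_nil] at hL
      refine ⟨g, k, [], rfl, Within.refl _ _ _, Or.inl ⟨rfl, rfl⟩, ?_⟩
      rw [𝒜.graph.revPath_revPath]
      exact Homot.rev_append (hrise hs (by omega) (by omega) (by omega))
    | cons d p ih =>
      intro g k s y hp hL hs h1 h2 hb
      obtain ⟨hd, hp⟩ := hp
      rw [List.length_cons] at hL
      have hdist : 𝒜.cuspedSpace.dist v (Dart.src 𝒜 (Dart.inv 𝒜 d)) ≤ s + 1 := by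
        refine (DartGraph.dist_triangle hconn _ (Vertex.at i g (k + 1)) _).trans (add_le_add hs ?_)
        rw [← hd]
        exact DartGraph.dist_src_tgt (Γ := 𝒜.graph) d
      obtain ⟨h, l, q₁, hl, hl1, hl2, hw, hq₁, H₁⟩ := exists_shortcut_dart (T := T + 1)
        (U := tower 𝒜 v i L (3 * L)) hd (hb d (by simp)) (by omega)
        (fun h l hl => by
          rw [hl] at hdist
          refine hmem hdist (by omega) ?_
          have := depth_tgt_le (Dart.inv 𝒜 d)
          rw [hl, show Dart.inv 𝒜 (Dart.inv 𝒜 d) = d from 𝒜.graph.inv_inv d,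
            show Dart.src 𝒜 d = _ from hd, Vertex.depth_at, Vertex.depth_at] at this
          omega)
        (hmem hs (by omega) (by omega))
      rw [hl] at hdist
      obtain ⟨h', l', q₂, rfl, hw', hq₂, H₂⟩ := ih h l (s + 1) y (by rw [← hl]; exact hp) (by omega)
        hdist (by omega) (by omega) fun d hd => hb d (by simp [hd])
      have hww : 𝒜.Within i ((p.length + 1) * 2 ^ (k₀ + 1 + L)) g h' := by
        rw [add_comm p.length, add_mul, one_mul]
        exact (hw.mono (Nat.pow_le_pow_right two_pos (by omega))).trans hw'
      obtain ⟨q, hq, H⟩ := hq₁.append (T := T) (U := tower 𝒜 v i L (3 * L)) hq₂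
        (hww.mono ((Nat.mul_le_mul_right _ (by omega)).trans hpow))
        H₁.left.left_mem H₂.left.left_mem H₂.left.right_mem
      exact ⟨h', l', q, rfl, hww, hq, (Homot.conj_append H₁ H₂).trans H⟩
  have hd0 : 𝒜.cuspedSpace.dist v (Vertex.at i g (k₀ + 1)) ≤ 0 :=
    (DartGraph.dist_self (Γ := 𝒜.graph) v).le
  obtain ⟨h, l, q, hhl, -, hq, H⟩ := key p g k₀ 0 v hp (by omega) hd0 (by omega) (by omega) hbase
  obtain ⟨rfl, rfl⟩ : g = h ∧ k₀ = l := by simpa [hv] using hhl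
  obtain ⟨-, rfl⟩ : g = g ∧ q = [] := by
    rcases hq with hq | hq
    · exact hq
    · exact absurd rfl hq.1
  have hr := hrise hd0 (Nat.zero_le _) (by omega) (by omega)
  have H' := Homot.conj_symm hr.rev hr.rev H
  refine Homot.mono ((tower_subset v i L (3 * L)).trans (DartGraph.cball_mono (by omega) _)) ?_
  exact H'.symm.trans (Homot.rev_append hr.rev)

variable (𝒜) in
/-- Short loops can be filled uniformly: a loop either meets the Cayley graph or stays in one
horoball. -/
theorem exists_homot_nil (L : ℕ) : ∃ A, ∀ (v : 𝒜.cuspedSpace.V) (p : List 𝒜.cuspedSpace.D),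
    𝒜.cuspedSpace.IsWalk v p v → p.length ≤ L →
    Homot (X := 𝒜.cuspedSpace) (𝒜.cuspedSpace.cball A v) v p [] v := by
  obtain ⟨A, hA⟩ := exists_homot_nil_of_base 𝒜 L
  have hconn := connected 𝒜
  refine ⟨4 * L + A, fun v p hp hL => ?_⟩
  by_cases hb : ∃ d ∈ p, ∃ g, 𝒜.cuspedSpace.tgt d = Vertex.base g
  · obtain ⟨d, hd, g, hg⟩ := hb
    obtain ⟨p₁, p₂, rfl⟩ := List.append_of_mem hd
    have hp' := DartGraph.isWalkIn_univ.2 hp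
    rw [← List.singleton_append, ← List.append_assoc] at hp' hL ⊢
    obtain ⟨y, h1, h2⟩ := hp'.of_append
    obtain ⟨z, h3, h4⟩ := h1.of_append
    have hy : Vertex.base g = y := hg.symm.trans h4.2.2.2
    subst hy
    rw [List.length_append] at hL
    have H := hA g (p₂ ++ (p₁ ++ [d])) (DartGraph.isWalk_append h2.isWalk h1.isWalk)
      ((List.length_append).trans_le ((add_comm _ _).trans_le hL))
    have hU := h1.isWalk.dist_le
    have hsub := DartGraph.cball_subset (n := 4 * L + A) (m := A) hconn hU (by omega)
    have hw := h1.isWalk.isWalkIn_cball hconn (n := 4 * L + A) (DartGraph.dist_self _).le (by omega)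
    have H2 := (H.mono hsub).loop_left hw
    exact H2
  · push Not at hb
    cases v with
    | base g =>
      rcases List.eq_nil_or_concat' p with rfl | ⟨p', d, rfl⟩
      · exact Homot.refl ⟨(DartGraph.dist_self _).trans_le (Nat.zero_le _), rfl⟩
      · obtain ⟨y, h1, h2⟩ := (DartGraph.isWalkIn_univ.2 hp).of_append
        exact absurd h2.2.2.2 (hb d (by simp) g)
    | horo i g k =>
      exact (homot_nil_of_horo 𝒜 hp hL hb).mono (DartGraph.cball_mono (by omega) _)

variable (𝒜) in
/-- Every radius has a filling radius. -/
theorem exists_isFillingRadius (R : ℕ) : ∃ A, 𝒜.cuspedSpace.IsFillingRadius R A := by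
  obtain ⟨A, hA⟩ := exists_homot_nil 𝒜 (2 * R + 1)
  exact ⟨A, isFillingRadius_of_short_loops (connected 𝒜) hA⟩

end PeripheralPresentation

namespace TwoComplex

variable {X : TwoComplex.{u}}

/-! ### Continuous functions on the realization -/

/-- Polar coordinates on the disc. -/
noncomputable def polar (z : I × I) : Disc :=
  ⟨(z.1 : ℝ) * (circlePt z.2 : ℂ), by
    rw [mem_closedBall_zero_iff, norm_mul, Complex.norm_real, Real.norm_of_nonneg z.1.2.1]
    exact mul_le_one₀ z.1.2.2 (norm_nonneg _) (mem_closedBall_zero_iff.1 (circlePt z.2).2)⟩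

theorem norm_circlePt (θ : ℝ) : ‖(circlePt θ : ℂ)‖ = 1 := by
  have h := Complex.norm_exp_ofReal_mul_I (2 * Real.pi * θ)
  push_cast at h
  exact h

theorem norm_polar (z : I × I) : ‖(polar z : ℂ)‖ = z.1 := by
  change ‖((z.1 : ℝ) : ℂ) * (circlePt z.2 : ℂ)‖ = _
  rw [norm_mul, norm_circlePt, mul_one, Complex.norm_real, Real.norm_of_nonneg z.1.2.1]

theorem polar_one (θ : I) : polar (1, θ) = circlePt θ := by
  ext
  simp [polar]

theorem continuous_polar : Continuous polar := by
  have := continuous_circlePt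
  unfold polar
  fun_prop

theorem exists_circlePt_mul (z : ℂ) : ∃ θ : I, (‖z‖ : ℂ) * circlePt θ = z := by
  refine ⟨⟨Int.fract (z.arg / (2 * Real.pi)), Int.fract_nonneg _, (Int.fract_lt_one _).le⟩, ?_⟩
  have h : (2 * Real.pi * (Int.fract (z.arg / (2 * Real.pi)) : ℝ) * Complex.I : ℂ) =
      z.arg * Complex.I - (⌊z.arg / (2 * Real.pi)⌋ : ℤ) * (2 * Real.pi * Complex.I) := by
    have hpi : (Real.pi : ℂ) ≠ 0 := by exact_mod_cast Real.pi_ne_zero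
    rw [Int.fract]
    push_cast
    field_simp
  change (‖z‖ : ℂ) * Complex.exp (2 * Real.pi * (Int.fract (z.arg / (2 * Real.pi)) : ℝ) *
    Complex.I) = z
  rw [h, Complex.exp_periodic.sub_int_mul_eq, Complex.norm_mul_exp_arg_mul_I]

theorem polar_surjective : Function.Surjective polar := by
  intro z
  obtain ⟨θ, hθ⟩ := exists_circlePt_mul z
  exact ⟨(⟨‖(z : ℂ)‖, norm_nonneg _, mem_closedBall_zero_iff.1 z.2⟩, θ), Subtype.ext hθ⟩

theorem isQuotientMap_polar : IsQuotientMap polar :=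
  continuous_polar.isClosedMap.isQuotientMap continuous_polar polar_surjective

theorem polar_eq_iff {z w : I × I} (h : polar z = polar w) :
    z.1 = w.1 ∧ ((z.1 : ℝ) = 0 ∨ z.2 = w.2 ∨ (z.2 = 0 ∧ w.2 = 1) ∨ (z.2 = 1 ∧ w.2 = 0)) := by
  have h1 : z.1 = w.1 := by
    ext
    rw [← norm_polar, ← norm_polar, h]
  refine ⟨h1, or_iff_not_imp_left.2 fun h0 => ?_⟩
  have h2 : Complex.exp (2 * Real.pi * (z.2 : ℝ) * Complex.I) =
      Complex.exp (2 * Real.pi * (w.2 : ℝ) * Complex.I) := by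
    have := congrArg Subtype.val h
    simp only [polar, ← h1] at this
    exact mul_left_cancel₀ (by exact_mod_cast h0) this
  obtain ⟨m, hm⟩ := Complex.exp_eq_exp_iff_exists_int.1 h2
  have hpi : (2 * Real.pi * Complex.I : ℂ) ≠ 0 := Complex.two_pi_I_ne_zero
  have h3 : ((z.2 : ℝ) : ℂ) = (w.2 : ℝ) + m := by
    apply mul_left_cancel₀ hpi
    linear_combination hm
  have h4 : (z.2 : ℝ) = w.2 + m := by exact_mod_cast h3
  have hz := z.2.2
  have hw := w.2.2
  have hm1 : (-1 : ℤ) ≤ m := by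
    have : (-1 : ℝ) ≤ m := by linarith [hz.1, hw.2]
    exact_mod_cast this
  have hm2 : m ≤ 1 := by
    have : (m : ℝ) ≤ 1 := by linarith [hz.2, hw.1]
    exact_mod_cast this
  obtain rfl | rfl | rfl : m = -1 ∨ m = 0 ∨ m = 1 := by omega
  · right; left
    push_cast at h4
    exact ⟨Subtype.ext (by rw [Icc.coe_zero]; linarith [hz.1, hw.2]),
      Subtype.ext (by rw [Icc.coe_one]; linarith [hz.1, hw.2])⟩
  · left
    ext
    simpa using h4
  · right; right
    push_cast at h4
    exact ⟨Subtype.ext (by rw [Icc.coe_one]; linarith [hz.2, hw.1]),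
      Subtype.ext (by rw [Icc.coe_zero]; linarith [hz.2, hw.1])⟩

/-- The 1-skeleton, as a 2-complex without 2-cells. -/
def skel (X : TwoComplex.{u}) : TwoComplex.{u} where
  toDartGraph := X.toDartGraph
  C := PEmpty
  base := PEmpty.elim
  bdry := PEmpty.elim
  closed c := c.elim

/-- The value of the extension to a 2-cell of a function on the 1-skeleton, in polar coordinates:
the extension is linear on the radii, and takes at the centre the value at the base vertex. -/
noncomputable def coneAux (ψ : C(X.skel.Space, ℝ)) (c : X.C) : C(I × I, ℝ) where
  toFun z := z.1 * ψ (X.skel.walkPt (X.base c) (X.bdry c) (z.2 * (X.bdry c).length)) +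
    (1 - z.1) * ψ (X.skel.vertexPt (X.base c))
  continuous_toFun := by
    have h : Continuous (X.skel.walkPt (X.base c) (X.bdry c)) :=
      continuous_walkPt (X := X.skel) (X.closed c)
    fun_prop

theorem coneAux_eq (ψ : C(X.skel.Space, ℝ)) (c : X.C) {z w : I × I} (h : polar z = polar w) :
    coneAux ψ c z = coneAux ψ c w := by
  obtain ⟨r, θ⟩ := z
  obtain ⟨r', θ'⟩ := w
  have hc : X.skel.IsWalk (X.base c) (X.bdry c) (X.base c) := X.closed c
  have e0 : X.skel.walkPt (X.base c) (X.bdry c) (((0 : I) : ℝ) * (X.bdry c).length) =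
      X.skel.vertexPt (X.base c) := walkPt_of_nonpos hc (by simp)
  have e1 : X.skel.walkPt (X.base c) (X.bdry c) (((1 : I) : ℝ) * (X.bdry c).length) =
      X.skel.vertexPt (X.base c) := walkPt_of_ge hc (by rw [Icc.coe_one, one_mul]; exact le_rfl)
  obtain ⟨rfl, h0 | h0 | ⟨h0, h1⟩ | ⟨h0, h1⟩⟩ := polar_eq_iff h
  · simp only [coneAux, ContinuousMap.coe_mk]
    rw [h0]
    simp
  all_goals
    simp only at h0
  · rw [h0]
  all_goals
    simp only at h1
    subst h0 h1
    simp only [coneAux, ContinuousMap.coe_mk, e0, e1]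

/-- The radial extension to a 2-cell of a function on the 1-skeleton. -/
noncomputable def coneMap (ψ : C(X.skel.Space, ℝ)) (c : X.C) : C(Disc, ℝ) :=
  isQuotientMap_polar.lift (f := ⟨polar, continuous_polar⟩) (coneAux ψ c)
    fun _ _ h => coneAux_eq ψ c h

theorem coneMap_polar (ψ : C(X.skel.Space, ℝ)) (c : X.C) (z : I × I) :
    coneMap ψ c (polar z) = coneAux ψ c z :=
  DFunLike.congr_fun (IsQuotientMap.lift_comp (f := ⟨polar, continuous_polar⟩) isQuotientMap_polar
    (coneAux ψ c) fun _ _ h => coneAux_eq ψ c h) z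

/-- The extension to the 2-cells of a function on the 1-skeleton. -/
noncomputable def skelExtend (ψ : C(X.skel.Space, ℝ)) : C(X.Space, ℝ) where
  toFun := Quot.lift
    (Sum.elim (fun v => ψ (X.skel.vertexPt v.1))
      (Sum.elim (fun d => ψ (X.skel.edgePt d.1 d.2)) (fun c => coneMap ψ c.1 c.2))) <| by
    intro a b h
    cases h with
    | start d => exact congrArg ψ (edgePt_zero (X := X.skel) d)
    | flip d t =>
      refine congrArg ψ ?_
      have := edgePt_inv (X := X.skel) d (σ t)
      rw [unitInterval.symm_symm] at this
      exact this.symm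
    | attach c j t =>
      have hn : (0 : ℝ) < (X.bdry c).length := by exact_mod_cast j.pos
      have hmem : ((j : ℕ) + (t : ℝ)) / (X.bdry c).length ∈ I := by
        refine unitInterval.div_mem (add_nonneg (Nat.cast_nonneg _) t.2.1) hn.le ?_
        have : ((j : ℕ) : ℝ) + 1 ≤ (X.bdry c).length := by exact_mod_cast j.2
        linarith [t.2.2]
      have h1 := coneMap_polar ψ c (1, ⟨_, hmem⟩)
      rw [polar_one] at h1
      refine h1.trans ?_
      simp only [coneAux, ContinuousMap.coe_mk]
      rw [div_mul_cancel₀ _ hn.ne', Icc.coe_one, sub_self, zero_mul, add_zero, one_mul]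
      exact congrArg ψ (walkPt_getElem (X := X.skel) (X.closed c) j.2 t)
    | attachNil c h θ =>
      obtain ⟨z, hz⟩ := polar_surjective (circlePt θ)
      change coneMap ψ c (circlePt θ) = ψ (X.skel.vertexPt (X.base c))
      rw [← hz, coneMap_polar]
      have e : ∀ t, X.skel.walkPt (X.base c) (X.bdry c) t = X.skel.vertexPt (X.base c) := by
        rw [h]
        exact fun _ => rfl
      simp only [coneAux, ContinuousMap.coe_mk, e]
      ring
  continuous_toFun := by
    refine continuous_quot_lift _ (Continuous.sumElim ?_ (Continuous.sumElim ?_ ?_))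
    · exact continuous_sigma fun v => continuous_of_const fun _ _ => rfl
    · exact continuous_sigma fun d => ψ.continuous.comp (continuous_edgePt (X := X.skel) d)
    · exact continuous_sigma fun c => (coneMap ψ c).continuous

theorem skelExtend_vertexPt (ψ : C(X.skel.Space, ℝ)) (x : X.V) :
    skelExtend ψ (X.vertexPt x) = ψ (X.skel.vertexPt x) := rfl

theorem skelExtend_edgePt (ψ : C(X.skel.Space, ℝ)) (d : X.D) (t : I) :
    skelExtend ψ (X.edgePt d t) = ψ (X.skel.edgePt d t) := rfl

theorem skelExtend_cellPt (ψ : C(X.skel.Space, ℝ)) (c : X.C) (z : I × I) :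
    skelExtend ψ (X.cellPt c (polar z)) = coneAux ψ c z := coneMap_polar ψ c z

/-- The continuous function on the 1-skeleton with given values on the vertices and on the
edges. -/
noncomputable def skelMap (a : X.V → ℝ) (b : X.D → C(I, ℝ)) (h0 : ∀ d, b d 0 = a (X.src d))
    (h1 : ∀ d t, b (X.inv d) (σ t) = b d t) : C(X.skel.Space, ℝ) where
  toFun := Quot.lift
    (Sum.elim (fun v => a v.1) (Sum.elim (fun d => b d.1 d.2) (fun c => PEmpty.elim c.1))) <| by
    intro x y h
    cases h with
    | start d => exact h0 d
    | flip d t => exact (h1 d t).symm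
    | attach c => exact PEmpty.elim c
    | attachNil c => exact PEmpty.elim c
  continuous_toFun := by
    refine continuous_quot_lift _ (Continuous.sumElim ?_ (Continuous.sumElim ?_ ?_))
    · exact continuous_sigma fun v => continuous_of_const fun _ _ => rfl
    · exact continuous_sigma fun d => (b d).continuous
    · exact continuous_sigma fun c => PEmpty.elim c

/-- The function on the 1-skeleton that is linear on the edges, with given values on the
vertices. -/
noncomputable def linearMap (a : X.V → ℝ) : C(X.skel.Space, ℝ) :=
  skelMap a (fun d => ⟨fun t => (1 - t) * a (X.src d) + t * a (X.tgt d), by fun_prop⟩)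
    (fun d => by simp) fun d t => by
      simp only [ContinuousMap.coe_mk, coe_symm_eq, DartGraph.src_inv, DartGraph.tgt_inv]
      ring

theorem linearMap_edgePt (a : X.V → ℝ) (d : X.D) (t : I) :
    linearMap a (X.skel.edgePt d t) = (1 - t) * a (X.src d) + t * a (X.tgt d) := rfl

/-- On a full subcomplex, the extension of a function that is linear on the edges takes its values
in every interval that contains the values on the vertices. -/
theorem skelExtend_linearMap_mem {a : X.V → ℝ} {U : Set X.V} {l r : ℝ}
    (hU : ∀ x ∈ U, a x ∈ Icc l r) {y : X.Space} (hy : y ∈ X.sub U) :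
    skelExtend (linearMap a) y ∈ Icc l r := by
  have hconv : ∀ {p q : ℝ} (t : I), p ∈ Icc l r → q ∈ Icc l r →
      (1 - (t : ℝ)) * p + t * q ∈ Icc l r := fun {p q} t hp hq =>
    (convex_Icc l r) hp hq (sub_nonneg.2 t.2.2) t.2.1 (by ring)
  have hskel : ∀ {y : X.skel.Space}, y ∈ X.skel.sub U → linearMap a y ∈ Icc l r := by
    rintro y (⟨x, hx, rfl⟩ | ⟨d, t, h1, h2, rfl⟩ | ⟨c, -⟩)
    · exact hU x hx
    · exact hconv (p := a (X.src d)) (q := a (X.tgt d)) t (hU _ h1) (hU _ h2)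
    · exact PEmpty.elim c
  rcases hy with ⟨x, hx, rfl⟩ | ⟨d, t, h1, h2, rfl⟩ | ⟨c, z, h1, h2, rfl⟩
  · exact hU x hx
  · rw [skelExtend_edgePt, linearMap_edgePt]
    exact hconv t (hU _ h1) (hU _ h2)
  · obtain ⟨z, rfl⟩ := polar_surjective z
    rw [skelExtend_cellPt]
    have h := hskel (walkPt_mem_sub (X := X.skel) ((X.closed c).isWalkIn h1 h2)
      (z.2 * (X.bdry c).length))
    have := hconv z.1 (hU _ h1) h
    rw [add_comm] at this
    exact this

open Classical in
/-- The function on the 1-skeleton that is supported on one edge. -/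
noncomputable def edgeBump (d : X.D) (k : C(I, ℝ)) (h0 : k 0 = 0) (h1 : k 1 = 0) :
    C(X.skel.Space, ℝ) :=
  skelMap (fun _ => 0)
    (fun e => if e = d then k else if e = X.inv d then ⟨fun t => k (σ t), by fun_prop⟩ else 0)
    (fun e => by split_ifs <;> simp [h0, h1]) fun e t => by
      have hd := X.inv_ne d
      by_cases he : e = d
      · subst he
        simp [hd]
      · by_cases he' : e = X.inv d
        · subst he'
          simp [hd, X.inv_inv]
        · have h2 : X.inv e ≠ d := fun h => he' (by rw [← h, X.inv_inv])
          have h3 : X.inv e ≠ X.inv d := fun h => he (by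
            rw [← X.inv_inv e, h, X.inv_inv])
          simp [he, he', h2, h3]

theorem edgeBump_edgePt (d : X.D) (k : C(I, ℝ)) (h0 : k 0 = 0) (h1 : k 1 = 0) (t : I) :
    edgeBump d k h0 h1 (X.skel.edgePt d t) = k t := by
  classical
  change (if d = d then k else _) t = k t
  rw [if_pos rfl]

theorem edgeBump_edgePt_of_ne (d e : X.D) (k : C(I, ℝ)) (h0 : k 0 = 0) (h1 : k 1 = 0) (t : I)
    (hd : e ≠ d) (hd' : e ≠ X.inv d) : edgeBump d k h0 h1 (X.skel.edgePt e t) = 0 := by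
  classical
  change (if e = d then k else if e = X.inv d then _ else 0) t = 0
  rw [if_neg hd, if_neg hd']
  rfl

theorem edgeBump_vertexPt (d : X.D) (k : C(I, ℝ)) (h0 : k 0 = 0) (h1 : k 1 = 0) (x : X.V) :
    edgeBump d k h0 h1 (X.skel.vertexPt x) = 0 := rfl

open Classical in
/-- The function supported on one 2-cell. -/
noncomputable def cellBump (c : X.C) (k : C(Disc, ℝ)) (hk : ∀ θ, k (circlePt θ) = 0) :
    C(X.Space, ℝ) where
  toFun := Quot.lift
    (Sum.elim (fun _ => 0) (Sum.elim (fun _ => 0) (fun z => (if z.1 = c then k else 0) z.2))) <| by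
    intro a b h
    cases h with
    | start d => rfl
    | flip d t => rfl
    | attach c' j t =>
      simp only [Sum.elim_inr, Sum.elim_inl]
      split_ifs
      · exact hk _
      · rfl
    | attachNil c' h θ =>
      simp only [Sum.elim_inr, Sum.elim_inl]
      split_ifs
      · exact hk _
      · rfl
  continuous_toFun := by
    refine continuous_quot_lift _ (Continuous.sumElim continuous_const
      (Continuous.sumElim continuous_const ?_))
    exact continuous_sigma fun c' => (if c' = c then k else 0 : C(Disc, ℝ)).continuous

theorem cellBump_cellPt (c : X.C) (k : C(Disc, ℝ)) (hk : ∀ θ, k (circlePt θ) = 0) (z : Disc) :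
    cellBump c k hk (X.cellPt c z) = k z := by
  classical
  change (if c = c then k else 0) z = k z
  rw [if_pos rfl]

theorem cellBump_cellPt_of_ne {c c' : X.C} (k : C(Disc, ℝ)) (hk : ∀ θ, k (circlePt θ) = 0)
    (z : Disc) (h : c' ≠ c) : cellBump c k hk (X.cellPt c' z) = 0 := by
  classical
  change (if c' = c then k else 0) z = 0
  rw [if_neg h]
  rfl

/-! ### The realization is a Hausdorff space -/

theorem exists_of_walkPt (x : X.V) (p : List X.D) (t : ℝ) :
    (∃ y, X.walkPt x p t = X.vertexPt y) ∨ ∃ d s, X.walkPt x p t = X.edgePt d s := by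
  induction p generalizing x t with
  | nil => exact Or.inl ⟨x, rfl⟩
  | cons d p ih =>
    rw [walkPt_cons]
    split_ifs
    · exact Or.inr ⟨d, _, rfl⟩
    · exact ih _ _

/-- Every point is a vertex, or an interior point of an edge or of a 2-cell. -/
theorem exists_rep (y : X.Space) : (∃ x, y = X.vertexPt x) ∨
    (∃ (d : X.D) (t : I), 0 < (t : ℝ) ∧ (t : ℝ) < 1 ∧ y = X.edgePt d t) ∨
    ∃ (c : X.C) (z : Disc), ‖(z : ℂ)‖ < 1 ∧ y = X.cellPt c z := by
  have hedge : ∀ (d : X.D) (t : I), (∃ x, X.edgePt d t = X.vertexPt x) ∨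
      ∃ (d' : X.D) (t' : I), 0 < (t' : ℝ) ∧ (t' : ℝ) < 1 ∧ X.edgePt d t = X.edgePt d' t' := by
    intro d t
    rcases t.2.1.eq_or_lt with h0 | h0
    · obtain rfl : t = 0 := Subtype.ext h0.symm
      exact Or.inl ⟨_, edgePt_zero d⟩
    rcases t.2.2.eq_or_lt with h1 | h1
    · obtain rfl : t = 1 := Subtype.ext h1
      exact Or.inl ⟨_, edgePt_one d⟩
    exact Or.inr ⟨d, t, h0, h1, rfl⟩
  obtain ⟨⟨x, -⟩ | ⟨d, t⟩ | ⟨c, z⟩, rfl⟩ := Quot.exists_rep y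
  · exact Or.inl ⟨x, rfl⟩
  · rcases hedge d t with h | h
    exacts [Or.inl h, Or.inr (Or.inl h)]
  · rcases (mem_closedBall_zero_iff.1 z.2).lt_or_eq with h | h
    · exact Or.inr (Or.inr ⟨c, z, h, rfl⟩)
    · obtain ⟨θ, hθ⟩ := exists_circlePt_mul z
      rw [h, Complex.ofReal_one, one_mul] at hθ
      have hz : circlePt θ = z := Subtype.ext hθ
      have hw := walkPt_bdry c θ
      rw [hz] at hw
      change (∃ x, X.cellPt c z = _) ∨ (∃ d t, _ ∧ _ ∧ X.cellPt c z = _) ∨ _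
      rw [← hw]
      rcases exists_of_walkPt (X.base c) (X.bdry c) (θ * (X.bdry c).length) with ⟨y, hy⟩ | ⟨d, s, hs⟩
      · exact Or.inl ⟨y, hy⟩
      · rw [hs]
        rcases hedge d s with h | h
        exacts [Or.inl h, Or.inr (Or.inl h)]

/-- The open 2-cell at `c` is separated from the other points by bump functions: `1 - |z|` detects the
cell, and its products with the coordinates detect `z`. -/
theorem cellPt_separated {c : X.C} {z : Disc} (hz : ‖(z : ℂ)‖ < 1) {y : X.Space}
    (h : ∀ f : C(X.Space, ℝ), f (X.cellPt c z) = f y) : X.cellPt c z = y := by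
  have h1 := h (cellBump c ⟨fun z => 1 - ‖(z : ℂ)‖, by fun_prop⟩ fun θ => by
    simp [norm_circlePt])
  have h2 := h (cellBump c ⟨fun z => (1 - ‖(z : ℂ)‖) * (z : ℂ).re, by fun_prop⟩ fun θ => by
    simp [norm_circlePt])
  have h3 := h (cellBump c ⟨fun z => (1 - ‖(z : ℂ)‖) * (z : ℂ).im, by fun_prop⟩ fun θ => by
    simp [norm_circlePt])
  rw [cellBump_cellPt] at h1 h2 h3
  simp only [ContinuousMap.coe_mk] at h1 h2 h3
  have hz' : (0 : ℝ) < 1 - ‖(z : ℂ)‖ := by linarith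
  obtain ⟨x, rfl⟩ | ⟨d, t, -, -, rfl⟩ | ⟨c', z', -, rfl⟩ := exists_rep y
  · exact absurd h1 hz'.ne'
  · exact absurd h1 hz'.ne'
  · by_cases hc : c' = c
    · subst hc
      rw [cellBump_cellPt] at h1 h2 h3
      simp only [ContinuousMap.coe_mk] at h1 h2 h3
      rw [← h1] at h2 h3
      congr 1
      exact Subtype.ext (Complex.ext (mul_left_cancel₀ hz'.ne' h2) (mul_left_cancel₀ hz'.ne' h3))
    · rw [cellBump_cellPt_of_ne _ _ _ hc] at h1
      exact absurd h1 hz'.ne'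

/-- The same for interior points of edges, with the bump functions `t (1 - t)` and `t² (1 - t)` on the
edge, extended radially to the 2-cells. -/
theorem edgePt_separated {d : X.D} {t : I} (h0 : 0 < (t : ℝ)) (h1 : (t : ℝ) < 1) {y : X.Space}
    (h : ∀ f : C(X.Space, ℝ), f (X.edgePt d t) = f y) : X.edgePt d t = y := by
  have hpos : 0 < (t : ℝ) * (1 - t) := mul_pos h0 (by linarith)
  have h2 := h (skelExtend (edgeBump d ⟨fun t => (t : ℝ) * (1 - t), by fun_prop⟩ (by simp)
    (by simp)))
  have h3 := h (skelExtend (edgeBump d ⟨fun t => (t : ℝ) * (t * (1 - t)), by fun_prop⟩ (by simp)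
    (by simp)))
  rw [skelExtend_edgePt, edgeBump_edgePt] at h2 h3
  simp only [ContinuousMap.coe_mk] at h2 h3
  obtain ⟨x, rfl⟩ | ⟨e, s, hs0, hs1, rfl⟩ | ⟨c, z, hz, rfl⟩ := exists_rep y
  · rw [skelExtend_vertexPt, edgeBump_vertexPt] at h2
    exact absurd h2 hpos.ne'
  · have main : ∀ s : I, (∀ f : C(X.Space, ℝ), f (X.edgePt d t) = f (X.edgePt d s)) →
        X.edgePt d t = X.edgePt d s := by
      intro s h
      have h2 := h (skelExtend (edgeBump d ⟨fun t => (t : ℝ) * (1 - t), by fun_prop⟩ (by simp)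
        (by simp)))
      have h3 := h (skelExtend (edgeBump d ⟨fun t => (t : ℝ) * (t * (1 - t)), by fun_prop⟩
        (by simp) (by simp)))
      rw [skelExtend_edgePt, edgeBump_edgePt, skelExtend_edgePt, edgeBump_edgePt] at h2 h3
      simp only [ContinuousMap.coe_mk] at h2 h3
      rw [← h2] at h3
      congr 1
      exact Subtype.ext (mul_right_cancel₀ hpos.ne' h3)
    by_cases he : e = d
    · subst he
      exact main s h
    · by_cases he' : e = X.inv d
      · subst he'
        rw [edgePt_inv] at h ⊢
        exact main _ h
      · rw [skelExtend_edgePt, edgeBump_edgePt_of_ne _ _ _ _ _ _ he he'] at h2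
        exact absurd h2 hpos.ne'
  · exact (cellPt_separated hz fun f => (h f).symm).symm

theorem eq_of_forall_continuousMap_eq {x y : X.Space} (h : ∀ f : C(X.Space, ℝ), f x = f y) :
    x = y := by
  classical
  obtain ⟨x, rfl⟩ | ⟨d, t, h0, h1, rfl⟩ | ⟨c, z, hz, rfl⟩ := exists_rep x
  · obtain ⟨y, rfl⟩ | ⟨d, t, h0, h1, rfl⟩ | ⟨c, z, hz, rfl⟩ := exists_rep y
    · by_contra hne
      have h1 := h (skelExtend (linearMap fun z => if z = x then 1 else 0))
      rw [skelExtend_vertexPt, skelExtend_vertexPt] at h1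
      change (if x = x then (1 : ℝ) else 0) = if y = x then 1 else 0 at h1
      rw [if_pos rfl, if_neg fun h => hne (by rw [h])] at h1
      exact one_ne_zero h1
    · exact (edgePt_separated h0 h1 fun f => (h f).symm).symm
    · exact (cellPt_separated hz fun f => (h f).symm).symm
  · exact edgePt_separated h0 h1 h
  · exact cellPt_separated hz h

instance : T2Space X.Space where
  t2 x y hxy := by
    obtain ⟨f, hf⟩ : ∃ f : C(X.Space, ℝ), f x ≠ f y := by
      by_contra! h
      exact hxy (eq_of_forall_continuousMap_eq h)
    exact separated_by_continuous f.continuous hf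

/-! ### The distance function -/

/-- The extension to the realization of the distance from the vertex `v`. -/
noncomputable def distFun (v : X.V) : C(X.Space, ℝ) :=
  skelExtend (linearMap fun x => (X.dist v x : ℝ))

theorem dist_le_of_vertexPt_mem_star {n : ℕ} {v x : X.V} (h : X.vertexPt x ∈ X.star n v) :
    X.dist v x ≤ n := by
  rw [star_eq_sub] at h
  have := (skelExtend_linearMap_mem (a := fun x => (X.dist v x : ℝ)) (l := 0) (r := n)
    (fun x hx => ⟨Nat.cast_nonneg _, by exact_mod_cast hx⟩) h).2
  change (X.dist v x : ℝ) ≤ n at this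
  exact_mod_cast this

theorem le_distFun_of_mem_star (hc : X.toSimple.Connected) {n : ℕ} {v w : X.V} {y : X.Space}
    (h : y ∈ X.star n w) : (X.dist v w : ℝ) - n ≤ distFun v y := by
  rw [star_eq_sub] at h
  refine (skelExtend_linearMap_mem (a := fun x => (X.dist v x : ℝ)) (l := (X.dist v w : ℝ) - n)
    (r := (X.dist v w : ℝ) + n) (fun x hx => ?_) h).1
  have hx' : X.dist w x ≤ n := hx
  have h1 := DartGraph.dist_triangle hc v x w
  have h2 := DartGraph.dist_triangle hc v w x
  rw [DartGraph.dist_comm x w] at h1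
  constructor
  · have : (X.dist v w : ℝ) ≤ X.dist v x + n := by exact_mod_cast h1.trans (by omega)
    linarith
  · exact_mod_cast h2.trans (by omega)

/-- A map that goes to infinity is proper. -/
theorem isCompact_preimage_of_le_distFun {f : I × ℝ≥0 → X.Space} (hf : Continuous f) {v : X.V}
    {b : ℝ} (hb : ∀ z, (z.2 : ℝ) - b ≤ distFun v (f z)) {C : Set X.Space} (hC : IsCompact C) :
    IsCompact (f ⁻¹' C) := by
  obtain ⟨M, hM⟩ := (hC.image (distFun v).continuous).bddAbove
  have hK : IsCompact ((univ : Set I) ×ˢ Icc (0 : ℝ≥0) (Real.toNNReal (M + b))) :=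
    isCompact_univ.prod isCompact_Icc
  refine hK.of_isClosed_subset (hC.isClosed.preimage hf) fun z hz => ⟨trivial, zero_le, ?_⟩
  have h1 := hM ⟨f z, hz, rfl⟩
  rw [← NNReal.coe_le_coe, Real.coe_toNNReal']
  exact le_max_of_le_left (by linarith [hb z])

end TwoComplex

namespace DartGraph

variable {Γ : DartGraph.{u}} {x : Γ.V}

/-! ### Geodesic rays -/

theorem GeodRay.dist_start (r : Γ.GeodRay x) (k : ℕ) : Γ.dist x (r.vert k) = k := by
  have := r.geod 0 k (Nat.zero_le k)
  rwa [r.start] at this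

theorem GeodRay.isGeodSeg (r : Γ.GeodRay x) (k : ℕ) : Γ.IsGeodSeg r.vert k x (r.vert k) :=
  ⟨r.start, rfl, fun i j hij _ => r.geod i j hij⟩

theorem EdgeRay.tgt_dart (r : Γ.EdgeRay) (k : ℕ) : Γ.tgt (r.dart k) = r.vert (k + 1) :=
  (r.chain k).symm

/-- Geodesic rays that are close at time `N` are `δ`-close until shortly before. -/
theorem GeodRay.dist_le_of_dist_le {δ : ℕ} (hthin : Γ.IsThin δ) (r s : Γ.GeodRay x) {k N C : ℕ}
    (h : Γ.dist (r.vert N) (s.vert N) ≤ C) (hk : 2 * k + C ≤ 2 * N) :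
    Γ.dist (r.vert k) (s.vert k) ≤ δ := by
  refine hthin x _ _ _ _ N N (r.isGeodSeg N) (s.isGeodSeg N) k ?_
  rw [r.dist_start, s.dist_start]
  omega

theorem GeodRay.dist_le_of_toBoundary_eq {δ : ℕ} (hthin : Γ.IsThin δ) {r s : Γ.GeodRay x}
    (h : r.toBoundary = s.toBoundary) (k : ℕ) : Γ.dist (r.vert k) (s.vert k) ≤ δ := by
  obtain ⟨C, hC⟩ := Quotient.exact h
  exact r.dist_le_of_dist_le hthin s (hC (k + C)) (by omega)

theorem GeodRay.toBoundary_eq_iff {δ : ℕ} (hthin : Γ.IsThin δ) {r s : Γ.GeodRay x} :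
    r.toBoundary = s.toBoundary ↔ ∀ k, Γ.dist (r.vert k) (s.vert k) ≤ δ :=
  ⟨fun h => dist_le_of_toBoundary_eq hthin h, fun h => Quotient.sound ⟨δ, h⟩⟩

theorem finite_setOf_dart (hlf : ∀ v, {d | Γ.src d = v}.Finite) (k : ℕ) :
    {d | ∃ r : Γ.GeodRay x, r.dart k = d}.Finite := by
  induction k with
  | zero =>
    refine (hlf x).subset ?_
    rintro d ⟨r, rfl⟩
    exact r.start
  | succ k ih =>
    refine (ih.biUnion fun d _ => hlf (Γ.tgt d)).subset ?_
    rintro d ⟨r, rfl⟩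
    exact mem_biUnion ⟨r, rfl⟩ (r.chain k)

/-- In a locally finite graph, the space of geodesic rays issuing from a vertex is compact. -/
theorem compactSpace_geodRay (hlf : ∀ v, {d | Γ.src d = v}.Finite) :
    CompactSpace (Γ.GeodRay x) := by
  let : TopologicalSpace Γ.D := ⊥
  have : DiscreteTopology Γ.D := ⟨rfl⟩
  have hind : IsInducing fun r : Γ.GeodRay x => r.dart := ⟨rfl⟩
  rw [← isCompact_univ_iff, hind.isCompact_iff, image_univ]
  have hK : IsCompact (Set.pi univ fun k => {d | ∃ r : Γ.GeodRay x, r.dart k = d}) :=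
    isCompact_univ_pi fun k => (finite_setOf_dart hlf k).isCompact
  refine hK.of_isClosed_subset ?_ ?_
  · have : range (fun r : Γ.GeodRay x => r.dart) =
        {f | Γ.src (f 0) = x} ∩ ((⋂ k, {f | Γ.src (f (k + 1)) = Γ.tgt (f k)}) ∩
          ⋂ i, ⋂ j, {f | i ≤ j → Γ.dist (Γ.src (f i)) (Γ.src (f j)) = j - i}) := by
      ext f
      simp only [mem_range, mem_inter_iff, mem_iInter]
      constructor
      · rintro ⟨r, rfl⟩
        exact ⟨r.start, r.chain, r.geod⟩
      · rintro ⟨h1, h2, h3⟩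
        exact ⟨⟨⟨f, h2⟩, h1, h3⟩, rfl⟩
    rw [this]
    have hc : ∀ i j : ℕ, ∀ S : Set (Γ.D × Γ.D), IsClosed {f : ℕ → Γ.D | (f i, f j) ∈ S} :=
      fun i j S => (isClosed_discrete S).preimage
        ((continuous_apply i).prodMk (continuous_apply j))
    refine (hc 0 0 {z | Γ.src z.1 = x}).inter ((isClosed_iInter fun k =>
      hc (k + 1) k {z | Γ.src z.1 = Γ.tgt z.2}).inter (isClosed_iInter fun i =>
        isClosed_iInter fun j => hc i j {z | i ≤ j → Γ.dist (Γ.src z.1) (Γ.src z.2) = j - i}))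
  · rintro _ ⟨r, rfl⟩ k -
    exact ⟨r, rfl⟩

/-- The boundary points all of whose representatives pass near `r` at time `N`. -/
def nearAt (δ N : ℕ) (r : Γ.GeodRay x) : Set (Γ.Boundary x) :=
  {ξ | ∀ q : Γ.GeodRay x, q.toBoundary = ξ → Γ.dist (q.vert N) (r.vert N) ≤ δ}

/-- The equivalence of rays is a closed relation on a compact space, hence the saturation of the
closed set of the rays that are far from `r` at time `N` is closed. -/
theorem isOpen_nearAt {δ : ℕ} (hthin : Γ.IsThin δ) (hlf : ∀ v, {d | Γ.src d = v}.Finite)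
    (N : ℕ) (r : Γ.GeodRay x) : IsOpen (nearAt δ N r) := by
  let : TopologicalSpace Γ.D := ⊥
  have : DiscreteTopology Γ.D := ⟨rfl⟩
  have := compactSpace_geodRay (x := x) hlf
  have hind : IsInducing fun r : Γ.GeodRay x => r.dart := ⟨rfl⟩
  have hdart : ∀ k, Continuous fun r : Γ.GeodRay x => r.dart k := fun k =>
    (continuous_apply k).comp hind.continuous
  have hc : ∀ k, ∀ S : Set (Γ.D × Γ.D),
      IsClosed {z : Γ.GeodRay x × Γ.GeodRay x | (z.1.dart k, z.2.dart k) ∈ S} := fun k S =>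
    (isClosed_discrete S).preimage
      (((hdart k).comp continuous_fst).prodMk ((hdart k).comp continuous_snd))
  have hcl : IsClosed (Prod.fst '' ((⋂ k, {z : Γ.GeodRay x × Γ.GeodRay x |
      Γ.dist (z.1.vert k) (z.2.vert k) ≤ δ}) ∩
        {z : Γ.GeodRay x × Γ.GeodRay x | ¬ Γ.dist (z.2.vert N) (r.vert N) ≤ δ})) := by
    refine isClosedMap_fst_of_compactSpace _ (IsClosed.inter (isClosed_iInter fun k => ?_) ?_)
    · exact hc k {z | Γ.dist (Γ.src z.1) (Γ.src z.2) ≤ δ}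
    · exact hc N {z | ¬ Γ.dist (Γ.src z.2) (r.vert N) ≤ δ}
  change IsOpen ((Quotient.mk (Γ.geodRaySetoid x)) ⁻¹' nearAt δ N r)
  rw [← isClosed_compl_iff]
  convert hcl using 1
  ext p
  simp only [mem_compl_iff, nearAt, mem_image, mem_inter_iff, mem_iInter]
  constructor
  · intro h
    obtain ⟨q, hq⟩ := not_forall.1 h
    obtain ⟨hq, hq'⟩ := Classical.not_imp.1 hq
    exact ⟨(p, q), ⟨(GeodRay.toBoundary_eq_iff hthin).1 hq.symm, hq'⟩, rfl⟩
  · rintro ⟨⟨p, q⟩, ⟨h1, h2⟩, rfl⟩ h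
    exact h2 (h q ((GeodRay.toBoundary_eq_iff hthin).2 h1).symm)

/-- Rays that represent close points of a path in the boundary stay close for a long time. -/
theorem exists_forall_dist_le {δ : ℕ} (hthin : Γ.IsThin δ) (hc : Γ.toSimple.Connected)
    (hlf : ∀ v, {d | Γ.src d = v}.Finite) {γ : I → Γ.Boundary x} (hγ : Continuous γ)
    (r : I → Γ.GeodRay x) (hr : ∀ a, (r a).toBoundary = γ a) (N : ℕ) :
    ∃ ε > 0, ∀ a b : I, Dist.dist a b < ε → ∀ k ≤ N,
      Γ.dist ((r a).vert k) ((r b).vert k) ≤ δ := by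
  obtain ⟨ε, hε, h⟩ := lebesgue_number_lemma_of_metric (s := (univ : Set I)) isCompact_univ
    (c := fun a => γ ⁻¹' nearAt δ (N + δ) (r a))
    (fun a => (isOpen_nearAt hthin hlf _ _).preimage hγ)
    (fun a _ => mem_iUnion.2 ⟨a, fun q hq => GeodRay.dist_le_of_toBoundary_eq hthin
      (hq.trans (hr a).symm) _⟩)
  refine ⟨ε, hε, fun a b hab k hk => ?_⟩
  obtain ⟨c, hc'⟩ := h a trivial
  have h1 := hc' (Metric.mem_ball_self hε) (r a) (hr a)
  have h2 := hc' (Metric.mem_ball'.2 hab) (r b) (hr b)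
  refine (r a).dist_le_of_dist_le hthin (r b) (C := 2 * δ) (N := N + δ) ?_ (by omega)
  have h3 := dist_triangle hc ((r a).vert (N + δ)) ((r c).vert (N + δ)) ((r b).vert (N + δ))
  rw [dist_comm ((r c).vert (N + δ))] at h3
  omega

end DartGraph

namespace PeripheralPresentation

variable {G : Type u} {n : ℕ} [Group G] {𝒜 : PeripheralPresentation G n}

theorem finite_setOf_within (i : Fin n) (m : ℕ) (g : G) : {h | 𝒜.Within i m g h}.Finite := by
  have hfin : {x | x ∈ 𝒜.S ∨ x⁻¹ ∈ 𝒜.S}.Finite := by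
    refine 𝒜.S_finite.union (𝒜.S_finite.inv.subset fun x hx => ?_)
    exact hx
  have : Finite {x | x ∈ 𝒜.S ∨ x⁻¹ ∈ 𝒜.S} := hfin
  refine ((List.finite_length_le {x | x ∈ 𝒜.S ∨ x⁻¹ ∈ 𝒜.S} m).image
    fun l => g * (l.map Subtype.val).prod).subset ?_
  rintro h ⟨l, h1, h2, rfl⟩
  lift l to List {x | x ∈ 𝒜.S ∨ x⁻¹ ∈ 𝒜.S} using fun x hx => (h2 x hx).2
  exact ⟨l, by simpa using h1, rfl⟩

variable (𝒜) in
theorem locallyFinite (v : 𝒜.cuspedSpace.V) : {d | 𝒜.cuspedSpace.src d = v}.Finite := by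
  have : Finite 𝒜.S := 𝒜.S_finite
  obtain g | ⟨i, g, k⟩ := v
  · refine ((finite_range fun s : 𝒜.S => (Dart.cayley g s true : 𝒜.Dart)).union
      ((finite_range fun s : 𝒜.S => (Dart.cayley (g * (s : G)⁻¹) s false : 𝒜.Dart)).union
        (finite_range fun i : Fin n => (Dart.vert i g 0 true : 𝒜.Dart)))).subset ?_
    rintro (⟨g', s, b⟩ | ⟨j, k', g', h', hne, hdd⟩ | ⟨j, g', k', b⟩) hd
    · cases b
      · right; left
        refine ⟨s, ?_⟩
        have : g' * s = g := Vertex.base.inj hd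
        simp [← this]
      · left
        obtain rfl : g' = g := Vertex.base.inj hd
        exact ⟨s, rfl⟩
    · cases hd
    · right; right
      cases b
      · cases hd
      · cases k' with
        | zero => cases hd; exact ⟨j, rfl⟩
        | succ k => cases hd
  · have : Finite {h | 𝒜.Within i (2 ^ (k + 1)) g h} := finite_setOf_within i _ g
    have : Finite {h // g ≠ h ∧ 𝒜.Within i (2 ^ (k + 1)) g h} :=
      (finite_setOf_within i (2 ^ (k + 1)) g).subset fun h hh => hh.2
    refine ((finite_range fun h : {h // g ≠ h ∧ 𝒜.Within i (2 ^ (k + 1)) g h} =>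
      (Dart.horiz i k g h.1 h.2.1 h.2.2 : 𝒜.Dart)).union
        (toFinite {.vert i g (k + 1) true, .vert i g k false})).subset fun d hd => ?_
    rcases exists_of_src_eq_at_succ (i := i) (g := g) (k := k) hd with
      ⟨h, hne, hdd, rfl⟩ | rfl | rfl
    · exact Or.inl ⟨⟨h, hne, hdd⟩, rfl⟩
    · exact Or.inr (Or.inl rfl)
    · exact Or.inr (Or.inr rfl)

end PeripheralPresentation

/-! ### Filling squares and gluing -/

/-- The map of the unit square that takes the vertical segment at `s = 0` to the lower and right
sides, the one at `s = 1` to the left and upper sides, and collapses the sides `t = 0`, `t = 1` to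
corners. -/
noncomputable def squareMap (z : I × I) : I × I :=
  (⟨(1 - (z.1 : ℝ)) * min (2 * (z.2 : ℝ)) 1 + (z.1 : ℝ) * max 0 (2 * (z.2 : ℝ) - 1), by
    obtain ⟨⟨s, hs0, hs1⟩, ⟨t, ht0, ht1⟩⟩ := z
    dsimp only
    have h1 : 0 ≤ min (2 * t) 1 := le_min (by linarith) zero_le_one
    have h2 : min (2 * t) 1 ≤ 1 := min_le_right _ _
    have h3 : 0 ≤ max 0 (2 * t - 1) := le_max_left _ _
    have h4 : max 0 (2 * t - 1) ≤ 1 := max_le zero_le_one (by linarith)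
    constructor <;> nlinarith⟩,
  ⟨(1 - (z.1 : ℝ)) * max 0 (2 * (z.2 : ℝ) - 1) + (z.1 : ℝ) * min (2 * (z.2 : ℝ)) 1, by
    obtain ⟨⟨s, hs0, hs1⟩, ⟨t, ht0, ht1⟩⟩ := z
    dsimp only
    have h1 : 0 ≤ min (2 * t) 1 := le_min (by linarith) zero_le_one
    have h2 : min (2 * t) 1 ≤ 1 := min_le_right _ _
    have h3 : 0 ≤ max 0 (2 * t - 1) := le_max_left _ _
    have h4 : max 0 (2 * t - 1) ≤ 1 := max_le zero_le_one (by linarith)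
    constructor <;> nlinarith⟩)

theorem continuous_squareMap : Continuous squareMap := by
  unfold squareMap
  fun_prop

theorem squareMap_add (z : I × I) : ((squareMap z).1 + (squareMap z).2 : ℝ) = 2 * z.2 := by
  obtain ⟨⟨s, hs⟩, ⟨t, ht⟩⟩ := z
  change (1 - s) * min (2 * t) 1 + s * max 0 (2 * t - 1) +
    ((1 - s) * max 0 (2 * t - 1) + s * min (2 * t) 1) = 2 * t
  have : min (2 * t) 1 + max 0 (2 * t - 1) = 2 * t := by
    rcases le_total (2 * t) 1 with h | h
    · rw [min_eq_left h, max_eq_left (by linarith)]; ring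
    · rw [min_eq_right h, max_eq_right (by linarith)]; ring
  linear_combination this

theorem squareMap_sub (z : I × I) : ((squareMap z).1 - (squareMap z).2 : ℝ) =
    (1 - 2 * z.1) * min (2 * (z.2 : ℝ)) (2 - 2 * (z.2 : ℝ)) := by
  obtain ⟨⟨s, hs⟩, ⟨t, ht⟩⟩ := z
  change (1 - s) * min (2 * t) 1 + s * max 0 (2 * t - 1) -
    ((1 - s) * max 0 (2 * t - 1) + s * min (2 * t) 1) = (1 - 2 * s) * min (2 * t) (2 - 2 * t)
  rcases le_total (2 * t) 1 with h | h
  · rw [min_eq_left h, max_eq_left (by linarith), min_eq_left (by linarith)]; ring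
  · rw [min_eq_right h, max_eq_right (by linarith), min_eq_right (by linarith)]; ring

theorem squareMap_surjective : Function.Surjective squareMap := by
  rintro ⟨⟨x, hx0, hx1⟩, ⟨y, hy0, hy1⟩⟩
  have ht : (x + y) / 2 ∈ I := ⟨by linarith, by linarith⟩
  have key : ∀ s : I, x - y = (1 - 2 * s) * min (x + y) (2 - (x + y)) →
      ∃ z, squareMap z = (⟨x, hx0, hx1⟩, ⟨y, hy0, hy1⟩) := by
    intro s hs
    refine ⟨(s, ⟨_, ht⟩), ?_⟩
    have h1 := squareMap_add (s, ⟨_, ht⟩)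
    have h2 := squareMap_sub (s, ⟨_, ht⟩)
    dsimp only at h1 h2
    rw [show 2 * ((x + y) / 2) = x + y by ring] at h1 h2
    rw [← hs] at h2
    refine Prod.ext (Subtype.ext ?_) (Subtype.ext ?_)
    · dsimp only; linarith
    · dsimp only; linarith
  have hM : |x - y| ≤ min (x + y) (2 - (x + y)) :=
    abs_le.2 ⟨by rw [neg_le]; exact le_min (by linarith) (by linarith),
      le_min (by linarith) (by linarith)⟩
  rcases ((abs_nonneg _).trans hM).eq_or_lt with h0 | h0
  · refine key 0 ?_
    rw [← h0] at hM ⊢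
    simpa using hM
  · have h1 := abs_le.1 (abs_div_le_one hM h0)
    refine key ⟨(1 - (x - y) / min (x + y) (2 - (x + y))) / 2, by linarith, by linarith⟩ ?_
    field_simp
    ring
where
  abs_div_le_one {a b : ℝ} (h : |a| ≤ b) (hb : 0 < b) : |a / b| ≤ 1 := by
    rw [abs_div, abs_of_pos hb]
    exact (div_le_one hb).2 h

theorem squareMap_eq_iff {z w : I × I} (h : squareMap z = squareMap w) :
    z.2 = w.2 ∧ (z.1 = w.1 ∨ z.2 = 0 ∨ z.2 = 1) := by
  have h1 := squareMap_add z
  have h2 := squareMap_sub z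
  rw [h, squareMap_add w] at h1
  rw [h, squareMap_sub w] at h2
  have ht : z.2 = w.2 := Subtype.ext (by linarith)
  refine ⟨ht, ?_⟩
  rw [← ht] at h2
  rcases mul_eq_mul_right_iff.1 h2 with h3 | h3
  · exact Or.inl (Subtype.ext (by linarith))
  · right
    rcases min_choice (2 * (z.2 : ℝ)) (2 - 2 * z.2) with h4 | h4 <;> rw [h4] at h3
    · exact Or.inl (Subtype.ext (by simpa using h3))
    · exact Or.inr (Subtype.ext (by change (z.2 : ℝ) = 1; linarith))

/-- If the two ways around a square are homotopic, then the square can be filled. -/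
theorem Path.Homotopic.exists_fill {Y : Type*} [TopologicalSpace Y] {a b c d : Y} {α : Path a b}
    {β : Path b c} {α' : Path a d} {β' : Path d c}
    (h : (α.trans β).Homotopic (α'.trans β')) :
    ∃ Φ : C(I × I, Y), (∀ t, Φ (t, 0) = α t) ∧ (∀ t, Φ (1, t) = β t) ∧ (∀ t, Φ (0, t) = α' t) ∧
      ∀ t, Φ (t, 1) = β' t := by
  obtain ⟨H⟩ := h
  have hq : IsQuotientMap (⟨squareMap, continuous_squareMap⟩ : C(I × I, I × I)) :=
    continuous_squareMap.isClosedMap.isQuotientMap continuous_squareMap squareMap_surjective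
  have hfac : Function.FactorsThrough (H : C(I × I, Y))
      (⟨squareMap, continuous_squareMap⟩ : C(I × I, I × I)) := by
    rintro ⟨s, t⟩ ⟨s', t'⟩ hz
    obtain ⟨h1, h2⟩ := squareMap_eq_iff hz
    dsimp only at h1 h2
    subst h1
    rcases h2 with rfl | rfl | rfl
    · rfl
    · exact (H.source _).trans (H.source _).symm
    · exact (H.target _).trans (H.target _).symm
  have hΦ : ∀ z, hq.lift (H : C(I × I, Y)) hfac (squareMap z) = H z := fun z =>
    DFunLike.congr_fun (hq.lift_comp (H : C(I × I, Y)) hfac) z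
  have hlow : ∀ t : I, (t : ℝ) / 2 ∈ I := fun t => ⟨by linarith [t.2.1], by linarith [t.2.2]⟩
  have hupp : ∀ t : I, (1 + (t : ℝ)) / 2 ∈ I := fun t => ⟨by linarith [t.2.1], by linarith [t.2.2]⟩
  have hcoord : ∀ (s u : I) (x y : I), (x + y : ℝ) = 2 * u →
      (x - y : ℝ) = (1 - 2 * s) * min (2 * (u : ℝ)) (2 - 2 * u) → squareMap (s, u) = (x, y) := by
    intro s u x y h1 h2
    have h3 := squareMap_add (s, u)
    have h4 := squareMap_sub (s, u)
    refine Prod.ext (Subtype.ext ?_) (Subtype.ext ?_)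
    · dsimp only at h3 h4 ⊢; linarith
    · dsimp only at h3 h4 ⊢; linarith
  have lowmin : ∀ t : I, min (2 * ((t : ℝ) / 2)) (2 - 2 * (t / 2)) = t := fun t => by
    rw [min_eq_left] <;> linarith [t.2.2]
  have uppmin : ∀ t : I, min (2 * ((1 + (t : ℝ)) / 2)) (2 - 2 * ((1 + t) / 2)) = 1 - t := fun t => by
    rw [min_eq_right] <;> linarith [t.2.1]
  have trans_low : ∀ {p q r : Y} (γ : Path p q) (γ' : Path q r) (t : I),
      (γ.trans γ') ⟨t / 2, hlow t⟩ = γ t := by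
    intro p q r γ γ' t
    rw [Path.trans_apply, dif_pos (by dsimp only; linarith [t.2.2])]
    congr 1
    ext
    dsimp only
    ring
  have trans_upp : ∀ {p q r : Y} (γ : Path p q) (γ' : Path q r) (t : I),
      (γ.trans γ') ⟨(1 + t) / 2, hupp t⟩ = γ' t := by
    intro p q r γ γ' t
    have h2 := trans_low γ'.symm γ.symm (σ t)
    rw [← Path.trans_symm, Path.symm_apply, Path.symm_apply, Function.comp_apply,
      Function.comp_apply, unitInterval.symm_symm] at h2
    rw [← h2]
    congr 1
    ext
    simp only [coe_symm_eq]
    ring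
  refine ⟨hq.lift (H : C(I × I, Y)) hfac, fun t => ?_, fun t => ?_, fun t => ?_, fun t => ?_⟩
  · rw [← hcoord 0 ⟨_, hlow t⟩ t 0 (by simp; ring) (by rw [lowmin]; simp), hΦ, H.apply_zero]
    exact trans_low _ _ _
  · rw [← hcoord 0 ⟨_, hupp t⟩ 1 t (by simp; ring) (by rw [uppmin]; simp), hΦ, H.apply_zero]
    exact trans_upp _ _ _
  · rw [← hcoord 1 ⟨_, hlow t⟩ 0 t (by simp; ring) (by rw [lowmin]; simp; ring), hΦ, H.apply_one]
    exact trans_low _ _ _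
  · rw [← hcoord 1 ⟨_, hupp t⟩ t 1 (by simp; ring) (by rw [uppmin]; simp; ring), hΦ, H.apply_one]
    exact trans_upp _ _ _

/-- Gluing of continuous maps along a locally finite closed cover. -/
theorem LocallyFinite.exists_glue {ι Z Y : Type*} [TopologicalSpace Z] [TopologicalSpace Y]
    {S : ι → Set Z} (hS : LocallyFinite S) (hcl : ∀ i, IsClosed (S i)) (hcov : ∀ z, ∃ i, z ∈ S i)
    (φ : ι → Z → Y) (hφ : ∀ i, ContinuousOn (φ i) (S i))
    (heq : ∀ i j z, z ∈ S i → z ∈ S j → φ i z = φ j z) :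
    ∃ f : Z → Y, Continuous f ∧ ∀ i, ∀ z ∈ S i, f z = φ i z := by
  choose k hk using hcov
  have hf : ∀ i, ∀ z ∈ S i, φ (k z) z = φ i z := fun i z hz => heq _ _ _ (hk z) hz
  exact ⟨fun z => φ (k z) z, hS.continuous (iUnion_eq_univ_iff.2 fun z => ⟨k z, hk z⟩) hcl
    fun i => (hφ i).congr (hf i), hf⟩

/-! ### Horizontal edges of filters -/

namespace StripFilter

variable {F : StripFilter} {m : ℕ} {t s t' s' a : I}

theorem IsHorizontalEdge.cast_lt (h : F.IsHorizontalEdge m t s) : (t : ℝ) < s := h.2.2.1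

/-- Two horizontal edges of the same height that meet are equal or adjacent. -/
theorem IsHorizontalEdge.eq_or_eq (h : F.IsHorizontalEdge m t s) (h' : F.IsHorizontalEdge m t' s')
    (h1 : t ≤ a) (h2 : a ≤ s) (h1' : t' ≤ a) (h2' : a ≤ s') :
    (t = t' ∧ s = s') ∨ (a = s ∧ a = t') ∨ (a = t ∧ a = s') := by
  rcases h.2.2.2 t' h'.1 with h3 | h3
  · rcases h'.2.2.2 t h.1 with h4 | h4
    · have ht : t = t' := le_antisymm h4 h3
      refine Or.inl ⟨ht, ?_⟩
      rcases h.2.2.2 s' h'.2.1 with h5 | h5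
      · exact absurd (h'.2.2.1.trans_le h5) (by rw [ht]; exact lt_irrefl _)
      · rcases h'.2.2.2 s h.2.1 with h6 | h6
        · exact absurd (h.2.2.1.trans_le h6) (by rw [ht]; exact lt_irrefl _)
        · exact le_antisymm h5 h6
    · exact Or.inr (Or.inr ⟨le_antisymm (h2'.trans h4) h1, le_antisymm h2' (h4.trans h1)⟩)
  · exact Or.inr (Or.inl ⟨le_antisymm h2 (h3.trans h1'), le_antisymm (h2.trans h3) h1'⟩)

/-- Between two vertices `t ≤ a < s` of the same height there is a horizontal edge that contains `a` and
does not end there. -/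
theorem exists_isHorizontalEdge (F : StripFilter) {m : ℕ} {t s : I} (ht : t ∈ F.level m)
    (hs : s ∈ F.level m) (h1 : t ≤ a) (h2 : a < s) :
    ∃ t' s', F.IsHorizontalEdge m t' s' ∧ t ≤ t' ∧ t' ≤ a ∧ a < s' ∧ s' ≤ s := by
  have hL : ((F.level m).filter (· ≤ a)).Nonempty := ⟨t, by simp [ht, h1]⟩
  have hR : ((F.level m).filter (a < ·)).Nonempty := ⟨s, by simp [hs, h2]⟩
  have hl := Finset.max'_mem _ hL
  have hr := Finset.min'_mem _ hR
  rw [Finset.mem_filter] at hl hr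
  refine ⟨_, _, ⟨hl.1, hr.1, hl.2.trans_lt hr.2, fun u hu => ?_⟩,
    Finset.le_max' _ _ (by simp [ht, h1]), hl.2, hr.2, Finset.min'_le _ _ (by simp [hs, h2])⟩
  rcases le_or_gt u a with h | h
  · exact Or.inl (Finset.le_max' _ _ (by simp [hu, h]))
  · exact Or.inr (Finset.min'_le _ _ (by simp [hu, h]))

/-- As `exists_isHorizontalEdge`, with a horizontal edge that does not start at `a`. -/
theorem exists_isHorizontalEdge' (F : StripFilter) {m : ℕ} {t s : I} (ht : t ∈ F.level m)
    (hs : s ∈ F.level m) (h1 : t < a) (h2 : a ≤ s) :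
    ∃ t' s', F.IsHorizontalEdge m t' s' ∧ t ≤ t' ∧ t' < a ∧ a ≤ s' ∧ s' ≤ s := by
  have hL : ((F.level m).filter (· < a)).Nonempty := ⟨t, by simp [ht, h1]⟩
  have hR : ((F.level m).filter (a ≤ ·)).Nonempty := ⟨s, by simp [hs, h2]⟩
  have hl := Finset.max'_mem _ hL
  have hr := Finset.min'_mem _ hR
  rw [Finset.mem_filter] at hl hr
  refine ⟨_, _, ⟨hl.1, hr.1, hl.2.trans_le hr.2, fun u hu => ?_⟩,
    Finset.le_max' _ _ (by simp [ht, h1]), hl.2, hr.2, Finset.min'_le _ _ (by simp [hs, h2])⟩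
  rcases lt_or_ge u a with h | h
  · exact Or.inl (Finset.le_max' _ _ (by simp [hu, h]))
  · exact Or.inr (Finset.min'_le _ _ (by simp [hu, h]))

theorem exists_isHorizontalEdge_mem (F : StripFilter) (m : ℕ) (a : I) :
    ∃ t s, F.IsHorizontalEdge m t s ∧ t ≤ a ∧ a ≤ s := by
  rcases a.2.1.eq_or_lt with h | h
  · have ha : a < 1 := Subtype.coe_lt_coe.1 (h ▸ zero_lt_one)
    obtain ⟨t, s, hts, -, h1, h2, -⟩ :=
      F.exists_isHorizontalEdge (F.zero_mem m) (F.one_mem m) a.2.1 ha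
    exact ⟨t, s, hts, h1, h2.le⟩
  · obtain ⟨t, s, hts, -, h1, h2, -⟩ :=
      F.exists_isHorizontalEdge' (F.zero_mem m) (F.one_mem m) (Subtype.coe_lt_coe.1 h) a.2.2
    exact ⟨t, s, hts, h1.le, h2⟩

/-- A vertex of the filter on a closed horizontal edge is one of its end points. -/
theorem IsHorizontalEdge.eq_of_mem_level (h : F.IsHorizontalEdge m t s) (ha : a ∈ F.level m)
    (h1 : t ≤ a) (h2 : a ≤ s) : a = t ∨ a = s :=
  (h.2.2.2 a ha).imp (fun h => le_antisymm h h1) fun h => le_antisymm h2 h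

end StripFilter

namespace TwoComplex

variable {X : TwoComplex.{u}}

/-! ### Maps on the levels of a filter -/

/-- The map `h` sends each horizontal edge `[t, s]` of height `m` to the edge path `P t s`, which
issues from the vertex `v t`, at constant speed. -/
def IsLevelMap (F : StripFilter) (m : ℕ) (v : I → X.V) (P : I → I → List X.D) (h : I → X.Space) :
    Prop :=
  Continuous h ∧ ∀ t s, F.IsHorizontalEdge m t s → ∀ a : I, t ≤ a → a ≤ s →
    h a = X.walkPt (v t) (P t s) (((a : ℝ) - t) / ((s : ℝ) - t) * (P t s).length)

variable {F : StripFilter} {m : ℕ} {v : I → X.V} {P : I → I → List X.D} {h : I → X.Space} {t s : I}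

theorem exists_isLevelMap (hP : ∀ t s, F.IsHorizontalEdge m t s → X.IsWalk (v t) (P t s) (v s)) :
    ∃ h, X.IsLevelMap F m v P h := by
  let ι := {e : I × I // F.IsHorizontalEdge m e.1 e.2}
  have hι : Finite ι := by
    refine Set.Finite.subset (s := (F.level m : Set I) ×ˢ (F.level m : Set I))
      ((F.level m).finite_toSet.prod (F.level m).finite_toSet) fun e he => ?_
    exact ⟨he.1, he.2.1⟩
  let φ : ι → I → X.Space := fun e a =>
    X.walkPt (v e.1.1) (P e.1.1 e.1.2) (((a : ℝ) - e.1.1) / ((e.1.2 : ℝ) - e.1.1) *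
      (P e.1.1 e.1.2).length)
  have h0 : ∀ e : ι, φ e e.1.1 = X.vertexPt (v e.1.1) := fun e =>
    walkPt_of_nonpos (hP _ _ e.2) (by simp)
  have h1 : ∀ e : ι, φ e e.1.2 = X.vertexPt (v e.1.2) := fun e =>
    walkPt_of_ge (hP _ _ e.2) (by rw [div_self (sub_pos.2 e.2.cast_lt).ne', one_mul])
  have heq : ∀ (i j : ι) (a : I), a ∈ Icc i.1.1 i.1.2 → a ∈ Icc j.1.1 j.1.2 → φ i a = φ j a := by
    rintro ⟨⟨t, s⟩, e⟩ ⟨⟨t', s'⟩, e'⟩ a ⟨ht, hs⟩ ⟨ht', hs'⟩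
    rcases e.eq_or_eq e' ht hs ht' hs' with ⟨h3, h4⟩ | ⟨h3, h4⟩ | ⟨h3, h4⟩
    · dsimp only at h3 h4
      subst h3 h4
      rfl
    · dsimp only at h3 h4
      subst h3 h4
      exact (h1 ⟨(t, a), e⟩).trans (h0 ⟨(a, s'), e'⟩).symm
    · dsimp only at h3 h4
      subst h3 h4
      exact (h0 ⟨(a, s), e⟩).trans (h1 ⟨(t', a), e'⟩).symm
  obtain ⟨f, hf, hf'⟩ := (locallyFinite_of_finite fun e : ι => Icc e.1.1 e.1.2).exists_glue
    (fun e => isClosed_Icc)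
    (fun a => by
      obtain ⟨t, s, hts, ht, hs⟩ := F.exists_isHorizontalEdge_mem m a
      exact ⟨⟨(t, s), hts⟩, ht, hs⟩)
    φ (fun e => ((continuous_walkPt (hP _ _ e.2)).comp (by fun_prop)).continuousOn) heq
  exact ⟨f, hf, fun t s hts a h1 h2 => hf' ⟨(t, s), hts⟩ a ⟨h1, h2⟩⟩

namespace IsLevelMap

theorem apply_left (hh : X.IsLevelMap F m v P h)
    (hP : ∀ t s, F.IsHorizontalEdge m t s → X.IsWalk (v t) (P t s) (v s))
    (hts : F.IsHorizontalEdge m t s) : h t = X.vertexPt (v t) := by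
  rw [hh.2 t s hts t le_rfl hts.2.2.1.le]
  exact walkPt_of_nonpos (hP _ _ hts) (by simp)

theorem apply_right (hh : X.IsLevelMap F m v P h)
    (hP : ∀ t s, F.IsHorizontalEdge m t s → X.IsWalk (v t) (P t s) (v s))
    (hts : F.IsHorizontalEdge m t s) : h s = X.vertexPt (v s) := by
  rw [hh.2 t s hts s hts.2.2.1.le le_rfl]
  exact walkPt_of_ge (hP _ _ hts) (by rw [div_self (sub_pos.2 hts.cast_lt).ne', one_mul])

theorem apply_of_mem_level (hh : X.IsLevelMap F m v P h)
    (hP : ∀ t s, F.IsHorizontalEdge m t s → X.IsWalk (v t) (P t s) (v s)) (ht : t ∈ F.level m) :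
    h t = X.vertexPt (v t) := by
  obtain ⟨t', s', hts, h1, h2⟩ := F.exists_isHorizontalEdge_mem m t
  rcases hts.eq_of_mem_level ht h1 h2 with rfl | rfl
  exacts [hh.apply_left hP hts, hh.apply_right hP hts]

/-- The point of `[t, s]` at parameter `x ∈ [0, 1]`. -/
noncomputable def segPt (t s : I) (x : I) : I := projIcc 0 1 zero_le_one ((t : ℝ) + x * (s - t))

theorem continuous_segPt (t s : I) : Continuous (segPt t s) := by
  unfold segPt
  exact continuous_projIcc.comp (by fun_prop)

theorem coe_segPt (t s x : I) : (segPt t s x : ℝ) = t + x * (s - t) := by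
  have : (t : ℝ) + x * (s - t) ∈ Icc (0 : ℝ) 1 := by
    obtain ⟨t, ht⟩ := t; obtain ⟨s, hs⟩ := s; obtain ⟨x, hx⟩ := x
    dsimp only
    constructor
    · nlinarith [mul_nonneg hx.1 hs.1, mul_nonneg (sub_nonneg.2 hx.2) ht.1]
    · nlinarith [mul_nonneg hx.1 (sub_nonneg.2 hs.2),
        mul_nonneg (sub_nonneg.2 hx.2) (sub_nonneg.2 ht.2)]
  unfold segPt
  rw [projIcc_of_mem _ this]

theorem le_segPt (hts : t ≤ s) (x : I) : t ≤ segPt t s x :=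
  Subtype.coe_le_coe.1 (by
    rw [coe_segPt]
    have : (t : ℝ) ≤ s := hts
    nlinarith [x.2.1])

theorem segPt_le (hts : t ≤ s) (x : I) : segPt t s x ≤ s :=
  Subtype.coe_le_coe.1 (by
    rw [coe_segPt]
    have : (t : ℝ) ≤ s := hts
    nlinarith [x.2.2])

/-- The restriction of a level map to the segment between two vertices is homotopic to an
edge path, and this in each full subcomplex that contains the edge paths in between. -/
theorem exists_homotopic (hh : X.IsLevelMap F m v P h)
    (hP : ∀ t s, F.IsHorizontalEdge m t s → X.IsWalk (v t) (P t s) (v s)) {U : Set X.V}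
    (ht : t ∈ F.level m) (hs : s ∈ F.level m) (hts : t ≤ s) (hU : v s ∈ U)
    (hPU : ∀ t' s', F.IsHorizontalEdge m t' s' → t ≤ t' → s' ≤ s →
      X.IsWalkIn U (v t') (P t' s') (v s')) :
    ∃ (p : List X.D) (hp : X.IsWalkIn U (v t) p (v s)) (γ : Path
      (⟨X.vertexPt (v t), vertexPt_mem_sub hp.left_mem⟩ : X.sub U)
      ⟨X.vertexPt (v s), vertexPt_mem_sub hp.right_mem⟩),
      (∀ x, (γ x : X.Space) = h (segPt t s x)) ∧ γ.Homotopic (walkPath hp) := by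
  induction hn : ((F.level m).filter (t < ·)).card using Nat.strong_induction_on generalizing t with
  | _ n ih =>
  rcases hts.eq_or_lt with rfl | hlt
  · refine ⟨[], .nil hU, Path.refl _, fun x => ?_, ?_⟩
    · rw [show segPt t t x = t from Subtype.ext (by rw [coe_segPt]; ring)]
      exact (hh.apply_of_mem_level hP ht).symm
    · rw [walkPath_nil hU]
  · obtain ⟨t₀, r, htr, h1, h2, h3, h4⟩ := F.exists_isHorizontalEdge ht hs le_rfl hlt
    obtain rfl : t₀ = t := le_antisymm h2 h1
    have htr' := htr.cast_lt
    have hrs : (r : ℝ) ≤ s := h4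
    have hts' : (t₀ : ℝ) < s := hlt
    obtain ⟨p, hp, β, hβ, hβp⟩ := ih _ (hn ▸ Finset.card_lt_card
      ⟨Finset.monotone_filter_right _ fun x _ (hx : r < x) => h3.trans hx, fun hsub => by
        have := hsub (show r ∈ _ by simp [htr.2.1, h3])
        simp at this⟩) htr.2.1 h4 (fun t' s' h5 h6 h7 => hPU t' s' h5 (h3.le.trans h6) h7) rfl
    have hq := hPU t₀ r htr le_rfl h4
    have hmem : ∀ x, h (segPt t₀ s x) ∈ X.sub U := by
      intro x
      rcases le_total (segPt t₀ s x) r with h5 | h5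
      · rw [hh.2 t₀ r htr _ (le_segPt hts x) h5]
        exact walkPt_mem_sub hq _
      · have h5' : (r : ℝ) ≤ segPt t₀ s x := h5
        have h6' : (segPt t₀ s x : ℝ) ≤ s := segPt_le hts x
        rcases hrs.eq_or_lt with h6 | h6
        · have : segPt t₀ s x = s := Subtype.ext (le_antisymm h6' (h6 ▸ h5'))
          rw [this, hh.apply_of_mem_level hP hs]
          exact vertexPt_mem_sub hU
        · have hy : ((segPt t₀ s x : ℝ) - r) / (s - r) ∈ I :=
            unitInterval.div_mem (by linarith) (by linarith) (by linarith)
          have e : segPt r s ⟨_, hy⟩ = segPt t₀ s x := by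
            ext
            rw [coe_segPt]
            dsimp only
            rw [div_mul_cancel₀ _ (by linarith)]
            ring
          rw [← e, ← hβ]
          exact (β _).2
    let γ : Path (⟨X.vertexPt (v t₀), vertexPt_mem_sub hq.left_mem⟩ : X.sub U)
        ⟨X.vertexPt (v s), vertexPt_mem_sub hU⟩ :=
      { toFun := fun x => ⟨h (segPt t₀ s x), hmem x⟩
        continuous_toFun := (hh.1.comp (continuous_segPt t₀ s)).subtype_mk _
        source' := Subtype.ext (by
          dsimp only
          rw [show segPt t₀ s 0 = t₀ from Subtype.ext (by rw [coe_segPt]; simp)]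
          exact hh.apply_of_mem_level hP ht)
        target' := Subtype.ext (by
          dsimp only
          rw [show segPt t₀ s 1 = s from Subtype.ext (by rw [coe_segPt]; simp)]
          exact hh.apply_of_mem_level hP hs) }
    refine ⟨P t₀ r ++ p, hq.append hp, γ, fun x => rfl, ?_⟩
    have hb : ((r : ℝ) - t₀) / (s - t₀) ∈ I :=
      unitInterval.div_mem (by linarith) (by linarith) (by linarith)
    have hb' : ((r : ℝ) - t₀) / (s - t₀) * (s - t₀) = r - t₀ :=
      div_mul_cancel₀ _ (by linarith)
    -- `γ` is cut at `r`: its first part runs through `P t₀ r`, its second part is `β`.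
    refine Path.Homotopic.trans (Path.homotopic_trans_of_eq γ (walkPath hq) β ⟨_, hb⟩ ?_ ?_)
      (((Path.Homotopic.refl _).hcomp hβp).trans (walkPath_append hq hp).symm)
    · intro x y hy
      refine Subtype.ext ?_
      change _ = h (segPt t₀ s y)
      have e : (segPt t₀ s y : ℝ) = t₀ + x * (r - t₀) := by
        rw [coe_segPt, hy, mul_assoc]
        dsimp only
        rw [hb']
      have e' : segPt t₀ s y = segPt t₀ r x := Subtype.ext (by rw [e, coe_segPt])
      rw [walkPath_apply, hh.2 t₀ r htr _ (le_segPt hts y)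
        (by rw [e']; exact segPt_le h3.le x), e]
      congr 2
      rw [add_sub_cancel_left, mul_div_assoc, div_self (by linarith), mul_one]
    · intro x y hy
      refine Subtype.ext ((hβ x).trans ?_)
      change _ = h (segPt t₀ s y)
      congr 1
      ext
      rw [coe_segPt, coe_segPt, hy]
      dsimp only
      linear_combination (1 - (x : ℝ)) * (-hb')

end IsLevelMap

end TwoComplex

namespace TwoComplex

variable {X : TwoComplex.{u}}

/-! ### Filling a strip -/

theorem rayPt_of_mem (r : X.EdgeRay) {m : ℕ} {u : ℝ≥0} (h1 : (m : ℝ≥0) ≤ u) (h2 : u ≤ m + 1) :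
    X.rayPt r u = X.edgePt (r.dart m) (projIcc 0 1 zero_le_one ((u : ℝ) - m)) := by
  rcases h2.lt_or_eq with h | rfl
  · have : ⌊u⌋₊ = m := (Nat.floor_eq_iff zero_le).2 ⟨h1, h⟩
    rw [rayPt, this]
  · have : ⌊(m : ℝ≥0) + 1⌋₊ = m + 1 := by
      rw [← Nat.cast_succ, Nat.floor_natCast]
    rw [rayPt, this]
    push_cast
    rw [sub_self, add_sub_cancel_left, projIcc_left, projIcc_right]
    refine (edgePt_zero _).trans (Eq.trans ?_ (edgePt_one _).symm)
    rw [r.chain m]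

theorem rayPt_natCast (r : X.EdgeRay) (m : ℕ) : X.rayPt r m = X.vertexPt (r.vert m) := by
  rw [rayPt_of_mem r le_rfl (by simp)]
  simp only [NNReal.coe_natCast, sub_self, projIcc_left]
  exact edgePt_zero _

/-- The filling property in terms of edge paths. The vertices of the loop lie in `B_A(v)` because the
homotopy starts with the loop itself. -/
theorem IsFillingRadius.homot_nil {R A : ℕ} (hA : X.IsFillingRadius R A) {v : X.V} {p : List X.D}
    (hp : X.IsWalkIn (X.cball R v) v p v) : Homot (X.cball A v) v p [] v := by
  obtain ⟨H, hH, hmem, h0, h1, hs⟩ := hA v p hp.isWalk fun d hd => hp.src_mem hd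
  have hv : v ∈ X.cball A v := by
    change X.dist v v ≤ A
    rw [DartGraph.dist_self]
    exact Nat.zero_le _
  have hp' : X.IsWalkIn (X.cball A v) v p v := by
    refine hp.isWalk.isWalkIn hv fun d hd => ?_
    obtain ⟨j, hj, rfl⟩ := List.getElem_of_mem hd
    refine dist_le_of_vertexPt_mem_star ?_
    have hlen : (0 : ℝ) < p.length := by exact_mod_cast (Nat.zero_le j).trans_lt hj
    have ht : (j : ℝ) / p.length ∈ I :=
      unitInterval.div_mem (Nat.cast_nonneg _) hlen.le (by exact_mod_cast hj.le)
    have h2 := hmem (0, ⟨_, ht⟩)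
    rw [h0] at h2
    dsimp only at h2
    have h3 := walkPt_getElem hp.isWalk hj 0
    rw [edgePt_zero, Icc.coe_zero, add_zero] at h3
    rwa [div_mul_cancel₀ _ hlen.ne', h3] at h2
  have hmem' : ∀ z, H z ∈ X.sub (X.cball A v) := fun z => by
    have := hmem z
    rwa [star_eq_sub] at this
  refine ⟨hp', .nil hv, ⟨⟨⟨⟨fun z => ⟨H z, hmem' z⟩, hH.subtype_mk _⟩, fun t => ?_, fun t => ?_⟩,
    ?_⟩⟩⟩
  · exact Subtype.ext (h0 t)
  · exact Subtype.ext (h1 t)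
  · rintro s t (rfl | rfl)
    · exact Subtype.ext ((hs s).1.trans (congrArg Subtype.val (walkPath hp').source.symm))
    · exact Subtype.ext ((hs s).2.trans (congrArg Subtype.val (walkPath hp').target.symm))

variable {F : StripFilter} {V : I → X.EdgeRay} {P : ℕ → I → I → List X.D} {R A : ℕ}

theorem walkPt_inv_dart (r : X.EdgeRay) {m : ℕ} {u : ℝ≥0} (h1 : (m : ℝ≥0) ≤ u) (h2 : u ≤ m + 1)
    {y : I} (hy : (y : ℝ) = m + 1 - u) (w : X.V) :
    X.walkPt w [X.inv (r.dart m)] (y * ([X.inv (r.dart m)] : List X.D).length) = X.rayPt r u := by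
  have h1' : (m : ℝ) ≤ u := by exact_mod_cast h1
  have h2' : (u : ℝ) ≤ m + 1 := by exact_mod_cast h2
  rw [walkPt_cons, List.length_singleton, Nat.cast_one, mul_one, if_pos y.2.2, projIcc_val,
    edgePt_inv, rayPt_of_mem r h1 h2]
  congr 1
  ext
  rw [projIcc_of_mem _ (show (u : ℝ) - m ∈ Icc (0 : ℝ) 1 from ⟨by linarith, by linarith⟩),
    coe_symm_eq, hy]
  dsimp only
  ring

/-- The map given on the boundary of a rectangle extends to the rectangle: the boundary is a loop
that is homotopically trivial in the star of the upper left vertex. -/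
theorem exists_rectangle_fill (hA : X.IsFillingRadius R A) (hRA : R ≤ A) {m : ℕ} {t s : I}
    (hts : F.IsHorizontalEdge m t s) {h₀ h₁ : I → X.Space}
    (hh₀ : X.IsLevelMap F m (fun a => (V a).vert m) (P m) h₀)
    (hh₁ : X.IsLevelMap F (m + 1) (fun a => (V a).vert (m + 1)) (P (m + 1)) h₁)
    (hP : ∀ t s, F.IsHorizontalEdge (m + 1) t s →
      X.IsWalk ((V t).vert (m + 1)) (P (m + 1) t s) ((V s).vert (m + 1)))
    (hlow : X.IsWalkIn (X.cball R ((V t).vert (m + 1))) ((V t).vert m) (P m t s) ((V s).vert m))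
    (hupp : ∀ t' s', F.IsHorizontalEdge (m + 1) t' s' → t ≤ t' → s' ≤ s →
      X.IsWalkIn (X.cball R ((V t).vert (m + 1))) ((V t').vert (m + 1)) (P (m + 1) t' s')
        ((V s').vert (m + 1))) :
    ∃ φ : I × ℝ≥0 → X.Space, Continuous φ ∧
      (∀ a, t ≤ a → a ≤ s → φ (a, (m : ℝ≥0)) = h₀ a ∧ φ (a, (m + 1 : ℝ≥0)) = h₁ a) ∧
      (∀ u : ℝ≥0, (m : ℝ≥0) ≤ u → u ≤ m + 1 →
        φ (t, u) = X.rayPt (V t) u ∧ φ (s, u) = X.rayPt (V s) u) ∧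
      ∀ z, φ z ∈ X.star A ((V t).vert (m + 1)) := by
  set w := (V t).vert (m + 1)
  have hts' := hts.cast_lt
  have hBA : X.cball R w ⊆ X.cball A w := DartGraph.cball_mono hRA w
  have hwB : w ∈ X.cball R w := by
    change X.dist w w ≤ R
    rw [DartGraph.dist_self]
    exact Nat.zero_le _
  have hsB : (V s).vert (m + 1) ∈ X.cball R w := by
    obtain ⟨t', s', h, h1, -, h2, h3⟩ := F.exists_isHorizontalEdge' (F.mono m hts.1)
      (F.mono m hts.2.1) hts.2.2.1 le_rfl
    obtain rfl := le_antisymm h3 h2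
    exact (hupp _ _ h h1 le_rfl).right_mem
  obtain ⟨p, hp, γ, hγ, hγp⟩ := hh₁.exists_homotopic hP (F.mono m hts.1) (F.mono m hts.2.1)
    hts.2.2.1.le hsB hupp
  have hleft : X.IsWalkIn (X.cball R w) w [X.inv ((V t).dart m)] ((V t).vert m) :=
    ⟨(V t).tgt_dart m, hwB, by rw [DartGraph.tgt_inv]; exact hlow.left_mem, X.tgt_inv _⟩
  have hright : X.IsWalkIn (X.cball R w) ((V s).vert (m + 1)) [X.inv ((V s).dart m)]
      ((V s).vert m) :=
    ⟨(V s).tgt_dart m, hsB, by rw [DartGraph.tgt_inv]; exact hlow.right_mem, X.tgt_inv _⟩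
  have hloop := hA.homot_nil ((hleft.append hlow).append (hp.append hright).rev)
  obtain ⟨g1, g2, hg⟩ := hloop.of_loop ((hp.append hright).mono hBA)
  let inc : C(X.sub (X.cball R w), X.sub (X.cball A w)) :=
    ⟨inclusion (sub_mono hBA), continuous_inclusion _⟩
  have hγp' : (γ.map inc.continuous).Homotopic (walkPath (hp.mono hBA)) := hγp.map inc
  have hhom : ((walkPath (hleft.mono hBA)).trans (walkPath (hlow.mono hBA))).Homotopic
      ((γ.map inc.continuous).trans (walkPath (hright.mono hBA))) :=
    (walkPath_append _ _).symm.trans (hg.trans ((walkPath_append (hp.mono hBA)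
      (hright.mono hBA)).trans (hγp'.symm.hcomp (.refl _))))
  -- The first coordinate of `Φ` is the depth below the upper side, the second one runs to the right.
  obtain ⟨Φ, hΦl, hΦb, hΦt, hΦr⟩ := hhom.exists_fill
  let x : I → I := fun a => projIcc 0 1 zero_le_one (((a : ℝ) - t) / (s - t))
  let y : ℝ≥0 → I := fun u => projIcc 0 1 zero_le_one ((m : ℝ) + 1 - u)
  have hx : ∀ a, t ≤ a → a ≤ s → (x a : ℝ) = ((a : ℝ) - t) / (s - t) := by
    intro a h1 h2
    have h1' : (t : ℝ) ≤ a := h1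
    have h2' : (a : ℝ) ≤ s := h2
    change ((projIcc (0 : ℝ) 1 zero_le_one (((a : ℝ) - t) / (s - t)) : I) : ℝ) = _
    rw [projIcc_of_mem _ (unitInterval.div_mem (sub_nonneg.2 h1') (by linarith) (by linarith))]
  have hy : ∀ u : ℝ≥0, (m : ℝ≥0) ≤ u → u ≤ m + 1 → (y u : ℝ) = m + 1 - u := by
    intro u h1 h2
    have h1' : (m : ℝ) ≤ u := by exact_mod_cast h1
    have h2' : (u : ℝ) ≤ m + 1 := by exact_mod_cast h2
    change ((projIcc (0 : ℝ) 1 zero_le_one ((m : ℝ) + 1 - u) : I) : ℝ) = _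
    rw [projIcc_of_mem _ (show (m : ℝ) + 1 - u ∈ Icc (0 : ℝ) 1 from ⟨by linarith, by linarith⟩)]
  refine ⟨fun z => Φ (y z.2, x z.1), ?_, fun a h1 h2 => ⟨?_, ?_⟩, fun u h1 h2 => ⟨?_, ?_⟩,
    fun z => ?_⟩
  · have hx' : Continuous x := continuous_projIcc.comp (by fun_prop)
    have hy' : Continuous y := continuous_projIcc.comp (by fun_prop)
    exact continuous_subtype_val.comp (Φ.continuous.comp
      ((hy'.comp continuous_snd).prodMk (hx'.comp continuous_fst)))
  · have : y m = 1 := Subtype.ext (by rw [hy m le_rfl (by simp)]; simp)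
    dsimp only
    rw [this, hΦb, walkPath_apply, hx a h1 h2, hh₀.2 t s hts a h1 h2]
  · have : y (m + 1) = 0 := Subtype.ext (by rw [hy (m + 1) (by simp) le_rfl]; simp)
    dsimp only
    rw [this, hΦt]
    refine (hγ (x a)).trans ?_
    congr 1
    ext
    rw [IsLevelMap.coe_segPt, hx a h1 h2, div_mul_cancel₀ _ (by linarith)]
    ring
  · have : x t = 0 := Subtype.ext (by rw [hx t le_rfl hts.2.2.1.le]; simp)
    dsimp only
    rw [this, hΦl]
    exact walkPt_inv_dart (V t) h1 h2 (hy u h1 h2) w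
  · have : x s = 1 := Subtype.ext (by
      rw [hx s hts.2.2.1.le le_rfl, div_self (by linarith)]; simp)
    dsimp only
    rw [this, hΦr]
    exact walkPt_inv_dart (V s) h1 h2 (hy u h1 h2) ((V s).vert (m + 1))
  · rw [star_eq_sub]
    exact (Φ (y z.2, x z.1)).2

/-- A family of edge path rays, and of edge paths that join them along the horizontal edges of a
filter and whose rectangles have small boundary, extends to a map of the strip. -/
theorem exists_strip_fill (hA : X.IsFillingRadius R A) (hRA : R ≤ A)
    (hlow : ∀ m t s, F.IsHorizontalEdge m t s →
      X.IsWalkIn (X.cball R ((V t).vert (m + 1))) ((V t).vert m) (P m t s) ((V s).vert m))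
    (hupp : ∀ m t s t' s', F.IsHorizontalEdge m t s → F.IsHorizontalEdge (m + 1) t' s' →
      t ≤ t' → s' ≤ s → X.IsWalkIn (X.cball R ((V t).vert (m + 1))) ((V t').vert (m + 1))
        (P (m + 1) t' s') ((V s').vert (m + 1))) :
    ∃ f : I × ℝ≥0 → X.Space, Continuous f ∧
      (∀ m, ∀ t ∈ F.level m, ∀ u : ℝ≥0, (m : ℝ≥0) ≤ u → f (t, u) = X.rayPt (V t) u) ∧
      (∀ m t s, F.IsHorizontalEdge m t s → ∀ a, t ≤ a → a ≤ s → f (a, (m : ℝ≥0)) =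
        X.walkPt ((V t).vert m) (P m t s) (((a : ℝ) - t) / ((s : ℝ) - t) * (P m t s).length)) ∧
      ∀ m t s, F.IsHorizontalEdge m t s → ∀ a, t ≤ a → a ≤ s → ∀ u : ℝ≥0, (m : ℝ≥0) ≤ u →
        u ≤ m + 1 → f (a, u) ∈ X.star A ((V t).vert (m + 1)) := by
  have hP : ∀ m t s, F.IsHorizontalEdge m t s →
      X.IsWalk ((V t).vert m) (P m t s) ((V s).vert m) := fun m t s h => (hlow m t s h).isWalk
  choose h hh using fun m => exists_isLevelMap (hP m)
  let ι := {e : ℕ × I × I // F.IsHorizontalEdge e.1 e.2.1 e.2.2}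
  choose φ hφc hφh hφv hφs using fun e : ι => exists_rectangle_fill hA hRA e.2 (hh _) (hh _)
    (hP _) (hlow _ _ _ e.2) (fun t' s' => hupp _ _ _ t' s' e.2)
  let S : ι → Set (I × ℝ≥0) := fun e => Icc e.1.2.1 e.1.2.2 ×ˢ Icc (e.1.1 : ℝ≥0) (e.1.1 + 1)
  have hmono := monotone_nat_of_le_succ F.mono
  have hSfin : LocallyFinite S := by
    rintro ⟨a, u⟩
    let M := ⌊u⌋₊ + 1
    refine ⟨univ ×ˢ Iio (M : ℝ≥0), prod_mem_nhds Filter.univ_mem (Iio_mem_nhds ?_), ?_⟩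
    · exact_mod_cast Nat.lt_floor_add_one u
    · refine (((finite_Iio M).prod ((F.level M).finite_toSet.prod
        (F.level M).finite_toSet)).preimage Subtype.val_injective.injOn).subset ?_
      rintro ⟨⟨m, t, s⟩, e⟩ ⟨⟨b, v⟩, ⟨-, hv⟩, -, hv'⟩
      have hm : m < M := by exact_mod_cast hv.1.trans_lt hv'
      exact ⟨hm, hmono hm.le e.1, hmono hm.le e.2.1⟩
  have hScov : ∀ z, ∃ e, z ∈ S e := by
    rintro ⟨a, u⟩
    obtain ⟨t, s, hts, h1, h2⟩ := F.exists_isHorizontalEdge_mem ⌊u⌋₊ a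
    exact ⟨⟨(⌊u⌋₊, t, s), hts⟩, ⟨h1, h2⟩, Nat.floor_le zero_le, (Nat.lt_floor_add_one u).le⟩
  -- Rectangles of different heights meet, if at all, in a horizontal segment.
  have hupper : ∀ (e e' : ι) (z : I × ℝ≥0), z ∈ S e → z ∈ S e' → e.1.1 < e'.1.1 →
      φ e z = φ e' z := by
    rintro ⟨⟨m, t, s⟩, e⟩ ⟨⟨m', t', s'⟩, e'⟩ ⟨a, u⟩ ⟨⟨h1, h2⟩, h3, h4⟩ ⟨⟨h1', h2'⟩, h3', h4'⟩ hm
    dsimp only at h1 h2 h3 h4 h1' h2' h3' h4' hm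
    have h5 : m' ≤ m + 1 := by exact_mod_cast h3'.trans h4
    obtain rfl : m' = m + 1 := le_antisymm h5 hm
    push_cast at h3'
    obtain rfl : u = m + 1 := le_antisymm h4 h3'
    have h6 := (hφh ⟨⟨m + 1, t', s'⟩, e'⟩ a h1' h2').1
    push_cast at h6
    exact (hφh ⟨⟨m, t, s⟩, e⟩ a h1 h2).2.trans h6.symm
  have heq : ∀ (e e' : ι) (z : I × ℝ≥0), z ∈ S e → z ∈ S e' → φ e z = φ e' z := by
    intro e e' z he he'
    rcases lt_trichotomy e.1.1 e'.1.1 with hm | hm | hm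
    · exact hupper e e' z he he' hm
    · obtain ⟨⟨m, t, s⟩, e⟩ := e
      obtain ⟨⟨m', t', s'⟩, e'⟩ := e'
      obtain ⟨a, u⟩ := z
      obtain ⟨⟨h1, h2⟩, h3, h4⟩ := he
      obtain ⟨⟨h1', h2'⟩, h3', h4'⟩ := he'
      dsimp only at h1 h2 h3 h4 h1' h2' h3' h4' hm
      subst hm
      rcases e.eq_or_eq e' h1 h2 h1' h2' with ⟨h5, h6⟩ | ⟨h5, h6⟩ | ⟨h5, h6⟩
      · subst h5 h6
        rfl
      · subst h5 h6
        exact (hφv ⟨⟨m, t, a⟩, e⟩ u h3 h4).2.trans (hφv ⟨⟨m, a, s'⟩, e'⟩ u h3 h4).1.symm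
      · subst h5 h6
        exact (hφv ⟨⟨m, a, s⟩, e⟩ u h3 h4).1.trans (hφv ⟨⟨m, t', a⟩, e'⟩ u h3 h4).2.symm
    · exact (hupper e' e z he' he hm).symm
  obtain ⟨f, hf, hfφ⟩ := hSfin.exists_glue (fun e => isClosed_Icc.prod isClosed_Icc) hScov φ
    (fun e => (hφc e).continuousOn) heq
  refine ⟨f, hf, fun m t ht u hu => ?_, fun m t s hts a h1 h2 => ?_,
    fun m t s hts a h1 h2 u h3 h4 => ?_⟩
  · have ht' : t ∈ F.level ⌊u⌋₊ := hmono (Nat.le_floor hu) ht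
    obtain ⟨t', s', hts, h1, h2⟩ := F.exists_isHorizontalEdge_mem ⌊u⌋₊ t
    have h3 : (⌊u⌋₊ : ℝ≥0) ≤ u := Nat.floor_le zero_le
    have h4 : u ≤ ⌊u⌋₊ + 1 := (Nat.lt_floor_add_one u).le
    rw [hfφ ⟨⟨_, t', s'⟩, hts⟩ (t, u) ⟨⟨h1, h2⟩, h3, h4⟩]
    rcases hts.eq_of_mem_level ht' h1 h2 with rfl | rfl
    exacts [(hφv ⟨⟨_, t, s'⟩, hts⟩ u h3 h4).1, (hφv ⟨⟨_, t', t⟩, hts⟩ u h3 h4).2]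
  · rw [hfφ ⟨⟨m, t, s⟩, hts⟩ (a, m) ⟨⟨h1, h2⟩, le_rfl, by simp⟩]
    exact (hφh ⟨⟨m, t, s⟩, hts⟩ a h1 h2).1.trans ((hh m).2 t s hts a h1 h2)
  · rw [hfφ ⟨⟨m, t, s⟩, hts⟩ (a, u) ⟨⟨h1, h2⟩, h3, h4⟩]
    exact hφs ⟨⟨m, t, s⟩, hts⟩ _

end TwoComplex

/-! ### Complementary components of a filter -/

namespace StripFilter

variable {F : StripFilter} {m : ℕ} {t s : I}

theorem IsHorizontalEdge.isPreconnected (_ : F.IsHorizontalEdge m t s) :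
    IsPreconnected (Ioo t s ×ˢ Ioo (m : ℝ≥0) (m + 1)) := by
  refine IsPreconnected.prod ?_ isPreconnected_Ioo
  exact isPreconnected_Ioo

theorem IsHorizontalEdge.closure_eq (h : F.IsHorizontalEdge m t s) :
    closure (Ioo t s ×ˢ Ioo (m : ℝ≥0) (m + 1)) = Icc t s ×ˢ Icc (m : ℝ≥0) (m + 1) := by
  rw [closure_prod_eq, closure_Ioo h.2.2.1.ne, closure_Ioo (by simp)]

theorem IsHorizontalEdge.boundary_cases {z : I × ℝ≥0}
    (hz : z ∈ Icc t s ×ˢ Icc (m : ℝ≥0) (m + 1)) (hz' : z ∉ Ioo t s ×ˢ Ioo (m : ℝ≥0) (m + 1)) :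
    z.1 = t ∨ z.1 = s ∨ z.2 = m ∨ z.2 = m + 1 := by
  by_contra! h
  obtain ⟨⟨h1, h2⟩, h3, h4⟩ := hz
  exact hz' ⟨⟨lt_of_le_of_ne h1 h.1.symm, lt_of_le_of_ne h2 h.2.1⟩,
    lt_of_le_of_ne h3 h.2.2.1.symm, lt_of_le_of_ne h4 h.2.2.2⟩

/-- The boundary of a rectangle over a horizontal edge belongs to the filter; the upper side may consist
of several horizontal edges. -/
theorem IsHorizontalEdge.mem_carrier (h : F.IsHorizontalEdge m t s) {z : I × ℝ≥0}
    (hz : z ∈ Icc t s ×ˢ Icc (m : ℝ≥0) (m + 1)) (hz' : z ∉ Ioo t s ×ˢ Ioo (m : ℝ≥0) (m + 1)) :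
    z ∈ F.carrier := by
  rcases IsHorizontalEdge.boundary_cases hz hz' with h1 | h1 | h1 | h1
  · exact Or.inl ⟨m, t, h.1, h1, hz.2.1, hz.2.2⟩
  · exact Or.inl ⟨m, s, h.2.1, h1, hz.2.1, hz.2.2⟩
  · exact Or.inr ⟨m, t, s, h, h1, hz.1.1, hz.1.2⟩
  · obtain ⟨t', s', h', h2, h3⟩ := F.exists_isHorizontalEdge_mem (m + 1) z.1
    exact Or.inr ⟨m + 1, t', s', h', by rw [h1]; push_cast; rfl, h2, h3⟩

theorem IsHorizontalEdge.subset_compl (h : F.IsHorizontalEdge m t s) :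
    Ioo t s ×ˢ Ioo (m : ℝ≥0) (m + 1) ⊆ F.carrierᶜ := by
  rintro ⟨b, v⟩ ⟨⟨h1, h2⟩, h3, h4⟩ (⟨m', t', ht', hb, h5, h6⟩ | ⟨m', t', s', -, hv, -⟩)
  · dsimp only at h1 h2 h3 h4 hb h5 h6
    subst hb
    have hm : m' < m + 1 := by exact_mod_cast h5.trans_lt h4
    rcases h.2.2.2 b (monotone_nat_of_le_succ F.mono (Nat.lt_succ_iff.1 hm) ht') with h7 | h7
    · exact absurd h1 h7.not_gt
    · exact absurd h2 h7.not_gt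
  · dsimp only at h3 h4 hv
    subst hv
    have h5 : m < m' := by exact_mod_cast h3
    have h6 : m' < m + 1 := by exact_mod_cast h4
    omega

/-- The complementary components of a filter are open rectangles. -/
theorem IsRectangle.exists_eq {R : Set (I × ℝ≥0)} (hR : F.IsRectangle R) :
    ∃ m t s, F.IsHorizontalEdge m t s ∧ R = Ioo t s ×ˢ Ioo (m : ℝ≥0) (m + 1) := by
  obtain ⟨⟨a, u⟩, hz, rfl⟩ := hR
  obtain ⟨t, s, h, h1, h2⟩ := F.exists_isHorizontalEdge_mem ⌊u⌋₊ a
  have hzQ : (a, u) ∈ Ioo t s ×ˢ Ioo (⌊u⌋₊ : ℝ≥0) (⌊u⌋₊ + 1) := by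
    by_contra h3
    exact hz (h.mem_carrier ⟨⟨h1, h2⟩, Nat.floor_le zero_le, (Nat.lt_floor_add_one u).le⟩ h3)
  refine ⟨⌊u⌋₊, t, s, h, Subset.antisymm ?_ (h.isPreconnected.subset_connectedComponentIn hzQ
    h.subset_compl)⟩
  refine isPreconnected_connectedComponentIn.subset_of_closure_inter_subset
    (isOpen_Ioo.prod isOpen_Ioo) ⟨_, mem_connectedComponentIn hz, hzQ⟩ ?_
  rintro z ⟨hz1, hz2⟩
  rw [h.closure_eq] at hz1
  by_contra h3
  exact connectedComponentIn_subset _ _ hz2 (h.mem_carrier hz1 h3)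

theorem IsHorizontalEdge.isUpperLeft (h : F.IsHorizontalEdge m t s) :
    F.IsUpperLeft (Ioo t s ×ˢ Ioo (m : ℝ≥0) (m + 1)) t (m + 1) := by
  rw [IsUpperLeft, h.closure_eq]
  push_cast
  exact ⟨F.mono m h.1, ⟨⟨le_rfl, h.2.2.1.le⟩, by simp, le_rfl⟩, fun z hz => ⟨hz.1.1, hz.2.2⟩⟩

theorem IsHorizontalEdge.frontier_subset (h : F.IsHorizontalEdge m t s) {z : I × ℝ≥0}
    (hz : z ∈ frontier (Ioo t s ×ˢ Ioo (m : ℝ≥0) (m + 1))) :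
    z ∈ Icc t s ×ˢ Icc (m : ℝ≥0) (m + 1) ∧ (z.1 = t ∨ z.1 = s ∨ z.2 = m ∨ z.2 = m + 1) := by
  rw [(isOpen_Ioo.prod isOpen_Ioo).frontier_eq, h.closure_eq] at hz
  exact ⟨hz.1, boundary_cases hz.1 hz.2⟩

end StripFilter

namespace TwoComplex

variable {X : TwoComplex.{u}} {F : StripFilter} {V : I → X.EdgeRay} {P : ℕ → I → I → List X.D}
  {R : ℕ}

theorem walkPt_mem_ball {w x y : X.V} {p : List X.D} (h : X.IsWalkIn (X.cball R w) x p y) (t : ℝ) :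
    X.walkPt x p t ∈ X.ball R w := by
  induction p generalizing x t with
  | nil => exact Or.inl ⟨x, h.1, rfl⟩
  | cons d p ih =>
    rw [walkPt_cons]
    split_ifs
    · exact Or.inr ⟨d, _, h.1 ▸ h.2.1, h.2.2.left_mem, rfl⟩
    · exact ih h.2.2 _

theorem rayPt_mem_ball {w : X.V} {r : X.EdgeRay} {m : ℕ} (h : r.vert m ∈ X.cball R w)
    (h' : r.vert (m + 1) ∈ X.cball R w) {u : ℝ≥0} (h1 : (m : ℝ≥0) ≤ u) (h2 : u ≤ m + 1) :
    X.rayPt r u ∈ X.ball R w := by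
  rw [rayPt_of_mem r h1 h2]
  exact Or.inr ⟨_, _, h, (r.tgt_dart m).symm ▸ h', rfl⟩

/-- A map of the strip as in `exists_strip_fill` takes the boundary of each rectangle to a ball about
the image of the upper left vertex. -/
theorem mem_ball_of_mem_frontier {f : I × ℝ≥0 → X.Space}
    (hv : ∀ m, ∀ t ∈ F.level m, ∀ u : ℝ≥0, (m : ℝ≥0) ≤ u → f (t, u) = X.rayPt (V t) u)
    (hh : ∀ m t s, F.IsHorizontalEdge m t s → ∀ a, t ≤ a → a ≤ s → f (a, (m : ℝ≥0)) =
        X.walkPt ((V t).vert m) (P m t s) (((a : ℝ) - t) / ((s : ℝ) - t) * (P m t s).length))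
    {m : ℕ} {t s : I} (hts : F.IsHorizontalEdge m t s)
    (hlow : X.IsWalkIn (X.cball R ((V t).vert (m + 1))) ((V t).vert m) (P m t s) ((V s).vert m))
    (hupp : ∀ t' s', F.IsHorizontalEdge (m + 1) t' s' →
      t ≤ t' → s' ≤ s → X.IsWalkIn (X.cball R ((V t).vert (m + 1))) ((V t').vert (m + 1))
        (P (m + 1) t' s') ((V s').vert (m + 1)))
    {z : I × ℝ≥0} (hz : z ∈ frontier (Ioo t s ×ˢ Ioo (m : ℝ≥0) (m + 1))) :
    f z ∈ X.ball R ((V t).vert (m + 1)) := by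
  obtain ⟨⟨⟨h1, h2⟩, h3, h4⟩, hz⟩ := hts.frontier_subset hz
  obtain ⟨a, u⟩ := z
  dsimp only at h1 h2 h3 h4 hz
  have hw : (V t).vert (m + 1) ∈ X.cball R ((V t).vert (m + 1)) := by
    change X.dist _ _ ≤ R
    rw [DartGraph.dist_self]
    exact Nat.zero_le _
  rcases hz with rfl | rfl | rfl | rfl
  · rw [hv m a hts.1 u h3]
    exact rayPt_mem_ball hlow.left_mem hw h3 h4
  · rw [hv m a hts.2.1 u h3]
    obtain ⟨t', s', h, h5, -, h6, h7⟩ := F.exists_isHorizontalEdge' (F.mono m hts.1)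
      (F.mono m hts.2.1) hts.2.2.1 le_rfl
    obtain rfl := le_antisymm h7 h6
    exact rayPt_mem_ball hlow.right_mem (hupp _ _ h h5 le_rfl).right_mem h3 h4
  · rw [hh m t s hts a h1 h2]
    exact walkPt_mem_ball hlow _
  · rcases h2.lt_or_eq with h5 | rfl
    · obtain ⟨t', s', h, h6, h7, h8, h9⟩ := F.exists_isHorizontalEdge (F.mono m hts.1)
        (F.mono m hts.2.1) h1 h5
      have := hh (m + 1) t' s' h a h7 h8.le
      push_cast at this
      rw [this]
      exact walkPt_mem_ball (hupp _ _ h h6 h9) _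
    · obtain ⟨t', s', h, h6, h7, h8, h9⟩ := F.exists_isHorizontalEdge' (F.mono m hts.1)
        (F.mono m hts.2.1) hts.2.2.1 le_rfl
      have := hh (m + 1) t' s' h a h7.le h8
      push_cast at this
      rw [this]
      exact walkPt_mem_ball (hupp _ _ h h6 h9) _

end TwoComplex

/-! ### Fine filters -/

namespace StripFilter

/-- The points dividing `[1/4, 3/4]` into `M` segments of equal length. -/
noncomputable def net (M : ℕ) : Finset I :=
  (Finset.range (M + 1)).image fun j : ℕ => projIcc 0 1 zero_le_one (1 / 4 + (j : ℝ) / (2 * M))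

theorem coe_net {M j : ℕ} (hM : 0 < M) (hj : j ≤ M) :
    ((projIcc 0 1 zero_le_one (1 / 4 + (j : ℝ) / (2 * M)) : I) : ℝ) = 1 / 4 + (j : ℝ) / (2 * M) ∧
      (1 / 4 + (j : ℝ) / (2 * M)) ∈ Icc (1 / 4 : ℝ) (3 / 4) := by
  have hM' : (0 : ℝ) < M := by exact_mod_cast hM
  have hj' : (j : ℝ) ≤ M := by exact_mod_cast hj
  have h1 : 0 ≤ (j : ℝ) / (2 * M) := by positivity
  have h2 : (j : ℝ) / (2 * M) ≤ 1 / 2 := by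
    rw [div_le_div_iff₀ (by linarith) (by norm_num)]
    linarith
  rw [projIcc_of_mem _ (show (1 / 4 + (j : ℝ) / (2 * M)) ∈ Icc (0 : ℝ) 1 from
    ⟨by linarith, by linarith⟩)]
  exact ⟨rfl, by linarith, by linarith⟩

theorem exists_mem_net {M : ℕ} (hM : 0 < M) {t : I} (h1 : 1 / 4 ≤ (t : ℝ)) (h2 : (t : ℝ) < 3 / 4) :
    ∃ x ∈ net M, t < x ∧ (x : ℝ) - t ≤ 1 / (2 * M) := by
  have hM' : (0 : ℝ) < 2 * M := by
    have : (0 : ℝ) < M := by exact_mod_cast hM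
    linarith
  have h0 : 0 ≤ 2 * M * ((t : ℝ) - 1 / 4) := mul_nonneg hM'.le (by linarith)
  have h3 := Nat.floor_le h0
  have h4 := Nat.lt_floor_add_one (2 * M * ((t : ℝ) - 1 / 4))
  set j := ⌊2 * M * ((t : ℝ) - 1 / 4)⌋₊
  have hj : j + 1 ≤ M := by
    have : (j : ℝ) < M := h3.trans_lt (by nlinarith)
    exact_mod_cast this
  obtain ⟨h5, -⟩ := coe_net hM hj
  refine ⟨_, Finset.mem_image.2 ⟨j + 1, by simpa using hj, rfl⟩, Subtype.coe_lt_coe.1 ?_, ?_⟩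
  · rw [h5, ← sub_lt_iff_lt_add', lt_div_iff₀ hM']
    push_cast
    linarith
  · rw [h5, show (1 : ℝ) / 4 + ((j + 1 : ℕ) : ℝ) / (2 * M) - t =
      (((j + 1 : ℕ) : ℝ) / (2 * M)) - ((t : ℝ) - 1 / 4) by ring, sub_le_iff_le_add,
      ← sub_le_iff_le_add', ← sub_div, div_le_iff₀ hM']
    push_cast
    linarith

/-- There are filters whose meshes in `[1/4, 3/4]` are as small as desired, and that have no
vertices over `(0, 1/4)` and `(3/4, 1)`. -/
theorem exists_fine {ε : ℕ → ℝ} (hε : ∀ m, 0 < ε m) :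
    ∃ F : StripFilter, (∀ m, ∀ t ∈ F.level m, t ≠ 0 → t ≠ 1 → 1 / 4 ≤ (t : ℝ) ∧ (t : ℝ) ≤ 3 / 4) ∧
      ∀ m t s, F.IsHorizontalEdge m t s → (t = 0 ∧ (s : ℝ) = 1 / 4) ∨ ((t : ℝ) = 3 / 4 ∧ s = 1) ∨
        (1 / 4 ≤ (t : ℝ) ∧ (s : ℝ) ≤ 3 / 4 ∧ (s : ℝ) - t < ε m) := by
  choose N hN using fun m => exists_nat_one_div_lt (hε m)
  let M : ℕ → ℕ := fun m => N m + 1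
  have hM : ∀ m, 0 < M m := fun m => Nat.succ_pos _
  let F : StripFilter :=
    { level := fun m => {0, 1} ∪ (Finset.range (m + 1)).biUnion fun k => net (M k)
      zero_mem := fun m => by simp
      one_mem := fun m => by simp
      mono := fun m => Finset.union_subset_union_right
        (Finset.biUnion_subset_biUnion_of_subset_left _ (Finset.range_mono (Nat.le_succ _))) }
  have hnet : ∀ m, ∀ x ∈ net (M m), x ∈ F.level m := fun m x hx =>
    Finset.mem_union_right _ (Finset.mem_biUnion.2 ⟨m, by simp, hx⟩)
  have hlevel : ∀ m, ∀ t ∈ F.level m, t = 0 ∨ t = 1 ∨ (1 / 4 ≤ (t : ℝ) ∧ (t : ℝ) ≤ 3 / 4) := by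
    intro m t ht
    rcases Finset.mem_union.1 ht with h | h
    · rw [Finset.mem_insert, Finset.mem_singleton] at h
      tauto
    · obtain ⟨k, -, h⟩ := Finset.mem_biUnion.1 h
      obtain ⟨j, hj, rfl⟩ := Finset.mem_image.1 h
      obtain ⟨h1, h2⟩ := coe_net (hM k) (Nat.lt_succ_iff.1 (Finset.mem_range.1 hj))
      rw [h1]
      exact Or.inr (Or.inr h2)
  have hfirst : ∀ m, ∃ x ∈ F.level m, (x : ℝ) = 1 / 4 := fun m =>
    ⟨_, hnet m _ (Finset.mem_image.2 ⟨0, by simp, rfl⟩), by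
      rw [(coe_net (hM m) (Nat.zero_le _)).1]; simp⟩
  have hlast : ∀ m, ∃ x ∈ F.level m, (x : ℝ) = 3 / 4 := fun m =>
    ⟨_, hnet m _ (Finset.mem_image.2 ⟨M m, by simp, rfl⟩), by
      have : (0 : ℝ) < M m := by exact_mod_cast hM m
      rw [(coe_net (hM m) le_rfl).1]
      field_simp
      norm_num⟩
  refine ⟨F, fun m t ht h0 h1 => by have := hlevel m t ht; tauto, fun m t s h => ?_⟩
  have hts := h.cast_lt
  rcases hlevel m t h.1 with ht | rfl | ⟨h1, h2⟩
  · left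
    refine ⟨ht, ?_⟩
    obtain ⟨x, hx, hx'⟩ := hfirst m
    rcases h.2.2.2 x hx with h3 | h3
    · have : (x : ℝ) ≤ t := h3
      rw [hx', ht, Icc.coe_zero] at this
      linarith
    · have h3' : (s : ℝ) ≤ x := h3
      rcases hlevel m s h.2.1 with rfl | rfl | ⟨h4, -⟩
      · rw [ht] at hts
        exact absurd hts (lt_irrefl _)
      · rw [hx', Icc.coe_one] at h3'
        linarith
      · linarith
  · exact absurd hts s.2.2.not_gt
  · right
    rcases h2.eq_or_lt with h3 | h3
    · left
      refine ⟨h3, ?_⟩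
      rcases hlevel m s h.2.1 with rfl | hs | ⟨-, h4⟩
      · rw [Icc.coe_zero] at hts
        linarith
      · exact hs
      · linarith
    · right
      refine ⟨h1, ?_, ?_⟩
      · obtain ⟨x, hx, hx'⟩ := hlast m
        rcases h.2.2.2 x hx with h4 | h4
        · have : (x : ℝ) ≤ t := h4
          linarith
        · have : (s : ℝ) ≤ x := h4
          linarith
      · obtain ⟨x, hx, hx1, hx2⟩ := exists_mem_net (hM m) h1 h3
        rcases h.2.2.2 x (hnet m x hx) with h4 | h4
        · exact absurd hx1 h4.not_gt
        · have h4' : (s : ℝ) ≤ x := h4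
          have h5 : (1 : ℝ) / (2 * M m) ≤ 1 / (N m + 1) := by
            have : (0 : ℝ) ≤ N m := Nat.cast_nonneg _
            refine one_div_le_one_div_of_le (by linarith) ?_
            simp only [M]
            push_cast
            linarith
          linarith [hN m]

end StripFilter

/-! ### Tracking along the sides of the strip -/

namespace DartGraph

variable {Γ : DartGraph.{u}} {x : Γ.V}

theorem EdgeRay.dist_le (hc : Γ.toSimple.Connected) (r : Γ.EdgeRay) {i j : ℕ} (hij : i ≤ j) :
    Γ.dist (r.vert i) (r.vert j) ≤ j - i := by
  induction j, hij using Nat.le_induction with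
  | base => rw [dist_self]; exact Nat.zero_le _
  | succ j hij ih =>
    have h1 := dist_triangle hc (r.vert i) (r.vert j) (r.vert (j + 1))
    have h2 := dist_src_tgt (r.dart j)
    rw [r.tgt_dart] at h2
    change Γ.dist (r.vert j) (r.vert (j + 1)) ≤ 1 at h2
    omega

theorem IsGeodSeg.length_eq {q : ℕ → Γ.V} {l : ℕ} {y z : Γ.V} (h : Γ.IsGeodSeg q l y z) :
    Γ.dist y z = l := by
  have := h.2.2 0 l (Nat.zero_le _) le_rfl
  rwa [h.1, h.2.1] at this

/-- A geodesic to a point of a ray `s'` that stays `K`-close to a geodesic ray tracks `s'`. -/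
theorem GeodRay.dist_le_of_isGeodSeg {δ K : ℕ} (hthin : Γ.IsThin δ) (hc : Γ.toSimple.Connected)
    (s : Γ.GeodRay x) {s' : Γ.EdgeRay} (hs : ∀ k, Γ.dist (s.vert k) (s'.vert k) ≤ K) {q : ℕ → Γ.V}
    {l m : ℕ} (hq : Γ.IsGeodSeg q l x (s'.vert m)) (i : ℕ) :
    Γ.dist (q (min i l)) (s'.vert (min i m)) ≤ K + δ := by
  have hl := hq.length_eq
  have hm := s.dist_start m
  have h1 := dist_triangle hc x (s.vert m) (s'.vert m)
  have h2 := dist_triangle hc x (s'.vert m) (s.vert m)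
  have h3 := hs m
  rw [dist_comm (s'.vert m)] at h2
  -- The way round through the common end point `s' m`.
  have hend := dist_triangle hc (q (min i l)) (s'.vert m) (s'.vert (min i m))
  have h4 := hq.2.2 (min i l) l (min_le_right _ _) le_rfl
  rw [hq.2.1] at h4
  have h5 := s'.dist_le hc (min_le_right i m)
  rw [dist_comm] at h5
  -- Thinness of the triangle on `∗`, `s m`, `s' m` applies up to the comparison point of the corner
  -- `∗`; beyond it both points are close to `s' m`.
  by_cases h : i ≤ l ∧ i ≤ m ∧ 2 * i + K ≤ m + l
  · obtain ⟨h6, h7, h8⟩ := h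
    rw [min_eq_left h6, min_eq_left h7]
    have h9 := hthin x _ _ q s.vert l m hq (s.isGeodSeg m) i
      (by rw [dist_comm (s'.vert m)]; omega)
    have h10 := dist_triangle hc (q i) (s.vert i) (s'.vert i)
    have := hs i
    omega
  · omega

end DartGraph

namespace TwoComplex

variable {X : TwoComplex.{u}}

theorem star_subset (hc : X.toSimple.Connected) {k n m : ℕ} {v w : X.V} (h : X.dist v w ≤ k)
    (hk : k + n ≤ m) : X.star n w ⊆ X.star m v := by
  rw [star_eq_sub, star_eq_sub]
  exact sub_mono (DartGraph.cball_subset hc h hk)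

theorem vertexPt_mem_star {n : ℕ} {v x : X.V} (h : X.dist v x ≤ n) : X.vertexPt x ∈ X.star n v := by
  rw [star_eq_sub]
  exact vertexPt_mem_sub h

theorem rayPt_mem_star (hc : X.toSimple.Connected) (r : X.EdgeRay) {u : ℝ≥0} {n : ℕ} {v : X.V}
    (h : X.dist v (r.vert ⌈u⌉₊) + 1 ≤ n) : X.rayPt r u ∈ X.star n v := by
  rcases Nat.eq_zero_or_pos ⌈u⌉₊ with h0 | h0
  · have hu : u = 0 := le_antisymm (Nat.ceil_eq_zero.1 h0) zero_le
    rw [h0] at h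
    have := rayPt_natCast r 0
    rw [Nat.cast_zero] at this
    rw [hu, this]
    exact vertexPt_mem_star (by omega)
  · obtain ⟨j, hj⟩ := Nat.exists_eq_succ_of_ne_zero h0.ne'
    rw [hj] at h
    have h1 : (j : ℝ≥0) ≤ u := (Nat.lt_ceil.1 (by omega)).le
    have h2 : u ≤ j + 1 := by
      have := Nat.le_ceil u
      rw [hj] at this
      exact_mod_cast this
    have h3 := DartGraph.dist_triangle hc v (r.vert (j + 1)) (r.vert j)
    have h4 := r.dist_le hc (Nat.le_succ j)
    rw [DartGraph.dist_comm] at h4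
    change X.dist v (r.vert (j + 1)) + 1 ≤ n at h
    change X.dist (r.vert (j + 1)) (r.vert j) ≤ _ at h4
    exact Or.inl (rayPt_mem_ball (show X.dist _ _ ≤ n by omega) (show X.dist _ _ ≤ n by omega) h1 h2)

/-- The loop that runs out to distance `R` and back shows that a filling radius for `R` cannot be
smaller than `R`. -/
theorem IsFillingRadius.le {R A : ℕ} (hA : X.IsFillingRadius R A) (hc : X.toSimple.Connected)
    {x y : X.V} (h : X.dist x y = R) : R ≤ A := by
  obtain ⟨p, hp, hlen⟩ := DartGraph.exists_geodesic hc x y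
  have hp' : X.IsWalkIn (X.cball R x) x p y :=
    hp.isWalkIn_cball hc (k := 0) (by rw [DartGraph.dist_self]) (by rw [hlen, zero_add]; exact h.le)
  obtain ⟨y', h1, -⟩ := (hA.homot_nil (hp'.append hp'.rev)).left.of_append
  obtain rfl := h1.right_unique hp'
  exact h ▸ h1.right_mem

end TwoComplex

namespace DartGraph

variable {Γ : DartGraph.{u}} {x : Γ.V}

/-! ### Rays along a path in the boundary -/

/-- Geodesic rays along a path `γ` of the boundary, with prescribed ends, and a filter such that rays
over the same horizontal edge of height `m` are `δ`-close up to time `m + 1`. Representatives of the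
same boundary point are `δ`-close for ever, hence the path is run through over `[1/4, 3/4]`, where
the filter is fine, and is constant over the outer horizontal edges. -/
theorem exists_rays {δ : ℕ} (hthin : Γ.IsThin δ) (hc : Γ.toSimple.Connected)
    (hlf : ∀ v, {d | Γ.src d = v}.Finite) (s₁ s₂ : Γ.GeodRay x)
    (γ : Path s₁.toBoundary s₂.toBoundary) :
    ∃ (F : StripFilter) (r : I → Γ.GeodRay x), r 0 = s₁ ∧ r 1 = s₂ ∧
      (∀ a, (r a).toBoundary ∈ range γ) ∧
      (∀ m, ∀ t ∈ F.level m, t ≠ 0 → t ≠ 1 → 1 / 4 ≤ (t : ℝ) ∧ (t : ℝ) ≤ 3 / 4) ∧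
      (∀ m t s, F.IsHorizontalEdge m t s → (t = 0 ∧ (s : ℝ) = 1 / 4) ∨ ((t : ℝ) = 3 / 4 ∧ s = 1) ∨
        (1 / 4 ≤ (t : ℝ) ∧ (s : ℝ) ≤ 3 / 4)) ∧
      ∀ m t s, F.IsHorizontalEdge m t s → ∀ a b, t ≤ a → a ≤ s → t ≤ b → b ≤ s → ∀ k ≤ m + 1,
        Γ.dist ((r a).vert k) ((r b).vert k) ≤ δ := by
  classical
  let γ' : I → Γ.Boundary x := fun a => γ (projIcc 0 1 zero_le_one (2 * (a : ℝ) - 1 / 2))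
  have hγ' : Continuous γ' := γ.continuous.comp (continuous_projIcc.comp (by fun_prop))
  have hγl : ∀ a : I, (a : ℝ) ≤ 1 / 4 → γ' a = s₁.toBoundary := fun a ha => by
    change γ (projIcc 0 1 zero_le_one (2 * (a : ℝ) - 1 / 2)) = _
    rw [projIcc_of_le_left _ (by linarith)]
    exact γ.source
  have hγr : ∀ a : I, 3 / 4 ≤ (a : ℝ) → γ' a = s₂.toBoundary := fun a ha => by
    change γ (projIcc 0 1 zero_le_one (2 * (a : ℝ) - 1 / 2)) = _
    rw [projIcc_of_right_le _ (by linarith)]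
    exact γ.target
  have hex : ∀ a, ∃ r : Γ.GeodRay x, r.toBoundary = γ' a ∧ (a = 0 → r = s₁) ∧ (a = 1 → r = s₂) := by
    intro a
    by_cases h0 : a = 0
    · subst h0
      exact ⟨s₁, (hγl 0 (by simp)).symm, fun _ => rfl, fun h => absurd h zero_ne_one⟩
    · by_cases h1 : a = 1
      · subst h1
        exact ⟨s₂, (hγr 1 (by norm_num)).symm, fun h => absurd h one_ne_zero, fun _ => rfl⟩
      · obtain ⟨r, hr⟩ := Quotient.exists_rep (γ' a)
        exact ⟨r, hr, fun h => absurd h h0, fun h => absurd h h1⟩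
  choose r hr hr0 hr1 using hex
  choose ε hε hclose using fun m => exists_forall_dist_le hthin hc hlf hγ' r hr (m + 1)
  obtain ⟨F, hF, hF'⟩ := StripFilter.exists_fine hε
  refine ⟨F, r, hr0 0 rfl, hr1 1 rfl, fun a => ⟨_, (hr a).symm⟩, hF, fun m t s h => ?_,
    fun m t s h a b h1 h2 h3 h4 k hk => ?_⟩
  · have := hF' m t s h
    tauto
  · have h1' : (t : ℝ) ≤ a := h1
    have h2' : (a : ℝ) ≤ s := h2
    have h3' : (t : ℝ) ≤ b := h3
    have h4' : (b : ℝ) ≤ s := h4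
    rcases hF' m t s h with ⟨-, hs⟩ | ⟨ht, -⟩ | ⟨-, -, hd⟩
    · refine GeodRay.dist_le_of_toBoundary_eq hthin ?_ k
      rw [hr, hr, hγl a (by linarith), hγl b (by linarith)]
    · refine GeodRay.dist_le_of_toBoundary_eq hthin ?_ k
      rw [hr, hr, hγr a (by linarith), hγr b (by linarith)]
    · refine hclose m a b ?_ k hk
      rw [Subtype.dist_eq, Real.dist_eq, abs_lt]
      constructor <;> linarith

end DartGraph

namespace TwoComplex

variable {X : TwoComplex.{u}} {x : X.V}

/-! ### The filter and the homotopy -/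

/-- The rays of `exists_rays`, with those over the two ends of the strip replaced by `s₁'` and `s₂'`,
are joined by geodesics along the horizontal edges, and the strip is filled rectangle by
rectangle. -/
theorem exists_filter_homotopy {δ : ℕ} (hthin : X.IsThin δ) (hc : X.toSimple.Connected)
    (hlf : ∀ v, {d | X.src d = v}.Finite) {K A : ℕ} (hK : δ ≤ K)
    (hA : X.IsFillingRadius (2 * K + δ + 1) A) (s₁ s₂ : X.GeodRay x) (s₁' s₂' : X.EdgeRay)
    (hx₁ : s₁'.vert 0 = x) (hx₂ : s₂'.vert 0 = x)
    (hs₁ : ∀ k, X.dist (s₁.vert k) (s₁'.vert k) ≤ K)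
    (hs₂ : ∀ k, X.dist (s₂.vert k) (s₂'.vert k) ≤ K)
    (γ : Path s₁.toBoundary s₂.toBoundary) :
    ∃ (F : StripFilter) (f : I × ℝ≥0 → X.Space),
      X.IsProperHomotopyRel f x s₁' s₂' ∧
      (∀ (m : ℕ), ∀ t ∈ F.level m, t ≠ 0 → t ≠ 1 →
        ∃ r : X.GeodRay x, r.toBoundary ∈ Set.range γ ∧
          ∀ u : ℝ≥0, (m : ℝ≥0) ≤ u → f (t, u) = X.rayPt r.toEdgeRay u) ∧
      (∀ (m : ℕ) (t s : I), F.IsHorizontalEdge m t s →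
        ∃ (x y : X.V) (p : List X.D), X.IsWalk x p y ∧
          p.length ≤ K + 2 * δ ∧
          ∀ a : I, t ≤ a → a ≤ s → f (a, (m : ℝ≥0)) =
            X.walkPt x p (((a : ℝ) - t) / ((s : ℝ) - t) * p.length)) ∧
      (∀ R : Set (I × ℝ≥0), F.IsRectangle R →
        ∃ (t : I) (m : ℕ) (w : X.V), F.IsUpperLeft R t m ∧
          f (t, (m : ℝ≥0)) = X.vertexPt w ∧
          (∀ z ∈ frontier R, f z ∈ X.ball (2 * K + δ + 1) w) ∧
          ∀ z ∈ R, f z ∈ X.star A w) ∧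
      (∀ (m : ℕ), ∀ t ∈ F.level m, ∃ w : X.V,
        f (t, (m : ℝ≥0)) = X.vertexPt w ∧
        ∀ (q : ℕ → X.V) (l : ℕ), X.IsGeodSeg q l x w →
          ∀ u : ℝ≥0, f (t, min u (m : ℝ≥0)) ∈
            X.star (2 * δ + A) (q (min ⌈u⌉₊ l))) := by
  classical
  obtain ⟨F, r, hr0, hr1, hrγ, hF, hF', hclose⟩ :=
    DartGraph.exists_rays hthin hc hlf s₁ s₂ γ
  have hRA : 2 * K + δ + 1 ≤ A := hA.le hc (s₁.dist_start _)
  -- The rays over the vertices of the filter: the given rays `s₁'`, `s₂'` over the two ends.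
  let V : I → X.EdgeRay := fun a => if a = 0 then s₁' else if a = 1 then s₂' else (r a).toEdgeRay
  have hV0 : V 0 = s₁' := if_pos rfl
  have hV1 : V 1 = s₂' := (if_neg one_ne_zero).trans (if_pos rfl)
  have hV : ∀ a, a ≠ 0 → a ≠ 1 → V a = (r a).toEdgeRay := fun a h0 h1 =>
    (if_neg h0).trans (if_neg h1)
  have hVr : ∀ a k, X.dist ((r a).vert k) ((V a).vert k) ≤ K := by
    intro a k
    by_cases h0 : a = 0
    · rw [h0, hr0, hV0]; exact hs₁ k
    · by_cases h1 : a = 1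
      · rw [h1, hr1, hV1]; exact hs₂ k
      · rw [hV a h0 h1, DartGraph.dist_self]; exact Nat.zero_le _
  have hVx : ∀ a, (V a).vert 0 = x := by
    intro a
    by_cases h0 : a = 0
    · rw [h0, hV0]; exact hx₁
    · by_cases h1 : a = 1
      · rw [h1, hV1]; exact hx₂
      · rw [hV a h0 h1]; exact (r a).start
  have hmid : ∀ a : I, 1 / 4 ≤ (a : ℝ) → (a : ℝ) ≤ 3 / 4 → a ≠ 0 ∧ a ≠ 1 := by
    rintro a h1 h2
    constructor
    · rintro rfl; norm_num at h1
    · rintro rfl; norm_num at h2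
  have hVmid : ∀ a b : I, ∀ k, a ≠ 0 ∧ a ≠ 1 → b ≠ 0 ∧ b ≠ 1 →
      X.dist ((r a).vert k) ((r b).vert k) ≤ δ → X.dist ((V a).vert k) ((V b).vert k) ≤ δ := by
    intro a b k ha hb h
    rw [hV a ha.1 ha.2, hV b hb.1 hb.2]
    exact h
  -- At most one end of a horizontal edge lies on the boundary of the strip.
  have hVts : ∀ m t s, F.IsHorizontalEdge m t s → ∀ k ≤ m + 1,
      X.dist ((V t).vert k) ((V s).vert k) ≤ K + δ := by
    intro m t s h k hk
    have hd := hclose m t s h t s le_rfl h.2.2.1.le h.2.2.1.le le_rfl k hk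
    rcases hF' m t s h with ⟨-, hs⟩ | ⟨ht, -⟩ | ⟨ht, hs⟩
    · obtain ⟨h0, h1⟩ := hmid s hs.ge (by rw [hs]; norm_num)
      rw [hV s h0 h1]
      have h2 := hVr t k
      have h3 := DartGraph.dist_triangle hc ((V t).vert k) ((r t).vert k) ((r s).vert k)
      rw [DartGraph.dist_comm] at h2
      exact h3.trans (add_le_add h2 hd)
    · obtain ⟨h0, h1⟩ := hmid t (by rw [ht]; norm_num) ht.le
      rw [hV t h0 h1]
      have h2 := hVr s k
      have h3 := DartGraph.dist_triangle hc ((r t).vert k) ((r s).vert k) ((V s).vert k)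
      exact h3.trans ((add_le_add hd h2).trans (by omega))
    · have hts := h.cast_lt
      exact (hVmid t s k (hmid t ht (by linarith)) (hmid s (by linarith) hs) hd).trans (by omega)
  choose P hPw hPl using fun (m : ℕ) (t s : I) =>
    DartGraph.exists_geodesic hc ((V t).vert m) ((V s).vert m)
  have hlow : ∀ m t s, F.IsHorizontalEdge m t s →
      X.IsWalkIn (X.cball (2 * K + δ + 1) ((V t).vert (m + 1))) ((V t).vert m) (P m t s)
        ((V s).vert m) := by
    intro m t s h
    have h1 := (V t).dist_le hc (Nat.le_succ m)
    rw [DartGraph.dist_comm] at h1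
    refine (hPw m t s).isWalkIn_cball hc (k := 1) (h1.trans (by omega)) ?_
    have h2 := hVts m t s h m (Nat.le_succ m)
    rw [hPl]
    change 1 + X.dist _ _ ≤ _
    omega
  have hupp : ∀ m t s t' s', F.IsHorizontalEdge m t s → F.IsHorizontalEdge (m + 1) t' s' →
      t ≤ t' → s' ≤ s → X.IsWalkIn (X.cball (2 * K + δ + 1) ((V t).vert (m + 1)))
        ((V t').vert (m + 1)) (P (m + 1) t' s') ((V s').vert (m + 1)) := by
    intro m t s t' s' h h' htt' hss'
    have h1 := hVts (m + 1) t' s' h' (m + 1) (Nat.le_succ _)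
    have h2 := hclose m t s h t t' le_rfl h.2.2.1.le htt' (h'.2.2.1.le.trans hss') (m + 1) le_rfl
    have h3 := hclose m t s h t' s' htt' (h'.2.2.1.le.trans hss') (htt'.trans h'.2.2.1.le) hss'
      (m + 1) le_rfl
    have htt'' : (t : ℝ) ≤ t' := htt'
    have hss'' : (s' : ℝ) ≤ s := hss'
    have hts := h'.cast_lt
    -- The outermost rectangles are not subdivided.
    have hcase : t = t' ∨ (1 / 4 ≤ (t : ℝ) ∧ (s : ℝ) ≤ 3 / 4) := by
      rcases hF' m t s h with ⟨ht, hs⟩ | ⟨ht, hs⟩ | h4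
      · left
        rcases hF' (m + 1) t' s' h' with ⟨ht', -⟩ | ⟨ht', -⟩ | ⟨ht', -⟩
        · rw [ht, ht']
        · linarith
        · linarith
      · left
        rcases hF' (m + 1) t' s' h' with ⟨ht', -⟩ | ⟨ht', -⟩ | ⟨-, hs'⟩
        · rw [ht', Icc.coe_zero] at htt''; linarith
        · exact Subtype.ext (ht.trans ht'.symm)
        · linarith
      · exact Or.inr h4
    rcases hcase with rfl | ⟨h4, h5⟩
    · refine (hPw (m + 1) t s').isWalkIn_cball hc (k := 0)
        (by rw [DartGraph.dist_self]) ?_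
      rw [hPl]
      omega
    · refine (hPw (m + 1) t' s').isWalkIn_cball hc (k := δ)
        (hVmid t t' _ (hmid t h4 (by linarith)) (hmid t' (by linarith) (by linarith)) h2) ?_
      have h6 := hVmid t' s' _ (hmid t' (by linarith) (by linarith))
        (hmid s' (by linarith) (by linarith)) h3
      rw [hPl]
      change δ + X.dist _ _ ≤ _
      omega
  obtain ⟨f, hf, hfv, hfh, hfs⟩ := exists_strip_fill hA hRA hlow hupp
  -- All rays start at `x`, so the geodesics of height `0` are empty.
  have hf0 : ∀ a, f (a, 0) = X.vertexPt x := by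
    intro a
    obtain ⟨t, s, hts, h1, h2⟩ := F.exists_isHorizontalEdge_mem 0 a
    have h3 := hfh 0 t s hts a h1 h2
    have h4 := hPl 0 t s
    rw [hVx t, hVx s] at h4
    have h5 : P 0 t s = [] := List.length_eq_zero_iff.1 (h4.trans (DartGraph.dist_self x))
    rw [Nat.cast_zero, h5, hVx t] at h3
    exact h3
  have hfvert : ∀ m, ∀ t ∈ F.level m, f (t, (m : ℝ≥0)) = X.vertexPt ((V t).vert m) :=
    fun m t ht => (hfv m t ht m le_rfl).trans (rayPt_natCast _ _)
  refine ⟨F, f, ⟨hf, fun C hC => ?_, fun u => ?_, fun u => ?_, hf0⟩, fun m t ht h0 h1 => ?_,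
    fun m t s h => ?_, fun R hR => ?_, fun m t ht => ⟨_, hfvert m t ht, fun q l hq u => ?_⟩⟩
  -- At height `u` the map takes values near a vertex at distance at least `u - K` from `x`.
  · refine isCompact_preimage_of_le_distFun (v := x) (b := K + A) hf ?_ hC
    rintro ⟨a, u⟩
    obtain ⟨t, s, hts, h1, h2⟩ := F.exists_isHorizontalEdge_mem ⌊u⌋₊ a
    have h3 := le_distFun_of_mem_star (v := x) hc
      (hfs _ t s hts a h1 h2 u (Nat.floor_le zero_le) (Nat.lt_floor_add_one u).le)
    have h4 := DartGraph.dist_triangle hc x ((V t).vert (⌊u⌋₊ + 1)) ((r t).vert (⌊u⌋₊ + 1))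
    have h5 := hVr t (⌊u⌋₊ + 1)
    rw [DartGraph.dist_comm] at h5
    rw [(r t).dist_start] at h4
    have h6 : ((⌊u⌋₊ + 1 : ℕ) : ℝ) ≤ X.dist x ((V t).vert (⌊u⌋₊ + 1)) + K := by
      exact_mod_cast h4.trans (Nat.add_le_add_left h5 _)
    have h7 : (u : ℝ) ≤ ((⌊u⌋₊ + 1 : ℕ) : ℝ) := by exact_mod_cast (Nat.lt_floor_add_one u).le
    dsimp only at h3 ⊢
    linarith
  · rw [hfv 0 0 (F.zero_mem 0) u (by simp), hV0]
  · rw [hfv 0 1 (F.one_mem 0) u (by simp), hV1]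
  · exact ⟨r t, hrγ t, fun u hu => by rw [hfv m t ht u hu, hV t h0 h1]⟩
  · refine ⟨_, _, P m t s, hPw m t s, ?_, hfh m t s h⟩
    have := hVts m t s h m (Nat.le_succ m)
    rw [hPl]
    change X.dist _ _ ≤ _
    omega
  · obtain ⟨m, t, s, h, rfl⟩ := hR.exists_eq
    exact ⟨t, m + 1, _, h.isUpperLeft, hfvert (m + 1) t (F.mono m h.1),
      fun z hz => mem_ball_of_mem_frontier hfv hfh h (hlow m t s h)
        (fun t' s' => hupp m t s t' s' h) hz,
      fun z hz => hfs m t s h z.1 hz.1.1.le hz.1.2.le z.2 hz.2.1.le hz.2.2.le⟩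
  · by_cases hend : t = 0 ∨ t = 1
    · have ht0 : t ∈ F.level 0 := by
        rcases hend with rfl | rfl
        exacts [F.zero_mem 0, F.one_mem 0]
      have hceil : ⌈min u (m : ℝ≥0)⌉₊ = min ⌈u⌉₊ m := by
        rcases le_total u m with h | h
        · rw [min_eq_left h, min_eq_left (Nat.ceil_le.2 h)]
        · rw [min_eq_right h, Nat.ceil_natCast, min_eq_right]
          exact_mod_cast h.trans (Nat.le_ceil u)
      rw [hfv 0 t ht0 _ (by simp)]
      refine rayPt_mem_star hc _ ?_
      rw [hceil]
      have := (r t).dist_le_of_isGeodSeg hthin hc (hVr t) hq ⌈u⌉₊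
      change X.dist _ _ ≤ _ at this
      omega
    · have h0 : t ≠ 0 := fun h => hend (Or.inl h)
      have h1 : t ≠ 1 := fun h => hend (Or.inr h)
      rw [hV t h0 h1] at hq
      obtain rfl : m = l := ((r t).dist_start m).symm.trans hq.length_eq
      rcases le_or_gt (m : ℝ≥0) u with hu | hu
      · rw [min_eq_right hu, min_eq_right (by exact_mod_cast hu.trans (Nat.le_ceil u)),
          hfvert m t ht, hV t h0 h1, hq.2.1]
        refine vertexPt_mem_star ?_
        rw [DartGraph.dist_self]
        exact Nat.zero_le _
      · rw [min_eq_left hu.le, min_eq_left (Nat.ceil_le.2 hu.le)]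
        rcases Nat.eq_zero_or_pos ⌈u⌉₊ with h2 | h2
        · have hu0 : u = 0 := le_antisymm (Nat.ceil_eq_zero.1 h2) zero_le
          rw [h2, hu0, hf0, hq.1]
          refine vertexPt_mem_star ?_
          rw [DartGraph.dist_self]
          exact Nat.zero_le _
        -- Below the vertex `(t, m)` the point lies in a rectangle whose left side is over an interior
        -- vertex `t₀`, as the outermost rectangles are not subdivided.
        · obtain ⟨j, hj⟩ := Nat.exists_eq_succ_of_ne_zero h2.ne'
          have h3 : (j : ℝ≥0) ≤ u := (Nat.lt_ceil.1 (by omega)).le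
          have h4 : u ≤ j + 1 := by
            have := Nat.le_ceil u
            rw [hj] at this
            exact_mod_cast this
          have h5 : j + 1 ≤ m := by
            have := Nat.ceil_le.2 hu.le
            omega
          have ht1 : t < 1 := lt_of_le_of_ne t.2.2 h1
          obtain ⟨t₀, s₀, h, -, h6, h7, -⟩ := F.exists_isHorizontalEdge (F.zero_mem j) (F.one_mem j)
            t.2.1 ht1
          obtain ⟨htl, htr⟩ := hF m t ht h0 h1
          have h6' : (t₀ : ℝ) ≤ t := h6
          have h7' : (t : ℝ) < s₀ := h7
          have ht₀ : t₀ ≠ 0 ∧ t₀ ≠ 1 := by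
            refine hmid t₀ ?_ (h6'.trans htr)
            rcases hF' j t₀ s₀ h with ⟨-, h8⟩ | ⟨h8, -⟩ | ⟨h8, -⟩
            · linarith
            · rw [h8]; norm_num
            · exact h8
          have h8 := hfs j t₀ s₀ h t h6 h7.le u h3 h4
          rw [hV t₀ ht₀.1 ht₀.2] at h8
          have h9 := hclose j t₀ s₀ h t t₀ h6 h7.le le_rfl h.2.2.1.le (j + 1) le_rfl
          have h10 := hthin x _ _ q (r t).vert m m hq ((r t).isGeodSeg m) (j + 1)
            (by rw [DartGraph.dist_self, (r t).dist_start]; omega)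
          have h11 := DartGraph.dist_triangle hc (q (j + 1)) ((r t).vert (j + 1))
            ((r t₀).vert (j + 1))
          rw [hj]
          exact star_subset hc (k := 2 * δ) (h11.trans (by omega)) le_rfl h8

end TwoComplex

theorem mainTheorem2 {G : Type*} [Group G] {n : ℕ} (𝒜 : PeripheralPresentation G n)
    (δ : ℕ) (hδ : 1 ≤ δ) (hthin : 𝒜.cuspedSpace.IsThin δ) (K : ℕ) (hK : δ ≤ K) :
    (∃ A : ℕ, 𝒜.cuspedSpace.IsFillingRadius (2 * K + δ + 1) A) ∧
    ∀ A : ℕ, 𝒜.cuspedSpace.IsFillingRadius (2 * K + δ + 1) A →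
    ∀ (s₁ s₂ : 𝒜.cuspedSpace.GeodRay 𝒜.basePt), s₁.toBoundary ≠ s₂.toBoundary →
    ∀ (s₁' s₂' : 𝒜.cuspedSpace.EdgeRay), s₁'.vert 0 = 𝒜.basePt → s₂'.vert 0 = 𝒜.basePt →
    (∀ k, 𝒜.cuspedSpace.dist (s₁.vert k) (s₁'.vert k) ≤ K) →
    (∀ k, 𝒜.cuspedSpace.dist (s₂.vert k) (s₂'.vert k) ≤ K) →
    ∀ γ : Path s₁.toBoundary s₂.toBoundary,
    ∃ (F : StripFilter) (f : I × ℝ≥0 → 𝒜.cuspedSpace.Space),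
      𝒜.cuspedSpace.IsProperHomotopyRel f 𝒜.basePt s₁' s₂' ∧
      -- vertical half lines at interior vertices
      (∀ (m : ℕ), ∀ t ∈ F.level m, t ≠ 0 → t ≠ 1 →
        ∃ r : 𝒜.cuspedSpace.GeodRay 𝒜.basePt, r.toBoundary ∈ Set.range γ ∧
          ∀ u : ℝ≥0, (m : ℝ≥0) ≤ u → f (t, u) = 𝒜.cuspedSpace.rayPt r.toEdgeRay u) ∧
      -- horizontal edges
      (∀ (m : ℕ) (t s : I), F.IsHorizontalEdge m t s →
        ∃ (x y : 𝒜.cuspedSpace.V) (p : List 𝒜.cuspedSpace.D), 𝒜.cuspedSpace.IsWalk x p y ∧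
          p.length ≤ K + 2 * δ ∧
          ∀ a : I, t ≤ a → a ≤ s → f (a, (m : ℝ≥0)) =
            𝒜.cuspedSpace.walkPt x p (((a : ℝ) - t) / ((s : ℝ) - t) * p.length)) ∧
      -- complementary rectangles
      (∀ R : Set (I × ℝ≥0), F.IsRectangle R →
        ∃ (t : I) (m : ℕ) (w : 𝒜.cuspedSpace.V), F.IsUpperLeft R t m ∧
          f (t, (m : ℝ≥0)) = 𝒜.cuspedSpace.vertexPt w ∧
          (∀ z ∈ frontier R, f z ∈ 𝒜.cuspedSpace.ball (2 * K + δ + 1) w) ∧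
          ∀ z ∈ R, f z ∈ 𝒜.cuspedSpace.star A w) ∧
      -- vertical segments track geodesics
      (∀ (m : ℕ), ∀ t ∈ F.level m, ∃ w : 𝒜.cuspedSpace.V,
        f (t, (m : ℝ≥0)) = 𝒜.cuspedSpace.vertexPt w ∧
        ∀ (q : ℕ → 𝒜.cuspedSpace.V) (l : ℕ), 𝒜.cuspedSpace.IsGeodSeg q l 𝒜.basePt w →
          ∀ u : ℝ≥0, f (t, min u (m : ℝ≥0)) ∈
            𝒜.cuspedSpace.star (2 * δ + A) (q (min ⌈u⌉₊ l))) := by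
  refine ⟨PeripheralPresentation.exists_isFillingRadius 𝒜 _, ?_⟩
  intro A hA s₁ s₂ _ s₁' s₂' hx₁ hx₂ hs₁ hs₂ γ
  exact TwoComplex.exists_filter_homotopy hthin (PeripheralPresentation.connected 𝒜)
    (PeripheralPresentation.locallyFinite 𝒜) hK hA s₁ s₂ s₁' s₂' hx₁ hx₂ hs₁ hs₂ γ
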